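/- Let $R$ be a Dedekind domain with field of fractions $K$. Let $\mathcal T$ be an (essentially small) $R$-linear abelian symmetric monoidal category with $R$-bilinear tensor product, and let $\omega:\mathcal T\to\mathrm{Mod}(R)$ be an $R$-linear symmetric monoidal functor. Assume that $(\mathcal T,\omega)$ is a Tannakian category over $R$, that is: the natural map $R\to\mathrm{End}(\mathbf 1)$ is an isomorphism, every object of $\mathcal T$ is a quotient of a rigid object (an object that has a dual), and $\omega$ is exact and faithful. Let $G=\mathrm{Aut}^\otimes(\omega)$ be the group functor on commutative $R$-algebras that maps $A$ to the group of tensor automorphisms of $A\otimes_R\omega:\mathcal T\to\mathrm{Mod}(A)$. For a group functor $H$ over a ring $S$, let $\mathrm{Rep}_f(H)$ be the symmetric monoidal category of finitely generated $S$-modules $V$ with an $A$-linear action of $H(A)$ on $A\otimes_S V$, functorial in the commutative $S$-algebra $A$. Let $\mathcal T^{\rm o}\subset\mathcal T$ be the full subcategory of rigid objects, and let ${\mathcal T^{\rm o}}_K$ be its base change: the category with the same objects and with $\mathrm{Hom}_{{\mathcal T^{\rm o}}_K}(X,Y)=K\otimes_R\mathrm{Hom}_{\mathcal T}(X,Y)$.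 Let $G_K$ be the base change of $G$ to $K$. Then: (i) $G$ is a flat affine group scheme over $R$, i.e. it is represented by a commutative Hopf algebra over $R$ that is flat as an $R$-module, and restriction to $\mathcal T^{\rm o}$ is an isomorphism $\mathrm{Aut}^\otimes(\omega)\to\mathrm{Aut}^\otimes(\omega|_{\mathcal T^{\rm o}})$. The functor $\omega$ factors as $\mathcal T\to\mathrm{Rep}_f(G)\to\mathrm{Mod}(R)$, where the second functor is the forgetful one and the first maps $X$ to $\omega(X)$ with its tautological action of $G$; the first functor is an equivalence of $R$-linear symmetric monoidal categories, its tensor structure being that of $\omega$. (ii) The functor ${\mathcal T^{\rm o}}_K\to\mathrm{Rep}_f(G_K)$ induced by $\omega$, which maps $X$ to $K\otimes_R\omega(X)$ and $a\otimes f$ to $a\cdot(K\otimes_R\omega(f))$, is an equivalence of $K$-linear symmetric monoidal categories, its tensor structure being induced by that of $\omega$. -/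

import Mathlib

open CategoryTheory MonoidalCategory TensorProduct

universe w v u

noncomputable section

namespace TannakaDedekind

section Linear

variable {R : Type u} [CommRing R] {A B C : Type u} [CommRing A] [Algebra R A]
  [CommRing B] [Algebra R B] [CommRing C] [Algebra R C]
variable {M N P : Type u} [AddCommGroup M] [Module R M] [AddCommGroup N] [Module R N]
  [AddCommGroup P] [Module R P]

/-- The map `φ ⊗ M : A ⊗ M → B ⊗ M` induced by a homomorphism `φ : A → B` of `R`-algebras. -/
abbrev scalarMap (φ : A →ₐ[R] B) (M : Type u) [AddCommGroup M] [Module R M] :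
    A ⊗[R] M →ₗ[R] B ⊗[R] M :=
  φ.toLinearMap.rTensor M

/-- Base change of an `A`-linear endomorphism of `A ⊗ M` along `φ : A → B`: the `B`-linear
endomorphism of `B ⊗ M` with `1 ⊗ m ↦ (φ ⊗ M) (g (1 ⊗ m))`. -/
def endMapFun (φ : A →ₐ[R] B) (g : Module.End A (A ⊗[R] M)) : Module.End B (B ⊗[R] M) :=
  LinearMap.liftBaseChange B
    (scalarMap φ M ∘ₗ g.restrictScalars R ∘ₗ TensorProduct.mk R A M 1)

theorem scalarMap_smul (φ : A →ₐ[R] B) (a : A) (x : A ⊗[R] M) :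
    scalarMap φ M (a • x) = φ a • scalarMap φ M x := by
  induction x with
  | zero => simp
  | tmul b m => simp [TensorProduct.smul_tmul']
  | add x y hx hy => simp only [smul_add, map_add, hx, hy]

theorem endMapFun_scalarMap (φ : A →ₐ[R] B) (g : Module.End A (A ⊗[R] M)) (x : A ⊗[R] M) :
    endMapFun φ g (scalarMap φ M x) = scalarMap φ M (g x) := by
  induction x with
  | zero => simp
  | tmul a m =>
    have h : a ⊗ₜ[R] m = a • ((1 : A) ⊗ₜ[R] m) := by simp [TensorProduct.smul_tmul']
    rw [h, scalarMap_smul, map_smul, map_smul, scalarMap_smul]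
    simp [endMapFun]
  | add x y hx hy => simp only [map_add, hx, hy]

theorem ext_scalarMap {Q : Type*} [AddCommGroup Q] [Module B Q] (φ : A →ₐ[R] B)
    {f g : B ⊗[R] M →ₗ[B] Q} (h : ∀ x, f (scalarMap φ M x) = g (scalarMap φ M x)) : f = g := by
  refine LinearMap.ext fun z => ?_
  induction z with
  | zero => simp
  | add z z' hz hz' => simp only [map_add, hz, hz']
  | tmul b m =>
    have hb : b ⊗ₜ[R] m = b • scalarMap φ M (1 ⊗ₜ m) := by simp [TensorProduct.smul_tmul']
    rw [hb, map_smul, map_smul, h]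

/-- Base change of endomorphisms as a homomorphism of monoids. -/
def endMap (φ : A →ₐ[R] B) (M : Type u) [AddCommGroup M] [Module R M] :
    Module.End A (A ⊗[R] M) →* Module.End B (B ⊗[R] M) where
  toFun := endMapFun φ
  map_one' := ext_scalarMap φ fun x => by rw [endMapFun_scalarMap]; rfl
  map_mul' f g := ext_scalarMap φ fun x => by
    rw [endMapFun_scalarMap, Module.End.mul_apply, Module.End.mul_apply, endMapFun_scalarMap,
      endMapFun_scalarMap]

/-- The group homomorphism `GL(M)(A) → GL(M)(B)`, where `GL(M)(A) = Aut_A(A ⊗ M)`, induced by a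
homomorphism `φ : A → B`. -/
def glMap (φ : A →ₐ[R] B) (M : Type u) [AddCommGroup M] [Module R M] :
    LinearMap.GeneralLinearGroup A (A ⊗[R] M) →* LinearMap.GeneralLinearGroup B (B ⊗[R] M) :=
  Units.map (endMap φ M)

theorem glMap_scalarMap (φ : A →ₐ[R] B) (g : LinearMap.GeneralLinearGroup A (A ⊗[R] M))
    (x : A ⊗[R] M) :
    (glMap φ M g).1 (scalarMap φ M x) = scalarMap φ M (g.1 x) :=
  endMapFun_scalarMap φ g.1 x

theorem glMap_id : glMap (AlgHom.id R A) M = MonoidHom.id _ := by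
  refine MonoidHom.ext fun g => Units.ext (ext_scalarMap (AlgHom.id R A) fun x => ?_)
  have h : ∀ x, scalarMap (AlgHom.id R A) M x = x := fun x => LinearMap.rTensor_id_apply _ _ x
  rw [glMap_scalarMap, h, h]
  rfl

theorem glMap_comp (φ : A →ₐ[R] B) (ψ : B →ₐ[R] C) :
    glMap (ψ.comp φ) M = (glMap ψ M).comp (glMap φ M) := by
  refine MonoidHom.ext fun g => Units.ext (ext_scalarMap (ψ.comp φ) fun x => ?_)
  have h : ∀ x, scalarMap (ψ.comp φ) M x = scalarMap ψ M (scalarMap φ M x) := by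
    intro x
    induction x with
    | zero => simp
    | tmul a m => simp
    | add x y hx hy => simp only [map_add, hx, hy]
  have e : ((glMap ψ M).comp (glMap φ M)) g = glMap ψ M (glMap φ M g) := rfl
  rw [e, glMap_scalarMap, h, h, glMap_scalarMap, glMap_scalarMap]

theorem baseChange_scalarMap (φ : A →ₐ[R] B) (f : M →ₗ[R] N) (x : A ⊗[R] M) :
    f.baseChange B (scalarMap φ M x) = scalarMap φ N (f.baseChange A x) := by
  induction x with
  | zero => simp
  | tmul a m => simp
  | add x y hx hy => simp only [map_add, hx, hy]

/-- Base change preserves the relation `f ∘ g = h ∘ f` for an `R`-linear map `f`. -/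
theorem glMap_comm (φ : A →ₐ[R] B) (f : M →ₗ[R] N) {g : LinearMap.GeneralLinearGroup A (A ⊗[R] M)}
    {h : LinearMap.GeneralLinearGroup A (A ⊗[R] N)}
    (H : ∀ x, f.baseChange A (g.1 x) = h.1 (f.baseChange A x)) (y : B ⊗[R] M) :
    f.baseChange B ((glMap φ M g).1 y) = (glMap φ N h).1 (f.baseChange B y) := by
  have key : f.baseChange B ∘ₗ (glMap φ M g).1 = (glMap φ N h).1 ∘ₗ f.baseChange B := by
    refine ext_scalarMap φ fun x => ?_
    rw [LinearMap.comp_apply, LinearMap.comp_apply, glMap_scalarMap, baseChange_scalarMap,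
      baseChange_scalarMap, glMap_scalarMap, H]
  exact LinearMap.congr_fun key y

/-- The tensor product over `A`, seen as `(A ⊗ M) × (A ⊗ N) → A ⊗ (M ⊗ N)`. -/
def pair (x : A ⊗[R] M) (y : A ⊗[R] N) : A ⊗[R] (M ⊗[R] N) :=
  (AlgebraTensorModule.distribBaseChange R A M N).symm (x ⊗ₜ[A] y)

@[simp]
theorem pair_tmul (a b : A) (m : M) (n : N) :
    pair (a ⊗ₜ[R] m) (b ⊗ₜ[R] n) = (a * b) ⊗ₜ[R] (m ⊗ₜ[R] n) :=
  AlgebraTensorModule.distribBaseChange_symm_tmul ..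

theorem pair_add_left (x x' : A ⊗[R] M) (y : A ⊗[R] N) :
    pair (x + x') y = pair x y + pair x' y := by
  simp [pair, TensorProduct.add_tmul]

theorem pair_add_right (x : A ⊗[R] M) (y y' : A ⊗[R] N) :
    pair x (y + y') = pair x y + pair x y' := by
  simp [pair, TensorProduct.tmul_add]

@[simp]
theorem pair_zero_left (y : A ⊗[R] N) : pair (0 : A ⊗[R] M) y = 0 := by simp [pair]

@[simp]
theorem pair_zero_right (x : A ⊗[R] M) : pair x (0 : A ⊗[R] N) = 0 := by simp [pair]

theorem ext_pair {Q : Type*} [AddCommGroup Q] [Module A Q]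
    {f g : A ⊗[R] (M ⊗[R] N) →ₗ[A] Q} (h : ∀ x y, f (pair x y) = g (pair x y)) : f = g := by
  have h' : f ∘ₗ (AlgebraTensorModule.distribBaseChange R A M N).symm.toLinearMap =
      g ∘ₗ (AlgebraTensorModule.distribBaseChange R A M N).symm.toLinearMap :=
    TensorProduct.ext' h
  refine LinearMap.ext fun z => ?_
  simpa using LinearMap.congr_fun h' (AlgebraTensorModule.distribBaseChange R A M N z)

/-- For `A`-linear maps `f` and `g` out of `A ⊗ M` and `A ⊗ N`, the `A`-linear map `f ⊗_A g` under
the identification `A ⊗ (M ⊗ N) ≃ (A ⊗ M) ⊗_A (A ⊗ N)`. -/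
def endTensor (f : Module.End A (A ⊗[R] M)) (g : Module.End A (A ⊗[R] N)) :
    Module.End A (A ⊗[R] (M ⊗[R] N)) :=
  (AlgebraTensorModule.distribBaseChange R A M N).symm.toLinearMap ∘ₗ TensorProduct.map f g ∘ₗ
    (AlgebraTensorModule.distribBaseChange R A M N).toLinearMap

@[simp]
theorem endTensor_pair (f : Module.End A (A ⊗[R] M)) (g : Module.End A (A ⊗[R] N))
    (x : A ⊗[R] M) (y : A ⊗[R] N) : endTensor f g (pair x y) = pair (f x) (g y) := by
  simp [endTensor, pair]

/-- The homomorphism `GL(M)(A) × GL(N)(A) → GL(M ⊗ N)(A)`. -/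
def glTensor : LinearMap.GeneralLinearGroup A (A ⊗[R] M) ×
    LinearMap.GeneralLinearGroup A (A ⊗[R] N) →*
      LinearMap.GeneralLinearGroup A (A ⊗[R] (M ⊗[R] N)) :=
  (Units.map
    { toFun := fun p : Module.End A (A ⊗[R] M) × Module.End A (A ⊗[R] N) => endTensor p.1 p.2
      map_one' := ext_pair fun x y => by simp
      map_mul' := fun p q => ext_pair fun x y => by simp }).comp
    MulEquiv.prodUnits.symm.toMonoidHom

@[simp]
theorem glTensor_pair (f : LinearMap.GeneralLinearGroup A (A ⊗[R] M))
    (g : LinearMap.GeneralLinearGroup A (A ⊗[R] N)) (x : A ⊗[R] M) (y : A ⊗[R] N) :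
    (glTensor (f, g)).1 (pair x y) = pair (f.1 x) (g.1 y) :=
  endTensor_pair f.1 g.1 x y

theorem glTensor_val (f : LinearMap.GeneralLinearGroup A (A ⊗[R] M))
    (g : LinearMap.GeneralLinearGroup A (A ⊗[R] N)) :
    (glTensor (f, g)).1 = endTensor f.1 g.1 := rfl

theorem scalarMap_pair (φ : A →ₐ[R] B) (x : A ⊗[R] M) (y : A ⊗[R] N) :
    scalarMap φ (M ⊗[R] N) (pair x y) = pair (scalarMap φ M x) (scalarMap φ N y) := by
  induction x with
  | zero => simp
  | add x x' hx hx' => simp only [pair_add_left, map_add, hx, hx']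
  | tmul a m =>
    induction y with
    | zero => simp
    | add y y' hy hy' => simp only [pair_add_right, map_add, hy, hy']
    | tmul b n => simp

theorem pair_induction {p : A ⊗[R] (M ⊗[R] N) → Prop} (h0 : p 0)
    (h : ∀ x y, p (pair x y)) (hadd : ∀ z z', p z → p z' → p (z + z')) (z) : p z := by
  induction z with
  | zero => exact h0
  | add z z' hz hz' => exact hadd z z' hz hz'
  | tmul a t =>
    induction t with
    | zero => simpa using h0
    | add t t' ht ht' => simpa [TensorProduct.tmul_add] using hadd _ _ ht ht'
    | tmul m n => simpa using h (a ⊗ₜ m) (1 ⊗ₜ n)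

theorem glMap_glTensor (φ : A →ₐ[R] B) (f : LinearMap.GeneralLinearGroup A (A ⊗[R] M))
    (g : LinearMap.GeneralLinearGroup A (A ⊗[R] N)) :
    glMap φ (M ⊗[R] N) (glTensor (f, g)) = glTensor (glMap φ M f, glMap φ N g) := by
  refine Units.ext (ext_scalarMap φ fun z => ?_)
  rw [glMap_scalarMap]
  induction z using pair_induction with
  | h0 => simp
  | hadd z z' hz hz' => simp only [map_add, hz, hz']
  | h x y => rw [glTensor_pair, scalarMap_pair, scalarMap_pair, glTensor_pair, glMap_scalarMap,
      glMap_scalarMap]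

theorem baseChange_map_pair {M' N' : Type u} [AddCommGroup M'] [Module R M'] [AddCommGroup N']
    [Module R N'] (f : M →ₗ[R] M') (g : N →ₗ[R] N') (x : A ⊗[R] M) (y : A ⊗[R] N) :
    (TensorProduct.map f g).baseChange A (pair x y) =
      pair (f.baseChange A x) (g.baseChange A y) := by
  induction x with
  | zero => simp
  | add x x' hx hx' => simp only [pair_add_left, map_add, hx, hx']
  | tmul a m =>
    induction y with
    | zero => simp
    | add y y' hy hy' => simp only [pair_add_right, map_add, hy, hy']
    | tmul b n => simp

theorem baseChange_assoc_pair (x : A ⊗[R] M) (y : A ⊗[R] N) (z : A ⊗[R] P) :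
    (TensorProduct.assoc R M N P).toLinearMap.baseChange A (pair (pair x y) z) =
      pair x (pair y z) := by
  induction x with
  | zero => simp
  | add x x' hx hx' => simp only [pair_add_left, map_add, hx, hx']
  | tmul a m =>
    induction y with
    | zero => simp
    | add y y' hy hy' => simp only [pair_add_left, pair_add_right, map_add, hy, hy']
    | tmul b n =>
      induction z with
      | zero => simp
      | add y y' hy hy' => simp only [pair_add_right, map_add, hy, hy']
      | tmul c p => simp [mul_assoc]

theorem ext_pair₃ {Q : Type*} [AddCommGroup Q] [Module A Q]
    {f g : A ⊗[R] ((M ⊗[R] N) ⊗[R] P) →ₗ[A] Q}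
    (h : ∀ x y z, f (pair (pair x y) z) = g (pair (pair x y) z)) : f = g := by
  refine ext_pair fun x z => ?_
  have hw : ∀ w, f (pair w z) = g (pair w z) := by
    intro w
    let p : A ⊗[R] (M ⊗[R] N) →ₗ[A] A ⊗[R] ((M ⊗[R] N) ⊗[R] P) :=
      (AlgebraTensorModule.distribBaseChange R A (M ⊗[R] N) P).symm.toLinearMap ∘ₗ
        (TensorProduct.mk A _ _).flip z
    exact LinearMap.congr_fun (ext_pair (f := f ∘ₗ p) (g := g ∘ₗ p) fun x y => h x y z) w
  exact hw x

theorem baseChange_comm_pair (x : A ⊗[R] M) (y : A ⊗[R] N) :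
    (TensorProduct.comm R M N).toLinearMap.baseChange A (pair x y) = pair y x := by
  induction x with
  | zero => simp
  | add x x' hx hx' => simp only [pair_add_left, pair_add_right, map_add, hx, hx']
  | tmul a m =>
    induction y with
    | zero => simp
    | add y y' hy hy' => simp only [pair_add_left, pair_add_right, map_add, hy, hy']
    | tmul b n => simp [mul_comm]

theorem baseChange_lid_pair (x : A ⊗[R] R) (y : A ⊗[R] M) :
    (TensorProduct.lid R M).toLinearMap.baseChange A (pair x y) =
      AlgebraTensorModule.rid R A A x • y := by
  induction x with
  | zero => simp
  | add x x' hx hx' => simp only [pair_add_left, map_add, hx, hx', add_smul]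
  | tmul a m =>
    induction y with
    | zero => simp
    | add y y' hy hy' => simp only [pair_add_right, map_add, hy, hy', smul_add]
    | tmul b n => simp [TensorProduct.smul_tmul']

theorem baseChange_rid_pair (x : A ⊗[R] M) (y : A ⊗[R] R) :
    (TensorProduct.rid R M).toLinearMap.baseChange A (pair x y) =
      AlgebraTensorModule.rid R A A y • x := by
  induction x with
  | zero => simp
  | add x x' hx hx' => simp only [pair_add_left, map_add, hx, hx', smul_add]
  | tmul a m =>
    induction y with
    | zero => simp
    | add y y' hy hy' => simp only [pair_add_right, map_add, hy, hy', add_smul]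
    | tmul b n => simp [TensorProduct.smul_tmul', mul_comm]

end Linear

/-- A group functor over `R`: a functor from commutative `R`-algebras to groups. -/
abbrev GroupFunctor (R : Type u) [CommRing R] := CommAlgCat.{u} R ⥤ GrpCat.{w}

section AffineGroup

variable {R : Type u} [CommRing R]

/-- `G` is a flat affine group scheme over `R`, seen as a group functor: it is represented by a
commutative Hopf algebra `L` that is flat over `R`, in the sense that there are isomorphisms of
groups `Hom_{R-alg}(L, A) ≃ G(A)`, natural in `A`, where `Hom_{R-alg}(L, A)` has the convolution
product. -/
def IsFlatAffineGroupScheme (G : GroupFunctor.{w} R) : Prop :=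
  ∃ L : CommHopfAlgCat.{u} R, Module.Flat R L ∧
    ∃ e : ∀ A : CommAlgCat.{u} R, WithConv (L →ₐ[R] A) ≃* G.obj A,
      ∀ (A B : CommAlgCat.{u} R) (φ : A ⟶ B) (f : L →ₐ[R] A),
        e B (WithConv.toConv (φ.hom.comp f)) = G.map φ (e A (WithConv.toConv f))

/-- A finite representation of a group functor `G` over `R`: a finitely generated `R`-module `V`
with actions of `G(A)` on `A ⊗ V` by `A`-linear automorphisms, functorial in the commutative
`R`-algebra `A`. -/
structure FinRep (G : GroupFunctor.{w} R) where
  /-- the underlying module -/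
  V : Type u
  [addCommGroup : AddCommGroup V]
  [module : Module R V]
  [finite : Module.Finite R V]
  /-- the action -/
  ρ : ∀ A : CommAlgCat.{u} R, G.obj A →* LinearMap.GeneralLinearGroup A (A ⊗[R] V)
  naturality : ∀ {A B : CommAlgCat.{u} R} (φ : A ⟶ B) (g : G.obj A),
    ρ B (G.map φ g) = glMap φ.hom V (ρ A g)

attribute [instance] FinRep.addCommGroup FinRep.module FinRep.finite

namespace FinRep

variable {G : GroupFunctor.{w} R}

/-- Homomorphisms of representations: the linear maps that commute with the action. -/
@[ext]
structure Hom (X Y : FinRep G) where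
  /-- the underlying linear map -/
  hom : X.V →ₗ[R] Y.V
  comm : ∀ (A : CommAlgCat.{u} R) (g : G.obj A) (x : A ⊗[R] X.V),
    hom.baseChange A ((X.ρ A g).1 x) = (Y.ρ A g).1 (hom.baseChange A x)

instance : Category (FinRep G) where
  Hom := Hom
  id X := ⟨LinearMap.id, fun A g x => by simp⟩
  comp f g := ⟨g.hom ∘ₗ f.hom, fun A a x => by
    rw [LinearMap.baseChange_comp, LinearMap.comp_apply, LinearMap.comp_apply, f.comm, g.comm]⟩

@[ext]
theorem hom_ext {X Y : FinRep G} {f g : X ⟶ Y} (h : f.hom = g.hom) : f = g := Hom.ext h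

@[simp] theorem id_hom (X : FinRep G) : (𝟙 X : X ⟶ X).hom = LinearMap.id := rfl

@[simp] theorem comp_hom {X Y Z : FinRep G} (f : X ⟶ Y) (g : Y ⟶ Z) :
    (f ≫ g).hom = g.hom ∘ₗ f.hom := rfl

variable (G) in
/-- The forgetful functor to modules. -/
@[simps]
def forget : FinRep G ⥤ ModuleCat.{u} R where
  obj X := ModuleCat.of R X.V
  map f := ModuleCat.ofHom f.hom

instance : (forget G).Faithful where
  map_injective h := hom_ext (congrArg ModuleCat.Hom.hom h)

instance {X Y : FinRep G} : Zero (X ⟶ Y) := ⟨⟨0, fun A g x => by simp⟩⟩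
instance {X Y : FinRep G} : Add (X ⟶ Y) :=
  ⟨fun f g => ⟨f.hom + g.hom, fun A a x => by simp [LinearMap.baseChange_add, f.comm, g.comm]⟩⟩
instance {X Y : FinRep G} : Neg (X ⟶ Y) :=
  ⟨fun f => ⟨-f.hom, fun A a x => by simp [LinearMap.baseChange_neg, f.comm]⟩⟩
instance {X Y : FinRep G} : Sub (X ⟶ Y) :=
  ⟨fun f g => ⟨f.hom - g.hom, fun A a x => by simp [LinearMap.baseChange_sub, f.comm, g.comm]⟩⟩
instance {X Y : FinRep G} : SMul R (X ⟶ Y) :=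
  ⟨fun r f => ⟨r • f.hom, fun A a x => by
    rw [LinearMap.baseChange_smul, LinearMap.smul_apply, LinearMap.smul_apply,
      f.comm]
    simp only [← algebraMap_smul A r, map_smul]⟩⟩

@[simp] theorem zero_hom {X Y : FinRep G} : (0 : X ⟶ Y).hom = 0 := rfl
@[simp] theorem add_hom {X Y : FinRep G} (f g : X ⟶ Y) : (f + g).hom = f.hom + g.hom := rfl
@[simp] theorem smul_hom {X Y : FinRep G} (r : R) (f : X ⟶ Y) : (r • f).hom = r • f.hom := rfl

instance : Preadditive (FinRep G) where
  homGroup _ _ :=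
    { add_assoc := fun f g h => hom_ext (add_assoc f.hom g.hom h.hom)
      zero_add := fun f => hom_ext (zero_add f.hom)
      add_zero := fun f => hom_ext (add_zero f.hom)
      neg_add_cancel := fun f => hom_ext (neg_add_cancel f.hom)
      add_comm := fun f g => hom_ext (add_comm f.hom g.hom)
      sub_eq_add_neg := fun f g => hom_ext (sub_eq_add_neg f.hom g.hom)
      nsmul := nsmulRec
      zsmul := zsmulRec }
  add_comp _ _ _ f f' g := hom_ext (LinearMap.comp_add f.hom f'.hom g.hom)
  comp_add _ _ _ f g g' := hom_ext (LinearMap.add_comp _ _ _)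

instance : Linear R (FinRep G) where
  homModule _ _ :=
    { one_smul := fun f => hom_ext (one_smul R f.hom)
      mul_smul := fun r s f => hom_ext (mul_smul r s f.hom)
      smul_zero := fun r => hom_ext (smul_zero r)
      smul_add := fun r f g => hom_ext (smul_add r f.hom g.hom)
      add_smul := fun r s f => hom_ext (add_smul r s f.hom)
      zero_smul := fun f => hom_ext (zero_smul R f.hom) }
  smul_comp _ _ _ r f g := hom_ext (LinearMap.comp_smul g.hom r f.hom)
  comp_smul _ _ _ f r g := hom_ext (LinearMap.smul_comp r g.hom f.hom)

instance : (forget G).Additive where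
instance : (forget G).Linear R where

/-- An isomorphism of the underlying modules that commutes with the action is an isomorphism. -/
@[simps]
def isoMk {X Y : FinRep G} (e : X.V ≃ₗ[R] Y.V)
    (h : ∀ (A : CommAlgCat.{u} R) (g : G.obj A) (x : A ⊗[R] X.V),
      e.toLinearMap.baseChange A ((X.ρ A g).1 x) = (Y.ρ A g).1 (e.toLinearMap.baseChange A x)) :
    X ≅ Y where
  hom := ⟨e.toLinearMap, h⟩
  inv := ⟨e.symm.toLinearMap, fun A g y => by
    have hl : ∀ x, e.symm.toLinearMap.baseChange A (e.toLinearMap.baseChange A x) = x := fun x => by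
      rw [← LinearMap.comp_apply, ← LinearMap.baseChange_comp]
      simp
    have hr : ∀ x, e.toLinearMap.baseChange A (e.symm.toLinearMap.baseChange A x) = x := fun x => by
      rw [← LinearMap.comp_apply, ← LinearMap.baseChange_comp]
      simp
    rw [← hl ((X.ρ A g).1 (e.symm.toLinearMap.baseChange A y)), h, hr]⟩
  hom_inv_id := hom_ext (by ext; simp)
  inv_hom_id := hom_ext (by ext; simp)

/-- The tensor product of representations, `g` acting on `A ⊗ (V ⊗ W) ≃ (A ⊗ V) ⊗_A (A ⊗ W)` by
`g ⊗_A g`. -/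
abbrev tensor (X Y : FinRep G) : FinRep G where
  V := X.V ⊗[R] Y.V
  ρ A := glTensor.comp ((X.ρ A).prod (Y.ρ A))
  naturality {A B} φ g := by
    simp only [MonoidHom.comp_apply, MonoidHom.prod_apply, X.naturality, Y.naturality,
      glMap_glTensor]

/-- The trivial representation on `R`. -/
abbrev unit : FinRep G where
  V := R
  ρ A := 1
  naturality φ g := by simp

theorem tensor_ρ_pair (X Y : FinRep G) (A : CommAlgCat.{u} R) (g : G.obj A) (x : A ⊗[R] X.V)
    (y : A ⊗[R] Y.V) :
    ((tensor X Y).ρ A g).1 (pair x y) = pair ((X.ρ A g).1 x) ((Y.ρ A g).1 y) :=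
  glTensor_pair _ _ x y

/-- To check that a map out of a tensor product of representations is equivariant, it is enough to
consider pairs. -/
theorem comm_of_pair {X Y Z : FinRep G} (f : X.V ⊗[R] Y.V →ₗ[R] Z.V)
    (h : ∀ (A : CommAlgCat.{u} R) (g : G.obj A) (x : A ⊗[R] X.V) (y : A ⊗[R] Y.V),
      f.baseChange A (pair ((X.ρ A g).1 x) ((Y.ρ A g).1 y)) =
        (Z.ρ A g).1 (f.baseChange A (pair x y)))
    (A : CommAlgCat.{u} R) (g : G.obj A) (z : A ⊗[R] (X.V ⊗[R] Y.V)) :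
    f.baseChange A (((tensor X Y).ρ A g).1 z) = (Z.ρ A g).1 (f.baseChange A z) := by
  induction z using pair_induction with
  | h0 => simp only [map_zero]
  | hadd z z' hz hz' => simp only [map_add, hz, hz']
  | h x y => rw [tensor_ρ_pair]; exact h A g x y

/-- The tensor product of homomorphisms. -/
@[simps]
def tensorMap {X X' Y Y' : FinRep G} (f : X ⟶ X') (g : Y ⟶ Y') : tensor X Y ⟶ tensor X' Y' where
  hom := TensorProduct.map f.hom g.hom
  comm := comm_of_pair _ fun A a x y => by
    rw [baseChange_map_pair, baseChange_map_pair, tensor_ρ_pair, f.comm, g.comm]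

/-- The associativity constraint. -/
def assoc (X Y Z : FinRep G) : tensor (tensor X Y) Z ≅ tensor X (tensor Y Z) :=
  isoMk (TensorProduct.assoc R X.V Y.V Z.V) <| comm_of_pair (X := tensor X Y) _ fun A g w z => by
    induction w using pair_induction with
    | h0 => simp only [map_zero, pair_zero_left]
    | hadd w w' h h' => simp only [map_add, pair_add_left, h, h']
    | h x y => rw [tensor_ρ_pair, baseChange_assoc_pair, baseChange_assoc_pair, tensor_ρ_pair,
        tensor_ρ_pair]

/-- The left unit constraint. -/
def leftUnit (X : FinRep G) : tensor unit X ≅ X :=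
  isoMk (TensorProduct.lid R X.V) <| comm_of_pair (X := unit) _ fun A g x y => by
    rw [baseChange_lid_pair, baseChange_lid_pair, map_smul]
    rfl

/-- The right unit constraint. -/
def rightUnit (X : FinRep G) : tensor X unit ≅ X :=
  isoMk (TensorProduct.rid R X.V) <| comm_of_pair (Y := unit) _ fun A g x y => by
    rw [baseChange_rid_pair, baseChange_rid_pair, map_smul]
    rfl

/-- The commutativity constraint. -/
def comm (X Y : FinRep G) : tensor X Y ≅ tensor Y X :=
  isoMk (TensorProduct.comm R X.V Y.V) <| comm_of_pair _ fun A g x y => by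
    rw [baseChange_comm_pair, baseChange_comm_pair, tensor_ρ_pair]

instance : MonoidalCategoryStruct (FinRep G) where
  tensorObj := tensor
  tensorUnit := unit
  tensorHom := tensorMap
  whiskerLeft X _ _ f := tensorMap (𝟙 X) f
  whiskerRight f Y := tensorMap f (𝟙 Y)
  associator := assoc
  leftUnitor := leftUnit
  rightUnitor := rightUnit

/-- The tensor structure of `FinRep G` lies over that of modules. -/
def inducingData : Monoidal.InducingFunctorData (forget G) where
  μIso _ _ := Iso.refl _
  εIso := Iso.refl _
  whiskerLeft_eq _ _ _ _ := rfl
  whiskerRight_eq _ _ := rfl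
  tensorHom_eq _ _ := rfl
  associator_eq X Y Z := by
    ext : 1
    exact TensorProduct.ext_threefold fun _ _ _ => rfl
  leftUnitor_eq _ := by
    ext : 1
    exact TensorProduct.ext' fun _ _ => rfl
  rightUnitor_eq _ := by
    ext : 1
    exact TensorProduct.ext' fun _ _ => rfl

instance : MonoidalCategory (FinRep G) := Monoidal.induced (forget G) inducingData

instance : (forget G).Monoidal :=
  (Monoidal.fromInducedCoreMonoidal (forget G) inducingData).toMonoidal

instance : BraidedCategory (FinRep G) :=
  .ofFaithful (forget G) comm fun X Y => by
    ext : 1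
    exact TensorProduct.ext' fun _ _ => rfl

instance : (forget G).Braided where
  braided X Y := by
    ext : 1
    exact TensorProduct.ext' fun _ _ => rfl

instance : SymmetricCategory (FinRep G) := .ofFaithful (forget G)

end FinRep
end AffineGroup

section TensorAut

variable {R : Type u} [CommRing R] {T : Type w} [Category.{v} T] [MonoidalCategory T]

/-- For a monoidal functor `ω : T ⥤ Mod(R)` and a commutative `R`-algebra `A`, the group of tensor
automorphisms of `A ⊗ ω : T ⥤ Mod(A)`: families of `A`-linear automorphisms of `A ⊗ ω(X)` which
are natural in `X` and compatible with tensor products and with the unit object. -/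
def tensorAut (ω : T ⥤ ModuleCat.{u} R) [ω.Monoidal] (A : Type u) [CommRing A] [Algebra R A] :
    Subgroup (∀ X : T, LinearMap.GeneralLinearGroup A (A ⊗[R] ω.obj X)) where
  carrier := {g |
    (∀ {X Y : T} (f : X ⟶ Y) (x : A ⊗[R] ω.obj X),
      (ω.map f).hom.baseChange A ((g X).1 x) = (g Y).1 ((ω.map f).hom.baseChange A x)) ∧
    (∀ (X Y : T) (x : A ⊗[R] (ω.obj X ⊗[R] ω.obj Y)),
      (Functor.LaxMonoidal.μ ω X Y).hom.baseChange A ((glTensor (g X, g Y)).1 x) =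
        (g (X ⊗ Y)).1 ((Functor.LaxMonoidal.μ ω X Y).hom.baseChange A x)) ∧
    (∀ x : A ⊗[R] R,
      (Functor.LaxMonoidal.ε ω).hom.baseChange A x =
        (g (𝟙_ T)).1 ((Functor.LaxMonoidal.ε ω).hom.baseChange A x))}
  one_mem' := by
    refine ⟨fun f x => rfl, fun X Y x => ?_, fun x => rfl⟩
    have : glTensor ((1 : ∀ X : T, LinearMap.GeneralLinearGroup A (A ⊗[R] ω.obj X)) X,
      (1 : ∀ X : T, LinearMap.GeneralLinearGroup A (A ⊗[R] ω.obj X)) Y) = 1 := map_one glTensor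
    rw [this]
    rfl
  mul_mem' {g h} hg hh := by
    refine ⟨fun {X Y} f x => ?_, fun X Y x => ?_, fun x => ?_⟩
    · change (ω.map f).hom.baseChange A ((g X).1 ((h X).1 x)) = (g Y).1 ((h Y).1 _)
      rw [hg.1, hh.1]
    · have : glTensor ((g * h) X, (g * h) Y) = glTensor (g X, g Y) * glTensor (h X, h Y) :=
        map_mul glTensor (g X, g Y) (h X, h Y)
      rw [this]
      change _ = (g _).1 ((h _).1 _)
      rw [← hh.2.1, ← hg.2.1]
      rfl
    · change _ = (g _).1 ((h _).1 _)
      rw [← hh.2.2, ← hg.2.2]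
  inv_mem' {g} hg := by
    have inv_apply : ∀ {M : Type u} [AddCommGroup M] [Module A M]
        (a : LinearMap.GeneralLinearGroup A M) (x : M), (a⁻¹).1 (a.1 x) = x := by
      intro M _ _ a x
      rw [← Module.End.mul_apply, ← Units.val_mul, inv_mul_cancel]
      rfl
    have apply_inv : ∀ {M : Type u} [AddCommGroup M] [Module A M]
        (a : LinearMap.GeneralLinearGroup A M) (x : M), a.1 ((a⁻¹).1 x) = x := by
      intro M _ _ a x
      rw [← Module.End.mul_apply, ← Units.val_mul, mul_inv_cancel]
      rfl
    refine ⟨fun {X Y} f x => ?_, fun X Y x => ?_, fun x => ?_⟩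
    · rw [Pi.inv_apply, Pi.inv_apply, ← inv_apply (g Y) (LinearMap.baseChange A _ _), ← hg.1,
        apply_inv]
    · have : glTensor (g⁻¹ X, g⁻¹ Y) = (glTensor (g X, g Y))⁻¹ := map_inv glTensor (g X, g Y)
      rw [this, Pi.inv_apply, ← inv_apply (g _) (LinearMap.baseChange A _ _), ← hg.2.1, apply_inv]
    · rw [Pi.inv_apply]
      conv_rhs => rw [hg.2.2, inv_apply]

/-- The group functor `Aut^⊗(ω)`, `A ↦ Aut^⊗(A ⊗ ω)`. -/
def tensorAutFunctor (ω : T ⥤ ModuleCat.{u} R) [ω.Monoidal] : GroupFunctor.{max w u} R where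
  obj A := GrpCat.of (tensorAut ω A)
  map {A B} φ := GrpCat.ofHom
    { toFun := fun g => ⟨fun X => glMap φ.hom (ω.obj X) (g.1 X),
        fun f => glMap_comm φ.hom (ω.map f).hom (g.2.1 f),
        fun X Y x => by
          have := glMap_comm φ.hom (M := ω.obj X ⊗[R] ω.obj Y)
            (Functor.LaxMonoidal.μ ω X Y).hom (g.2.2.1 X Y) x
          rwa [glMap_glTensor] at this,
        fun x => by
          have := glMap_comm φ.hom (M := R) (g := 1) (Functor.LaxMonoidal.ε ω).hom g.2.2.2 x
          rwa [map_one] at this⟩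
      map_one' := Subtype.ext (funext fun X => map_one _)
      map_mul' := fun g h => Subtype.ext (funext fun X => map_mul _ _ _) }
  map_id A := by
    refine GrpCat.hom_ext (MonoidHom.ext fun g => Subtype.ext (funext fun X => ?_))
    exact DFunLike.congr_fun glMap_id (g.1 X)
  map_comp {A B C} φ ψ := by
    refine GrpCat.hom_ext (MonoidHom.ext fun g => Subtype.ext (funext fun X => ?_))
    exact DFunLike.congr_fun (glMap_comp φ.hom ψ.hom) (g.1 X)

/-- The restriction homomorphism `Aut^⊗(A ⊗ ω) → Aut^⊗(A ⊗ ω')`, where `ω'` is the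
restriction of `ω` along a monoidal functor. -/
def tensorAutRestrict {T' : Type*} [Category T'] [MonoidalCategory T'] (i : T' ⥤ T) [i.Monoidal]
    (ω : T ⥤ ModuleCat.{u} R) [ω.Monoidal] (A : Type u) [CommRing A] [Algebra R A] :
    tensorAut ω A →* tensorAut (i ⋙ ω) A where
  toFun g := ⟨fun X => g.1 (i.obj X), fun f => g.2.1 (i.map f),
    fun X Y x => by
      rw [Functor.LaxMonoidal.comp_μ, ModuleCat.hom_comp]
      have h₁ := g.2.2.1 (i.obj X) (i.obj Y) x
      have h₂ := g.2.1 (Functor.LaxMonoidal.μ i X Y)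
      simp only [LinearMap.baseChange_comp, LinearMap.comp_apply]
      exact (congrArg _ h₁).trans (h₂ _),
    fun x => by
      rw [Functor.LaxMonoidal.comp_ε, ModuleCat.hom_comp]
      have h₁ := g.2.2.2 x
      have h₂ := g.2.1 (Functor.LaxMonoidal.ε i)
      simp only [LinearMap.baseChange_comp, LinearMap.comp_apply]
      exact (congrArg _ h₁).trans (h₂ _)⟩
  map_one' := rfl
  map_mul' _ _ := rfl

end TensorAut

section Tannakian

/-- Monoidal functors preserve duals: the triangle identity for the image. -/
theorem map_evaluation_coevaluation {C D : Type*} [Category* C] [MonoidalCategory C] [Category* D]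
    [MonoidalCategory D] (F : C ⥤ D) [F.Monoidal] (X Y : C) [ExactPairing X Y] :
    (Functor.LaxMonoidal.ε F ≫ F.map (η_ X Y) ≫ Functor.OplaxMonoidal.δ F _ _) ▷ F.obj X ≫
      (α_ _ _ _).hom ≫
        F.obj X ◁ (Functor.LaxMonoidal.μ F _ _ ≫ F.map (ε_ X Y) ≫ Functor.OplaxMonoidal.η F) =
      (λ_ _).hom ≫ (ρ_ _).inv := by
  have h := congrArg F.map (ExactPairing.evaluation_coevaluation X Y)
  simp only [Functor.map_comp, Functor.Monoidal.map_whiskerRight,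
    Functor.Monoidal.map_whiskerLeft, Functor.Monoidal.map_associator,
    Functor.Monoidal.map_leftUnitor, Functor.Monoidal.map_rightUnitor_inv, Category.assoc,
    Functor.Monoidal.μ_δ_assoc] at h
  have h' := congrArg (fun f => Functor.LaxMonoidal.ε F ▷ F.obj X ≫
    Functor.LaxMonoidal.μ F _ _ ≫ f ≫
      Functor.OplaxMonoidal.δ F _ _ ≫ F.obj X ◁ Functor.OplaxMonoidal.η F) h
  simp only [Category.assoc, Functor.Monoidal.μ_δ_assoc] at h'
  simp only [comp_whiskerRight, MonoidalCategory.whiskerLeft_comp, Category.assoc]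
  simp at h'
  rw [h', Functor.LaxMonoidal.left_unitality, Functor.OplaxMonoidal.right_unitality]
  simp only [Category.assoc]

variable (R : Type u) [CommRing R] {T : Type w} [Category.{v} T] [MonoidalCategory T]

variable (T) in
/-- The rigid objects of a symmetric monoidal category: those that have a dual. -/
def rigid : ObjectProperty T := fun X => Nonempty (HasRightDual X)

instance : (rigid T).IsMonoidal where
  prop_unit := ⟨{ rightDual := 𝟙_ T }⟩
  prop_tensor _ _ := fun ⟨_⟩ ⟨_⟩ => ⟨hasRightDualTensor⟩

/-- The conditions which make `(T, ω)` a (neutral) Tannakian category over `R`, for an `R`-linear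
abelian symmetric monoidal category `T` with `R`-bilinear tensor product and an `R`-linear
symmetric monoidal functor `ω` from `T` to `R`-modules: the structural map from `R` to the
endomorphism ring of the unit object is an isomorphism, every object is a quotient of a rigid one,
and `ω` is faithful and exact. -/
structure IsTannakian [Preadditive T] [Linear R T] (ω : T ⥤ ModuleCat.{u} R) : Prop where
  end_unit : Function.Bijective fun r : R => r • 𝟙 (𝟙_ T)
  dominated : ∀ X : T, ∃ (P : T) (f : P ⟶ X), rigid T P ∧ Epi f
  faithful : ω.Faithful
  leftExact : Limits.PreservesFiniteLimits ω
  rightExact : Limits.PreservesFiniteColimits ω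

variable {R}

/-- A tensor functor maps rigid objects to finitely generated modules. -/
theorem finite_of_rigid (ω : T ⥤ ModuleCat.{u} R) [ω.Monoidal] {P : T} (hP : rigid T P) :
    Module.Finite R (ω.obj P) := by
  obtain ⟨_⟩ := hP
  let c : 𝟙_ (ModuleCat.{u} R) ⟶ ω.obj P ⊗ ω.obj (Pᘁ) :=
    Functor.LaxMonoidal.ε ω ≫ ω.map (η_ P (Pᘁ)) ≫ Functor.OplaxMonoidal.δ ω _ _
  let e : ω.obj (Pᘁ) ⊗ ω.obj P ⟶ 𝟙_ (ModuleCat.{u} R) :=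
    Functor.LaxMonoidal.μ ω _ _ ≫ ω.map (ε_ P (Pᘁ)) ≫ Functor.OplaxMonoidal.η ω
  have key : c ▷ ω.obj P ≫ (α_ (ω.obj P) (ω.obj (Pᘁ)) (ω.obj P)).hom ≫ ω.obj P ◁ e =
      (λ_ (ω.obj P)).hom ≫ (ρ_ (ω.obj P)).inv :=
    map_evaluation_coevaluation ω P (Pᘁ)
  obtain ⟨S, hS⟩ := TensorProduct.exists_finset (c.hom (1 : R))
  classical
  refine ⟨⟨S.image Prod.fst, ?_⟩⟩
  refine eq_top_iff.mpr fun x _ => ?_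
  have hx : (ω.obj P ◁ e).hom ((α_ (ω.obj P) (ω.obj (Pᘁ)) (ω.obj P)).hom.hom (c.hom (1 : R) ⊗ₜ[R] x)) =
      (ρ_ (ω.obj P)).inv.hom ((λ_ (ω.obj P)).hom.hom ((1 : R) ⊗ₜ[R] x)) :=
    congrArg (fun f => f.hom ((1 : R) ⊗ₜ[R] x)) key
  rw [hS, TensorProduct.sum_tmul, map_sum, map_sum] at hx
  have hx' := congrArg (TensorProduct.rid R (ω.obj P)) hx
  rw [map_sum] at hx'
  have hx2 : (∑ i ∈ S, (e.hom (i.2 ⊗ₜ[R] x) : R) • i.1) = x := by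
    refine Eq.trans ?_ (hx'.trans ?_)
    · exact Finset.sum_congr rfl fun i _ => rfl
    · change (1 : R) • (1 : R) • x = x
      simp
  rw [← hx2]
  refine Submodule.sum_mem _ fun i hi => Submodule.smul_mem _ _ (Submodule.subset_span ?_)
  exact Finset.mem_coe.mpr (Finset.mem_image_of_mem Prod.fst hi)

theorem IsTannakian.finite [Preadditive T] [Linear R T] {ω : T ⥤ ModuleCat.{u} R} [ω.Monoidal]
    (h : IsTannakian R ω) (X : T) : Module.Finite R (ω.obj X) := by
  obtain ⟨P, f, hP, hf⟩ := h.dominated X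
  have := h.rightExact
  have := finite_of_rigid ω hP
  exact Module.Finite.of_surjective (ω.map f).hom
    ((ModuleCat.epi_iff_surjective _).mp inferInstance)

variable [Preadditive T] [Linear R T]

/-- The functor `T ⥤ Rep_f(Aut^⊗(ω))` through which `ω` factors: it maps `X` to `ω(X)` with the
action of `Aut^⊗(A ⊗ ω)` on `A ⊗ ω(X)`. -/
@[simps]
def toRep (ω : T ⥤ ModuleCat.{u} R) [ω.Monoidal] (h : IsTannakian R ω) :
    T ⥤ FinRep (tensorAutFunctor ω) where
  obj X :=
    { V := ω.obj X
      finite := h.finite X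
      ρ := fun A => (Pi.evalMonoidHom _ X).comp (tensorAut ω A).subtype
      naturality := fun _ _ => rfl }
  map f :=
    { hom := (ω.map f).hom
      comm := fun _ g x => g.2.1 f x }
  map_id X := FinRep.hom_ext (by simp)
  map_comp f g := FinRep.hom_ext (by simp)

end Tannakian

/-- The base change `C_K` of an `R`-linear category `C` along `R → K`: it has the same objects as
`C`, and `Hom_{C_K}(X, Y) = K ⊗ Hom_C(X, Y)`. -/
structure ScalarExt (R : Type u) [CommRing R] (K : Type u) [CommRing K] [Algebra R K]
    (C : Type w) where
  /-- the underlying object -/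
  as : C

namespace ScalarExt

variable {R : Type u} [CommRing R] {K : Type u} [CommRing K] [Algebra R K]
  {C : Type w} [Category.{v} C] [Preadditive C] [Linear R C]

instance : CategoryStruct (ScalarExt R K C) where
  Hom X Y := K ⊗[R] (X.as ⟶ Y.as)
  id X := (1 : K) ⊗ₜ[R] 𝟙 X.as
  comp {X Y Z} f g :=
    TensorProduct.map₂ (LinearMap.mul R K) (Linear.comp (S := R) X.as Y.as Z.as) f g

/-- The pure tensor `a ⊗ f` as a morphism of `C_K`. -/
def tmulHom {X Y : ScalarExt R K C} (a : K) (f : X.as ⟶ Y.as) : X ⟶ Y := a ⊗ₜ[R] f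

instance homAddCommGroup (X Y : ScalarExt R K C) : AddCommGroup (X ⟶ Y) :=
  inferInstanceAs (AddCommGroup (K ⊗[R] (X.as ⟶ Y.as)))

instance homModule (X Y : ScalarExt R K C) : Module K (X ⟶ Y) :=
  inferInstanceAs (Module K (K ⊗[R] (X.as ⟶ Y.as)))

theorem hom_induction {X Y : ScalarExt R K C} {p : (X ⟶ Y) → Prop}
    (zero : p 0) (tmul : ∀ a f, p (tmulHom a f))
    (add : ∀ f g, p f → p g → p (f + g)) (f : X ⟶ Y) : p f :=
  TensorProduct.induction_on (motive := p) f zero tmul add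

theorem id_eq (X : ScalarExt R K C) : 𝟙 X = tmulHom 1 (𝟙 X.as) := rfl

theorem tmulHom_comp {X Y Z : ScalarExt R K C} (a b : K) (f : X.as ⟶ Y.as) (g : Y.as ⟶ Z.as) :
    (tmulHom a f : X ⟶ Y) ≫ (tmulHom b g : Y ⟶ Z) = tmulHom (a * b) (f ≫ g) := rfl

theorem add_comp' {X Y Z : ScalarExt R K C} (f f' : X ⟶ Y) (g : Y ⟶ Z) :
    (f + f') ≫ g = f ≫ g + f' ≫ g :=
  LinearMap.map_add₂ (TensorProduct.map₂ (LinearMap.mul R K)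
    (Linear.comp (S := R) X.as Y.as Z.as)) f f' g

theorem comp_add' {X Y Z : ScalarExt R K C} (f : X ⟶ Y) (g g' : Y ⟶ Z) :
    f ≫ (g + g') = f ≫ g + f ≫ g' :=
  map_add (TensorProduct.map₂ (LinearMap.mul R K) (Linear.comp (S := R) X.as Y.as Z.as) f) g g'

theorem zero_comp' {X Y Z : ScalarExt R K C} (g : Y ⟶ Z) : (0 : X ⟶ Y) ≫ g = 0 :=
  LinearMap.map_zero₂ (TensorProduct.map₂ (LinearMap.mul R K)
    (Linear.comp (S := R) X.as Y.as Z.as)) g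

theorem comp_zero' {X Y Z : ScalarExt R K C} (f : X ⟶ Y) : f ≫ (0 : Y ⟶ Z) = 0 :=
  map_zero (TensorProduct.map₂ (LinearMap.mul R K) (Linear.comp (S := R) X.as Y.as Z.as) f)

theorem smul_tmulHom {X Y : ScalarExt R K C} (c a : K) (f : X.as ⟶ Y.as) :
    c • (tmulHom a f : X ⟶ Y) = tmulHom (c * a) f := rfl

instance : Category (ScalarExt R K C) where
  id_comp {X Y} f := by
    induction f using hom_induction with
    | zero => rw [comp_zero']
    | tmul a f => rw [id_eq, tmulHom_comp, one_mul, Category.id_comp]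
    | add f g hf hg => rw [comp_add', hf, hg]
  comp_id {X Y} f := by
    induction f using hom_induction with
    | zero => rw [zero_comp']
    | tmul a f => rw [id_eq, tmulHom_comp, mul_one, Category.comp_id]
    | add f g hf hg => rw [add_comp', hf, hg]
  assoc f g h := by
    induction f using hom_induction with
    | zero => simp only [zero_comp']
    | add f f' hf hf' => simp only [add_comp', hf, hf']
    | tmul a f =>
      induction g using hom_induction with
      | zero => simp only [zero_comp', comp_zero']
      | add g g' hg hg' => simp only [add_comp', comp_add', hg, hg']
      | tmul b g =>
        induction h using hom_induction with
        | zero => simp only [comp_zero']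
        | add h h' hh hh' => simp only [comp_add', hh, hh']
        | tmul c h => simp only [tmulHom_comp, mul_assoc, Category.assoc]

instance : Preadditive (ScalarExt R K C) where
  homGroup := homAddCommGroup
  add_comp _ _ _ f f' g := add_comp' f f' g
  comp_add _ _ _ f g g' := comp_add' f g g'

instance : Linear K (ScalarExt R K C) where
  homModule := homModule
  smul_comp _ _ _ c f g := by
    induction f using hom_induction with
    | zero => simp only [smul_zero, zero_comp']
    | add f f' hf hf' => simp only [smul_add, add_comp', hf, hf']
    | tmul a f =>
      induction g using hom_induction with
      | zero => simp only [smul_zero, comp_zero']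
      | add g g' hg hg' => simp only [smul_add, comp_add', hg, hg']
      | tmul b g => simp only [tmulHom_comp, smul_tmulHom, mul_assoc]
  comp_smul _ _ _ f c g := by
    induction f using hom_induction with
    | zero => simp only [smul_zero, zero_comp']
    | add f f' hf hf' => simp only [smul_add, add_comp', hf, hf']
    | tmul a f =>
      induction g using hom_induction with
      | zero => simp only [smul_zero, comp_zero']
      | add g g' hg hg' => simp only [smul_add, comp_add', hg, hg']
      | tmul b g => simp only [tmulHom_comp, smul_tmulHom, mul_left_comm]

variable (R K C) in
/-- The canonical functor `C ⥤ C_K`, `f ↦ 1 ⊗ f`. -/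
def incl : C ⥤ ScalarExt R K C where
  obj X := ⟨X⟩
  map f := tmulHom 1 f
  map_id _ := rfl
  map_comp f g := by rw [tmulHom_comp, one_mul]

section Lift

variable {D : Type*} [Category* D] [Preadditive D] [Linear K D]

/-- The additive map `a ⊗ f ↦ a • F(f)`. -/
def liftHom (F : C ⥤ D) [F.Additive]
    (hF : ∀ {X Y : C} (r : R) (f : X ⟶ Y), F.map (r • f) = algebraMap R K r • F.map f)
    (X Y : ScalarExt R K C) : (X ⟶ Y) →+ (F.obj X.as ⟶ F.obj Y.as) :=
  TensorProduct.liftAddHom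
    { toFun := fun a : K =>
        { toFun := fun f : X.as ⟶ Y.as => a • F.map f
          map_zero' := by simp
          map_add' := fun f g => by simp }
      map_zero' := by ext; simp
      map_add' := fun a b => by ext; simp [add_smul] }
    (fun r a f => by
      change (r • a) • F.map f = a • F.map (r • f)
      rw [hF, smul_smul, Algebra.smul_def, mul_comm])

theorem liftHom_tmulHom (F : C ⥤ D) [F.Additive]
    (hF : ∀ {X Y : C} (r : R) (f : X ⟶ Y), F.map (r • f) = algebraMap R K r • F.map f)
    {X Y : ScalarExt R K C} (a : K) (f : X.as ⟶ Y.as) :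
    liftHom F hF X Y (tmulHom a f) = a • F.map f := rfl

/-- The functor `C_K ⥤ D`, `a ⊗ f ↦ a • F(f)`, to a `K`-linear category `D` that is induced by an
`R`-linear functor `F : C ⥤ D`. -/
def lift (F : C ⥤ D) [F.Additive]
    (hF : ∀ {X Y : C} (r : R) (f : X ⟶ Y), F.map (r • f) = algebraMap R K r • F.map f) :
    ScalarExt R K C ⥤ D where
  obj X := F.obj X.as
  map {X Y} f := liftHom F hF X Y f
  map_id X := by rw [id_eq, liftHom_tmulHom, one_smul, F.map_id]
  map_comp {X Y Z} f g := by
    induction f using hom_induction with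
    | zero => rw [zero_comp', map_zero, map_zero, Limits.zero_comp]
    | add f f' hf hf' => rw [add_comp', map_add, hf, hf', map_add, Preadditive.add_comp]
    | tmul a f =>
      induction g using hom_induction with
      | zero => rw [comp_zero', map_zero, map_zero, Limits.comp_zero]
      | add g g' hg hg' => rw [comp_add', map_add, hg, hg', map_add, Preadditive.comp_add]
      | tmul b g =>
        rw [tmulHom_comp, liftHom_tmulHom, liftHom_tmulHom, liftHom_tmulHom, F.map_comp,
          Linear.smul_comp, Linear.comp_smul, smul_smul]

end Lift

section Monoidal

variable [MonoidalCategory C] [MonoidalPreadditive C] [MonoidalLinear R C]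

/-- The tensor product of morphisms of `C` as a bilinear map. -/
def tensorBilin (X Y X' Y' : C) : (X ⟶ Y) →ₗ[R] (X' ⟶ Y') →ₗ[R] (X ⊗ X' ⟶ Y ⊗ Y') :=
  LinearMap.mk₂ R (fun f g => f ⊗ₘ g) (fun f f' g => MonoidalPreadditive.add_tensor f f' g)
    (fun r f g => by simp [MonoidalCategory.tensorHom_def]) (fun f g g' => MonoidalPreadditive.tensor_add f g g')
    (fun r f g => by simp [MonoidalCategory.tensorHom_def])

/-- The tensor product of morphisms of `C_K`: `(a ⊗ f) ⊗ (b ⊗ g) = ab ⊗ (f ⊗ g)`. -/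
def tensorMap {X Y X' Y' : ScalarExt R K C} (f : X ⟶ Y) (g : X' ⟶ Y') :
    (⟨X.as ⊗ X'.as⟩ : ScalarExt R K C) ⟶ ⟨Y.as ⊗ Y'.as⟩ :=
  TensorProduct.map₂ (LinearMap.mul R K) (tensorBilin (R := R) X.as Y.as X'.as Y'.as) f g

theorem tensorMap_tmulHom {X Y X' Y' : ScalarExt R K C} (a b : K) (f : X.as ⟶ Y.as)
    (g : X'.as ⟶ Y'.as) :
    tensorMap (tmulHom a f : X ⟶ Y) (tmulHom b g : X' ⟶ Y') = tmulHom (a * b) (f ⊗ₘ g) := rfl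

theorem add_tensorMap {X Y X' Y' : ScalarExt R K C} (f f' : X ⟶ Y) (g : X' ⟶ Y') :
    tensorMap (f + f') g = tensorMap f g + tensorMap f' g :=
  LinearMap.map_add₂ (TensorProduct.map₂ (LinearMap.mul R K)
    (tensorBilin (R := R) X.as Y.as X'.as Y'.as)) f f' g

theorem tensorMap_add {X Y X' Y' : ScalarExt R K C} (f : X ⟶ Y) (g g' : X' ⟶ Y') :
    tensorMap f (g + g') = tensorMap f g + tensorMap f g' :=
  map_add (TensorProduct.map₂ (LinearMap.mul R K)
    (tensorBilin (R := R) X.as Y.as X'.as Y'.as) f) g g'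

theorem zero_tensorMap {X Y X' Y' : ScalarExt R K C} (g : X' ⟶ Y') :
    tensorMap (0 : X ⟶ Y) g = 0 :=
  LinearMap.map_zero₂ (TensorProduct.map₂ (LinearMap.mul R K)
    (tensorBilin (R := R) X.as Y.as X'.as Y'.as)) g

theorem tensorMap_zero {X Y X' Y' : ScalarExt R K C} (f : X ⟶ Y) :
    tensorMap f (0 : X' ⟶ Y') = 0 :=
  map_zero (TensorProduct.map₂ (LinearMap.mul R K)
    (tensorBilin (R := R) X.as Y.as X'.as Y'.as) f)

instance : MonoidalCategoryStruct (ScalarExt R K C) where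
  tensorObj X Y := ⟨X.as ⊗ Y.as⟩
  tensorUnit := ⟨𝟙_ C⟩
  tensorHom := tensorMap
  whiskerLeft X _ _ f := tensorMap (𝟙 X) f
  whiskerRight f Y := tensorMap f (𝟙 Y)
  associator X Y Z := (incl R K C).mapIso (α_ X.as Y.as Z.as)
  leftUnitor X := (incl R K C).mapIso (λ_ X.as)
  rightUnitor X := (incl R K C).mapIso (ρ_ X.as)

theorem tensorMap_comp {X Y Z X' Y' Z' : ScalarExt R K C} (f : X ⟶ Y) (g : X' ⟶ Y') (h : Y ⟶ Z)
    (k : Y' ⟶ Z') : tensorMap f g ≫ tensorMap h k = tensorMap (f ≫ h) (g ≫ k) := by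
  induction f using hom_induction with
  | zero => simp only [zero_comp', zero_tensorMap]
  | add f f' hf hf' => simp only [add_comp', add_tensorMap, hf, hf']
  | tmul a f =>
    induction g using hom_induction with
    | zero => simp only [zero_comp', tensorMap_zero]
    | add f f' hf hf' => simp only [add_comp', tensorMap_add, hf, hf']
    | tmul b g =>
      induction h using hom_induction with
      | zero => simp only [comp_zero', zero_tensorMap]
      | add f f' hf hf' => simp only [comp_add', add_tensorMap, hf, hf']
      | tmul c h =>
        induction k using hom_induction with
        | zero => simp only [comp_zero', tensorMap_zero]
        | add f f' hf hf' => simp only [comp_add', tensorMap_add, hf, hf']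
        | tmul d k => simp only [tmulHom_comp, tensorMap_tmulHom, mul_mul_mul_comm,
            tensorHom_comp_tensorHom]

instance : MonoidalCategory (ScalarExt R K C) :=
  MonoidalCategory.ofTensorHom
    (id_tensorHom_id := fun X Y => by
      change tensorMap (tmulHom 1 (𝟙 X.as)) (tmulHom 1 (𝟙 Y.as)) = tmulHom 1 (𝟙 (X.as ⊗ Y.as))
      rw [tensorMap_tmulHom, mul_one, id_tensorHom_id])
    (tensorHom_comp_tensorHom := tensorMap_comp)
    (associator_naturality := fun {X₁ X₂ X₃ Y₁ Y₂ Y₃} f g h => by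
      change tensorMap (tensorMap f g) h ≫ tmulHom 1 (α_ _ _ _).hom =
        tmulHom 1 (α_ _ _ _).hom ≫ tensorMap f (tensorMap g h)
      induction f using hom_induction with
      | zero => simp only [zero_comp', zero_tensorMap, comp_zero']
      | add f f' hf hf' => simp only [add_comp', comp_add', add_tensorMap, hf, hf']
      | tmul a f =>
        induction g using hom_induction with
        | zero => simp only [zero_comp', zero_tensorMap, tensorMap_zero, comp_zero']
        | add f f' hf hf' =>
          simp only [add_comp', comp_add', add_tensorMap, tensorMap_add, hf, hf']
        | tmul b g =>
          induction h using hom_induction with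
          | zero => simp only [zero_comp', tensorMap_zero, comp_zero']
          | add f f' hf hf' => simp only [add_comp', comp_add', tensorMap_add, hf, hf']
          | tmul c h =>
            rw [tensorMap_tmulHom, tensorMap_tmulHom, tensorMap_tmulHom, tensorMap_tmulHom,
              tmulHom_comp, tmulHom_comp, mul_one, one_mul, mul_assoc, associator_naturality])
    (leftUnitor_naturality := fun {X Y} f => by
      change tensorMap (tmulHom 1 (𝟙 (𝟙_ C))) f ≫ tmulHom 1 (λ_ _).hom = tmulHom 1 (λ_ _).hom ≫ f
      induction f using hom_induction with
      | zero => simp only [zero_comp', tensorMap_zero, comp_zero']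
      | add f f' hf hf' => simp only [add_comp', comp_add', tensorMap_add, hf, hf']
      | tmul a f =>
        rw [tensorMap_tmulHom, tmulHom_comp, tmulHom_comp, mul_one, one_mul, id_tensorHom,
          leftUnitor_naturality])
    (rightUnitor_naturality := fun {X Y} f => by
      change tensorMap f (tmulHom 1 (𝟙 (𝟙_ C))) ≫ tmulHom 1 (ρ_ _).hom = tmulHom 1 (ρ_ _).hom ≫ f
      induction f using hom_induction with
      | zero => simp only [zero_comp', zero_tensorMap, comp_zero']
      | add f f' hf hf' => simp only [add_comp', comp_add', add_tensorMap, hf, hf']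
      | tmul a f =>
        rw [tensorMap_tmulHom, tmulHom_comp, tmulHom_comp, mul_one, mul_one, one_mul, tensorHom_id,
          rightUnitor_naturality])
    (pentagon := fun W X Y Z => by
      change tensorMap (tmulHom 1 (α_ W.as X.as Y.as).hom) (tmulHom 1 (𝟙 Z.as)) ≫
        tmulHom 1 (α_ W.as (X.as ⊗ Y.as) Z.as).hom ≫
          tensorMap (tmulHom 1 (𝟙 W.as)) (tmulHom 1 (α_ X.as Y.as Z.as).hom) =
            tmulHom 1 (α_ (W.as ⊗ X.as) Y.as Z.as).hom ≫
              tmulHom 1 (α_ W.as X.as (Y.as ⊗ Z.as)).hom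
      rw [tensorMap_tmulHom, tensorMap_tmulHom, tmulHom_comp, tmulHom_comp, tmulHom_comp]
      simp only [mul_one, tensorHom_id, id_tensorHom, MonoidalCategory.pentagon])
    (triangle := fun X Y => by
      change tmulHom 1 (α_ X.as (𝟙_ C) Y.as).hom ≫
        tensorMap (tmulHom 1 (𝟙 X.as)) (tmulHom 1 (λ_ Y.as).hom) =
          tensorMap (tmulHom 1 (ρ_ X.as).hom) (tmulHom 1 (𝟙 Y.as))
      rw [tensorMap_tmulHom, tensorMap_tmulHom, tmulHom_comp]
      simp only [mul_one, tensorHom_id, id_tensorHom, MonoidalCategory.triangle])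

instance [BraidedCategory C] : BraidedCategory (ScalarExt R K C) where
  braiding X Y := (incl R K C).mapIso (β_ X.as Y.as)
  braiding_naturality_right X Y Z f := by
    change tensorMap (tmulHom 1 (𝟙 X.as)) f ≫ tmulHom 1 (β_ X.as Z.as).hom =
      tmulHom 1 (β_ X.as Y.as).hom ≫ tensorMap f (tmulHom 1 (𝟙 X.as))
    induction f using hom_induction with
    | zero => simp only [zero_comp', tensorMap_zero, zero_tensorMap, comp_zero']
    | add f f' hf hf' => simp only [add_comp', comp_add', tensorMap_add, add_tensorMap, hf, hf']
    | tmul a f =>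
      rw [tensorMap_tmulHom, tensorMap_tmulHom, tmulHom_comp, tmulHom_comp]
      simp only [mul_one, one_mul, tensorHom_id, id_tensorHom,
        BraidedCategory.braiding_naturality_right]
  braiding_naturality_left {X Y} f Z := by
    change tensorMap f (tmulHom 1 (𝟙 Z.as)) ≫ tmulHom 1 (β_ Y.as Z.as).hom =
      tmulHom 1 (β_ X.as Z.as).hom ≫ tensorMap (tmulHom 1 (𝟙 Z.as)) f
    induction f using hom_induction with
    | zero => simp only [zero_comp', tensorMap_zero, zero_tensorMap, comp_zero']
    | add f f' hf hf' => simp only [add_comp', comp_add', tensorMap_add, add_tensorMap, hf, hf']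
    | tmul a f =>
      rw [tensorMap_tmulHom, tensorMap_tmulHom, tmulHom_comp, tmulHom_comp]
      simp only [mul_one, one_mul, tensorHom_id, id_tensorHom,
        BraidedCategory.braiding_naturality_left]
  hexagon_forward X Y Z := by
    change tmulHom 1 (α_ X.as Y.as Z.as).hom ≫ tmulHom 1 (β_ X.as (Y.as ⊗ Z.as)).hom ≫
      tmulHom 1 (α_ Y.as Z.as X.as).hom =
        tensorMap (tmulHom 1 (β_ X.as Y.as).hom) (tmulHom 1 (𝟙 Z.as)) ≫
          tmulHom 1 (α_ Y.as X.as Z.as).hom ≫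
            tensorMap (tmulHom 1 (𝟙 Y.as)) (tmulHom 1 (β_ X.as Z.as).hom)
    rw [tensorMap_tmulHom, tensorMap_tmulHom, tmulHom_comp, tmulHom_comp, tmulHom_comp,
      tmulHom_comp]
    simp only [mul_one, tensorHom_id, id_tensorHom, BraidedCategory.hexagon_forward]
  hexagon_reverse X Y Z := by
    change tmulHom 1 (α_ X.as Y.as Z.as).inv ≫ tmulHom 1 (β_ (X.as ⊗ Y.as) Z.as).hom ≫
      tmulHom 1 (α_ Z.as X.as Y.as).inv =
        tensorMap (tmulHom 1 (𝟙 X.as)) (tmulHom 1 (β_ Y.as Z.as).hom) ≫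
          tmulHom 1 (α_ X.as Z.as Y.as).inv ≫
            tensorMap (tmulHom 1 (β_ X.as Z.as).hom) (tmulHom 1 (𝟙 Y.as))
    rw [tensorMap_tmulHom, tensorMap_tmulHom, tmulHom_comp, tmulHom_comp, tmulHom_comp,
      tmulHom_comp]
    simp only [mul_one, tensorHom_id, id_tensorHom, BraidedCategory.hexagon_reverse]

instance [SymmetricCategory C] : SymmetricCategory (ScalarExt R K C) where
  symmetry X Y := by
    change tmulHom 1 (β_ X.as Y.as).hom ≫ tmulHom 1 (β_ Y.as X.as).hom = 𝟙 (X ⊗ Y)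
    rw [tmulHom_comp, mul_one, SymmetricCategory.symmetry]
    rfl

end Monoidal

end ScalarExt

section BaseChange

variable {R K : Type u} [CommRing R] [CommRing K] [Algebra R K]

section Linear

variable {A B : Type u} [CommRing A] [Algebra R A] [Algebra K A] [IsScalarTower R K A]
  [CommRing B] [Algebra R B] [Algebra K B] [IsScalarTower R K B]
  {M N : Type u} [AddCommGroup M] [Module R M] [AddCommGroup N] [Module R N]

variable (K) in
/-- Transport of automorphisms along `A ⊗_K (K ⊗_R M) ≃ A ⊗_R M`, for a `K`-algebra `A`. -/
def glExt : LinearMap.GeneralLinearGroup A (A ⊗[R] M) →*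
    LinearMap.GeneralLinearGroup A (A ⊗[K] (K ⊗[R] M)) :=
  (LinearMap.GeneralLinearGroup.congrLinearEquiv
    (AlgebraTensorModule.cancelBaseChange R K A A M).symm).toMonoidHom

theorem cancel_glExt (g : LinearMap.GeneralLinearGroup A (A ⊗[R] M)) (x : A ⊗[K] (K ⊗[R] M)) :
    AlgebraTensorModule.cancelBaseChange R K A A M ((glExt K g).1 x) =
      g.1 (AlgebraTensorModule.cancelBaseChange R K A A M x) :=
  (AlgebraTensorModule.cancelBaseChange R K A A M).apply_symm_apply _

theorem cancel_scalarMap (ψ : A →ₐ[K] B) (x : A ⊗[K] (K ⊗[R] M)) :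
    AlgebraTensorModule.cancelBaseChange R K B B M (scalarMap ψ (K ⊗[R] M) x) =
      scalarMap (ψ.restrictScalars R) M (AlgebraTensorModule.cancelBaseChange R K A A M x) := by
  induction x with
  | zero => simp
  | add x y hx hy => simp only [map_add, hx, hy]
  | tmul a y =>
    induction y with
    | zero => simp
    | add x y hx hy => simp only [map_add, tmul_add, hx, hy]
    | tmul k m => simp

theorem cancel_baseChange (f : M →ₗ[R] N) (x : A ⊗[K] (K ⊗[R] M)) :
    AlgebraTensorModule.cancelBaseChange R K A A N ((f.baseChange K).baseChange A x) =
      f.baseChange A (AlgebraTensorModule.cancelBaseChange R K A A M x) := by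
  rw [LinearMap.baseChange_baseChange]
  exact (AlgebraTensorModule.cancelBaseChange R K A A N).apply_symm_apply _

theorem glMap_glExt (ψ : A →ₐ[K] B) (g : LinearMap.GeneralLinearGroup A (A ⊗[R] M)) :
    glMap ψ (K ⊗[R] M) (glExt K g) = glExt K (glMap (ψ.restrictScalars R) M g) := by
  refine Units.ext (ext_scalarMap ψ fun x => ?_)
  apply (AlgebraTensorModule.cancelBaseChange R K B B M).injective
  rw [glMap_scalarMap, cancel_glExt, cancel_scalarMap, cancel_scalarMap, cancel_glExt,
    glMap_scalarMap]

theorem glExt_comm (f : M →ₗ[R] N) {g : LinearMap.GeneralLinearGroup A (A ⊗[R] M)}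
    {h : LinearMap.GeneralLinearGroup A (A ⊗[R] N)}
    (H : ∀ x, f.baseChange A (g.1 x) = h.1 (f.baseChange A x)) (x : A ⊗[K] (K ⊗[R] M)) :
    (f.baseChange K).baseChange A ((glExt K g).1 x) =
      (glExt K h).1 ((f.baseChange K).baseChange A x) := by
  apply (AlgebraTensorModule.cancelBaseChange R K A A N).injective
  rw [cancel_glExt, cancel_baseChange, cancel_baseChange, cancel_glExt, H]

end Linear

/-- A `K`-algebra, seen as an `R`-algebra along `R → K`. -/
abbrev restrictAlg (R : Type u) {K : Type u} [CommRing R] [CommRing K] [Algebra R K]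
    (A : CommAlgCat.{u} K) : CommAlgCat.{u} R :=
  @CommAlgCat.of R _ A _ (Algebra.compHom A (algebraMap R K))

instance (A : CommAlgCat.{u} K) : Algebra K (restrictAlg R A) := A.algebra

instance (A : CommAlgCat.{u} K) : IsScalarTower R K (restrictAlg R A) :=
  IsScalarTower.of_algebraMap_eq fun _ => rfl

/-- A homomorphism of `K`-algebras, seen as a homomorphism of `R`-algebras. -/
abbrev restrictHom {A B : CommAlgCat.{u} K} (φ : A ⟶ B) : restrictAlg R A →ₐ[R] restrictAlg R B :=
  AlgHom.restrictScalars R (S := K) (A := restrictAlg R A) (B := restrictAlg R B) φ.hom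

variable (R K) in
/-- The restriction functor from commutative `K`-algebras to commutative `R`-algebras. -/
@[simps]
def restrictAlgFunctor : CommAlgCat.{u} K ⥤ CommAlgCat.{u} R where
  obj A := restrictAlg R A
  map φ := ConcreteCategory.ofHom (C := CommAlgCat.{u} R) (restrictHom φ)

variable (K) in
/-- The base change `G_K` of a group functor: `G_K(A) = G(A)` for `K`-algebras `A`. -/
abbrev GroupFunctor.baseChange (G : GroupFunctor.{w} R) : GroupFunctor.{w} K :=
  restrictAlgFunctor R K ⋙ G

variable (R) in
/-- For a `K`-algebra `A`, the identification of `Aut_A(A ⊗_R M)` with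
`Aut_A(A ⊗_K (K ⊗_R M))`. -/
def glRestrict (A : CommAlgCat.{u} K) (M : Type u) [AddCommGroup M] [Module R M] :
    LinearMap.GeneralLinearGroup (restrictAlg R A) (restrictAlg R A ⊗[R] M) →*
      LinearMap.GeneralLinearGroup A (A ⊗[K] (K ⊗[R] M)) :=
  glExt (A := restrictAlg R A) K

theorem glMap_glRestrict {A B : CommAlgCat.{u} K} (φ : A ⟶ B) {M : Type u} [AddCommGroup M]
    [Module R M] (g : LinearMap.GeneralLinearGroup (restrictAlg R A) (restrictAlg R A ⊗[R] M)) :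
    glMap φ.hom (K ⊗[R] M) (glRestrict R A M g) = glRestrict R B M (glMap (restrictHom (R := R) φ) M g) :=
  glMap_glExt (A := restrictAlg R A) (B := restrictAlg R B) φ.hom g

theorem glRestrict_comm {A : CommAlgCat.{u} K} {M N : Type u} [AddCommGroup M]
    [Module R M] [AddCommGroup N] [Module R N] (f : M →ₗ[R] N)
    {g : LinearMap.GeneralLinearGroup (restrictAlg R A) (restrictAlg R A ⊗[R] M)}
    {h : LinearMap.GeneralLinearGroup (restrictAlg R A) (restrictAlg R A ⊗[R] N)}
    (H : ∀ x, f.baseChange (restrictAlg R A) (g.1 x) = h.1 (f.baseChange (restrictAlg R A) x))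
    (x : A ⊗[K] (K ⊗[R] M)) :
    (f.baseChange K).baseChange A ((glRestrict R A M g).1 x) =
      (glRestrict R A N h).1 ((f.baseChange K).baseChange A x) :=
  glExt_comm (A := restrictAlg R A) f H x

variable (K) in
/-- The base change `K ⊗ V` of a representation `V` of `G` to a representation of `G_K`:
for `K`-algebras `A`, the group `G_K(A) = G(A)` acts on `A ⊗_K (K ⊗_R V) ≃ A ⊗_R V`. -/
def FinRep.extend {G : GroupFunctor.{w} R} (X : FinRep G) : FinRep (G.baseChange K) where
  V := K ⊗[R] X.V
  ρ A := (glRestrict R A X.V).comp (X.ρ (restrictAlg R A))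
  naturality {A B} φ g := by
    have h := X.naturality ((restrictAlgFunctor R K).map φ) g
    exact (congrArg (glRestrict R B X.V) h).trans (glMap_glRestrict φ _).symm

variable (K) in
/-- The functor `Rep_f(G) ⥤ Rep_f(G_K)`, `V ↦ K ⊗ V`. -/
def FinRep.baseChange (G : GroupFunctor.{w} R) : FinRep G ⥤ FinRep (G.baseChange K) where
  obj X := X.extend K
  map f :=
    { hom := f.hom.baseChange K
      comm := fun A g => glRestrict_comm f.hom (f.comm (restrictAlg R A) g) }
  map_id _ := FinRep.hom_ext LinearMap.baseChange_id
  map_comp _ _ := FinRep.hom_ext (LinearMap.baseChange_comp _ _)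

end BaseChange

section Induced

variable {R : Type u} [CommRing R] {T : Type w} [Category.{v} T] [MonoidalCategory T]
  [Preadditive T] [Linear R T]

/-- The composite `T° ⥤ Rep_f(G) ⥤ Rep_f(G_K)`, where `G = Aut^⊗(ω)`. -/
def rigidToRep (K : Type u) [CommRing K] [Algebra R K] (ω : T ⥤ ModuleCat.{u} R) [ω.Monoidal]
    (h : IsTannakian R ω) :
    (rigid T).FullSubcategory ⥤ FinRep ((tensorAutFunctor ω).baseChange K) :=
  (rigid T).ι ⋙ toRep ω h ⋙ FinRep.baseChange K (tensorAutFunctor ω)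

instance (K : Type u) [CommRing K] [Algebra R K] (ω : T ⥤ ModuleCat.{u} R) [ω.Monoidal]
    [ω.Additive] (h : IsTannakian R ω) : (rigidToRep K ω h).Additive where
  map_add {X Y f g} := FinRep.hom_ext <| by
    change ((ω.map (f.hom + g.hom)).hom).baseChange K = _
    rw [Functor.map_add, ModuleCat.hom_add, LinearMap.baseChange_add]
    rfl

theorem rigidToRep_smul (K : Type u) [CommRing K] [Algebra R K] (ω : T ⥤ ModuleCat.{u} R)
    [ω.Monoidal] [ω.Additive] [ω.Linear R] (h : IsTannakian R ω)
    {X Y : (rigid T).FullSubcategory} (r : R) (f : X ⟶ Y) :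
    (rigidToRep K ω h).map (r • f) = algebraMap R K r • (rigidToRep K ω h).map f :=
  FinRep.hom_ext <| by
    change ((ω.map (r • f.hom)).hom).baseChange K = algebraMap R K r • (ω.map f.hom).hom.baseChange K
    rw [Functor.map_smul, ModuleCat.hom_smul, LinearMap.baseChange_smul, algebraMap_smul]

/-- The functor `(T°)_K ⥤ Rep_f(G_K)` induced by `ω`, where `G = Aut^⊗(ω)`: it maps `X` to
`K ⊗ ω(X)` with its action of `G_K`, and a morphism `a ⊗ f` to `a • (K ⊗ ω(f))`. -/
def genericFunctor (K : Type u) [CommRing K] [Algebra R K] (ω : T ⥤ ModuleCat.{u} R)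
    [ω.Monoidal] [ω.Additive] [ω.Linear R] (h : IsTannakian R ω) :
    ScalarExt R K (rigid T).FullSubcategory ⥤ FinRep ((tensorAutFunctor ω).baseChange K) :=
  ScalarExt.lift (rigidToRep K ω h) (rigidToRep_smul K ω h)

end Induced

end TannakaDedekind

end

open TannakaDedekind

/-! The Hopf algebra of `G` consists of matrix coefficients `g ↦ φ(g x)`, where `P` is rigid, `x ∈
ω(P)` and `φ` is a linear form on `ω(P)`. `Coord h` is the colimit of the duals of `ω(P)` over all
pairs `(P, x)`. As `ω` is exact and every object is a quotient of a rigid one, these pairs form a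
cofiltered category (`IsTannakian.isCofiltered`), so an element of the colimit is a single
coefficient and a relation holds as soon as it holds over one further pair.

For rigid `P` the module `ω(P)` is finite projective, hence `Coord h ⊗ N` is the filtered colimit of
`Hom(ω(P), N)`. It is left exact in `N`, so `Coord h` is flat. Moreover, if the coefficient of `x`
and `k : ω(P) → N` vanishes, then `k` is killed by some `ω(a)` with `a : Q ⟶ P` whose image contains
`x` (`Coord.exists_of_mkMod_eq_zero`). This criterion converts equations over `Coord h` into
morphisms of `T` and carries the whole reconstruction.

Points: a tensor automorphism on rigid objects can be evaluated on coefficients, which gives an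
algebra homomorphism out of `Coord h`. Conversely every `ω(X)` has a coaction of `Coord h`, obtained
by lifting vectors to rigid covers, so a homomorphism `Coord h → A` acts on all `A ⊗ ω(X)`; the
action is invertible because it preserves coevaluations. Thus `Coord h` represents `G`, on `T` as
well as on rigid objects, and the Hopf structure follows by Yoneda.

Reconstruction: by the criterion, every vector of a comodule `V` lies in the image of an equivariant
map from some `ω(P)`, the kernel of such a map is (over a Noetherian ring) the image of some `ω(a)`,
and an equivariant map `ω(X) → ω(Y)` is locally, hence globally, induced by a morphism. Therefore
`V`, if finitely generated, is `ω` of a cokernel, and `toRep` is an equivalence.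

Generic fibre: faithfulness and fullness follow by clearing denominators. A representation `W` of
`G_K` is, over `R`, a comodule that is usually not finitely generated; the lattice spanned by
finitely many generators lies in the image of some `ω(P)`, and this image is some `ω(X)`. It is
torsion-free, hence flat over the Dedekind domain `R`, and flatness of `ω(X)` makes `X` rigid
(`IsTannakian.rigid_of_flat`); finally `K ⊗ ω(X) ≃ W`. -/

noncomputable section

namespace TannakaDedekind

/-! ### Rigid covers, and the cofiltered category of pairs `(P, x)`. -/

section Points

variable {R : Type u} [CommRing R] {T : Type w} [Category.{v} T] {ω : T ⥤ ModuleCat.{u} R}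

theorem map_comp_apply {X Y Z : T} (f : X ⟶ Y) (g : Y ⟶ Z) (x : ω.obj X) :
    (ω.map (f ≫ g)).hom x = (ω.map g).hom ((ω.map f).hom x) := by
  rw [ω.map_comp]; rfl

theorem map_id_apply {X : T} (x : ω.obj X) : (ω.map (𝟙 X)).hom x = x := by
  rw [ω.map_id]; rfl

variable [MonoidalCategory T]

/-- The triangle identity evaluated on elements. The coevaluation is kept as a morphism `c` of `T`,
so that naturality of actions can later be applied to it. -/
theorem exists_coevaluation [ω.Monoidal] {P : T} (hP : rigid T P) :
    ∃ (D : T) (c : 𝟙_ T ⟶ P ⊗ D) (e : ω.obj D ⊗[R] ω.obj P →ₗ[R] R), ∀ x : ω.obj P,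
      TensorProduct.rid R (ω.obj P) (e.lTensor (ω.obj P) (TensorProduct.assoc R _ _ _
        ((Functor.OplaxMonoidal.δ ω P D).hom
          ((ω.map c).hom ((Functor.LaxMonoidal.ε ω).hom (1 : R))) ⊗ₜ[R] x))) = x := by
  obtain ⟨_⟩ := hP
  let e : ω.obj (Pᘁ) ⊗ ω.obj P ⟶ 𝟙_ (ModuleCat.{u} R) :=
    Functor.LaxMonoidal.μ ω _ _ ≫ ω.map (ε_ P (Pᘁ)) ≫ Functor.OplaxMonoidal.η ω
  refine ⟨Pᘁ, η_ P (Pᘁ), e.hom, fun x => ?_⟩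
  have hx := congrArg (fun f => f.hom ((1 : R) ⊗ₜ[R] x)) (map_evaluation_coevaluation ω P (Pᘁ))
  refine (congrArg (TensorProduct.rid R (ω.obj P)) hx).trans ?_
  change (1 : R) • (1 : R) • x = x
  simp

/-- If the coevaluation element is `∑ pᵢ ⊗ dᵢ`, then the forms `e(dᵢ, -)` and the vectors `pᵢ` are a
dual basis. -/
theorem dualTensorHom_mem_range_of_rigid [ω.Monoidal] {P : T} (hP : rigid T P) :
    (1 : Module.End R (ω.obj P)) ∈ (dualTensorHom R (ω.obj P) (ω.obj P)).range := by
  obtain ⟨D, c, e, hc⟩ := exists_coevaluation (ω := ω) hP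
  let t : ω.obj P ⊗[R] ω.obj D →ₗ[R] Module.End R (ω.obj P) :=
    dualTensorHom R (ω.obj P) (ω.obj P) ∘ₗ
      (TensorProduct.curry e).rTensor (ω.obj P) ∘ₗ (TensorProduct.comm R _ _).toLinearMap
  have ht : ∀ (z : ω.obj P ⊗[R] ω.obj D) (x : ω.obj P), t z x =
      TensorProduct.rid R (ω.obj P) (e.lTensor _ (TensorProduct.assoc R _ _ _ (z ⊗ₜ[R] x))) := by
    intro z x
    induction z with
    | zero => simp
    | add z z' hz hz' => simp only [map_add, TensorProduct.add_tmul, LinearMap.add_apply, hz, hz']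
    | tmul p d => rfl
  exact ⟨_, LinearMap.ext fun x => (ht _ x).trans (hc x)⟩

theorem projective_of_rigid [ω.Monoidal] {P : T} (hP : rigid T P) :
    Module.Projective R (ω.obj P) :=
  Module.Projective.of_one_mem_range_dualTensorHom (dualTensorHom_mem_range_of_rigid hP)

variable [Abelian T] [Linear R T]

namespace IsTannakian

theorem map_surjective (h : IsTannakian R ω) {X Y : T} (f : X ⟶ Y) [Epi f] :
    Function.Surjective (ω.map f).hom := by
  have := h.rightExact
  exact (ModuleCat.epi_iff_surjective _).mp inferInstance

theorem map_injective (h : IsTannakian R ω) {X Y : T} (f : X ⟶ Y) [Mono f] :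
    Function.Injective (ω.map f).hom := by
  have := h.leftExact
  exact (ModuleCat.mono_iff_injective _).mp inferInstance

theorem epi_of_surjective (h : IsTannakian R ω) {X Y : T} (f : X ⟶ Y)
    (hf : Function.Surjective (ω.map f).hom) : Epi f := by
  have := h.faithful
  exact ω.epi_of_epi_map ((ModuleCat.epi_iff_surjective _).mpr hf)

theorem hom_ext (h : IsTannakian R ω) {X Y : T} {f g : X ⟶ Y}
    (hfg : ∀ x, (ω.map f).hom x = (ω.map g).hom x) : f = g :=
  h.faithful.map_injective (ModuleCat.hom_ext (LinearMap.ext hfg))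

/-- An element of `ω(X)` lifts to `ω(P)` for a rigid `P`. -/
theorem exists_lift (h : IsTannakian R ω) {X : T} (x : ω.obj X) :
    ∃ (P : T) (_ : rigid T P) (p : P ⟶ X) (y : ω.obj P), (ω.map p).hom y = x := by
  obtain ⟨P, p, hP, _⟩ := h.dominated X
  obtain ⟨y, hy⟩ := h.map_surjective p x
  exact ⟨P, hP, p, y, hy⟩

/-- Since `ω` preserves equalizers, `x` comes from `ω` of the equalizer of `f` and `g`, and there it
lifts to a rigid cover. -/
theorem exists_equalize (h : IsTannakian R ω) {X Y : T} (f g : X ⟶ Y) (x : ω.obj X)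
    (hx : (ω.map f).hom x = (ω.map g).hom x) :
    ∃ (P : T) (_ : rigid T P) (p : P ⟶ X) (y : ω.obj P), (ω.map p).hom y = x ∧ p ≫ f = p ≫ g := by
  have := h.leftExact
  let l := Limits.isLimitForkMapOfIsLimit ω _ (Limits.equalizerIsEqualizer f g)
  -- The vector `x` is encoded as a map from `R`, to which the universal property of the equalizer
  -- in modules applies.
  let k : ModuleCat.of R R ⟶ ω.obj X := ModuleCat.ofHom (LinearMap.toSpanSingleton R _ x)
  have hk : k ≫ ω.map f = k ≫ ω.map g := by
    ext
    simpa [k] using hx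
  obtain ⟨m, hm⟩ := Limits.Fork.IsLimit.lift' l k hk
  have hm' : (ω.map (Limits.equalizer.ι f g)).hom (m.hom (1 : R)) = x := by
    have := congrArg (fun k => k.hom (1 : R)) hm
    simpa [k] using this
  obtain ⟨P, hP, p, y, hy⟩ := h.exists_lift (m.hom (1 : R))
  refine ⟨P, hP, p ≫ Limits.equalizer.ι f g, y, ?_, ?_⟩
  · rw [map_comp_apply, hy, hm']
  · rw [Category.assoc, Category.assoc, Limits.equalizer.condition]

/-- A rigid cover of the vector `(x, y)` of `ω(X ⊞ Y)`. -/
theorem exists_pair (h : IsTannakian R ω) {X Y : T} (x : ω.obj X) (y : ω.obj Y) :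
    ∃ (P : T) (_ : rigid T P) (p : P ⟶ X) (q : P ⟶ Y) (z : ω.obj P),
      (ω.map p).hom z = x ∧ (ω.map q).hom z = y := by
  have := h.leftExact
  have := ω.additive_of_preserves_binary_products
  let x' := (ω.map (Limits.biprod.inl : X ⟶ X ⊞ Y)).hom x
  let y' := (ω.map (Limits.biprod.inr : Y ⟶ X ⊞ Y)).hom y
  obtain ⟨P, hP, p, z, hz⟩ := h.exists_lift (x' + y')
  refine ⟨P, hP, p ≫ Limits.biprod.fst, p ≫ Limits.biprod.snd, z, ?_, ?_⟩
  · rw [map_comp_apply, hz, map_add, ← map_comp_apply, ← map_comp_apply]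
    simp
  · rw [map_comp_apply, hz, map_add, ← map_comp_apply, ← map_comp_apply]
    simp

/-- A substitute for the fibre product that stays among rigid objects. It makes constructions by
lifting to rigid covers independent of the lift. -/
theorem exists_comp_eq (h : IsTannakian R ω) {X Y Z : T} (f : X ⟶ Z) (g : Y ⟶ Z) (x : ω.obj X)
    (y : ω.obj Y) (hxy : (ω.map f).hom x = (ω.map g).hom y) :
    ∃ (P : T) (_ : rigid T P) (p : P ⟶ X) (q : P ⟶ Y) (z : ω.obj P),
      (ω.map p).hom z = x ∧ (ω.map q).hom z = y ∧ p ≫ f = q ≫ g := by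
  obtain ⟨P, hP, p, q, z, hp, hq⟩ := h.exists_pair x y
  obtain ⟨Q, hQ, r, t, ht, hr⟩ := h.exists_equalize (p ≫ f) (q ≫ g) z (by
    rw [map_comp_apply, map_comp_apply, hp, hq, hxy])
  exact ⟨Q, hQ, r ≫ p, r ≫ q, t, by rw [map_comp_apply, ht, hp], by rw [map_comp_apply, ht, hq],
    by simpa using hr⟩

end IsTannakian

variable (ω) in
/-- The category of pairs `(P, x)` of a rigid object `P` and an element `x` of `ω(P)`. -/
abbrev Points := ((rigid T).ι ⋙ ω ⋙ CategoryTheory.forget (ModuleCat.{u} R)).Elements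

/-- The pair `(P, x)`. -/
abbrev Points.mk {P : T} (hP : rigid T P) (x : ω.obj P) : Points ω :=
  ⟨⟨P, hP⟩, x⟩

/-- Cones over two pairs come from biproducts and cones over parallel maps from equalizers. The dual
index category is then filtered, which gives elementwise control over `Coord`. -/
theorem IsTannakian.isCofiltered (h : IsTannakian R ω) : IsCofiltered (Points ω) where
  cone_objs p q := by
    obtain ⟨P, hP, a, b, z, ha, hb⟩ := h.exists_pair (X := p.1.obj) (Y := q.1.obj) p.2 q.2
    exact ⟨Points.mk hP z, ⟨ObjectProperty.homMk a, ha⟩, ⟨ObjectProperty.homMk b, hb⟩, trivial⟩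
  cone_maps p q f g := by
    obtain ⟨P, hP, a, z, ha, hfg⟩ := h.exists_equalize f.1.hom g.1.hom p.2 (f.2.trans g.2.symm)
    refine ⟨Points.mk hP z, ⟨ObjectProperty.homMk a, ha⟩, ?_⟩
    apply Subtype.ext
    apply InducedCategory.hom_ext
    exact hfg
  nonempty := by
    obtain ⟨P, hP, _⟩ := h.exists_lift (X := 𝟙_ T) 0
    exact ⟨Points.mk hP 0⟩

instance [EssentiallySmall.{u} T] : EssentiallySmall.{u} (rigid T).FullSubcategory :=
  essentiallySmall_of_fully_faithful (rigid T).ι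

instance [EssentiallySmall.{u} T] : Limits.HasColimitsOfShape (Points ω)ᵒᵖ (ModuleCat.{u} R) :=
  Limits.hasColimitsOfShape_of_essentiallySmall.{u} _ _

/-- The index category is only essentially small, so the statement about filtered colimits is
transported from a small model. -/
theorem IsTannakian.preserves_forget [EssentiallySmall.{u} T] (h : IsTannakian R ω) :
    Limits.PreservesColimitsOfShape (Points ω)ᵒᵖ (CategoryTheory.forget (ModuleCat.{u} R)) := by
  have := h.isCofiltered
  have : IsFiltered (SmallModel.{u} (Points ω)ᵒᵖ) :=
    IsFiltered.of_equivalence (equivSmallModel.{u} _)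
  exact Limits.preservesColimitsOfShape_of_equiv (equivSmallModel.{u} (Points ω)ᵒᵖ).symm _

variable (ω) in
/-- The functor `(P, x) ↦ Hom(ω(P), R)`. -/
@[simps]
def dualFunctor : (Points ω)ᵒᵖ ⥤ ModuleCat.{u} R where
  obj p := ModuleCat.of R (Module.Dual R (ω.obj p.unop.1.obj))
  map f := ModuleCat.ofHom (Module.Dual.transpose (R := R) (ω.map f.unop.1.hom).hom)
  map_id p := by
    refine ModuleCat.hom_ext (LinearMap.ext fun φ => LinearMap.ext fun x => ?_)
    exact congrArg φ (map_id_apply x)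
  map_comp f g := by
    refine ModuleCat.hom_ext (LinearMap.ext fun φ => LinearMap.ext fun x => ?_)
    exact congrArg φ (map_comp_apply _ _ x)


end Points

/-! ### The module of matrix coefficients. -/

section Coordinates

variable {R : Type u} [CommRing R] {T : Type w} [Category.{v} T] [EssentiallySmall.{u} T]
  [Abelian T] [Linear R T] [MonoidalCategory T]

/-- The colimit of the modules `Hom(ω(P), R)` over all pairs `(P, x)` of a rigid object `P` and
an element `x` of `ω(P)`: the coordinate ring of `Aut^⊗(ω)`. -/
def Coord {ω : T ⥤ ModuleCat.{u} R} (_ : IsTannakian R ω) : Type u :=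
  (Limits.colimit (dualFunctor ω) : ModuleCat.{u} R)

variable {ω : T ⥤ ModuleCat.{u} R} {h : IsTannakian R ω}

namespace Coord

instance : AddCommGroup (Coord h) :=
  inferInstanceAs (AddCommGroup (Limits.colimit (dualFunctor ω) : ModuleCat.{u} R))

instance : Module R (Coord h) :=
  inferInstanceAs (Module R (Limits.colimit (dualFunctor ω) : ModuleCat.{u} R))

variable (h) in
/-- The matrix coefficient `g ↦ φ(g x)`, as a linear map in `φ`. -/
def mk {P : T} (hP : rigid T P) (x : ω.obj P) : Module.Dual R (ω.obj P) →ₗ[R] Coord h :=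
  (Limits.colimit.ι (dualFunctor ω) (Opposite.op (Points.mk hP x))).hom

/-- The relation `φ(g(a x)) = (φ ∘ a)(g x)`, which expresses the naturality of `g`. -/
theorem mk_map {P Q : T} (hP : rigid T P) (hQ : rigid T Q) (a : P ⟶ Q) (x : ω.obj P)
    (φ : Module.Dual R (ω.obj Q)) :
    mk h hQ ((ω.map a).hom x) φ = mk h hP x (φ ∘ₗ (ω.map a).hom) := by
  let m : Points.mk hP x ⟶ Points.mk hQ ((ω.map a).hom x) := ⟨ObjectProperty.homMk a, rfl⟩
  exact (congrArg (fun k => k.hom φ) (Limits.colimit.w (dualFunctor ω) m.op)).symm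

/-- In a filtered colimit no sums of coefficients are needed. -/
theorem exists_mk (l : Coord h) : ∃ (P : T) (hP : rigid T P) (x : ω.obj P)
    (φ : Module.Dual R (ω.obj P)), mk h hP x φ = l := by
  have := h.isCofiltered
  have := h.preserves_forget
  obtain ⟨⟨⟨⟨P, hP⟩, x⟩⟩, φ, hφ⟩ := Limits.Concrete.colimit_exists_rep (dualFunctor ω) l
  exact ⟨P, hP, x, φ, hφ⟩

section Desc

variable {M : Type u} [AddCommGroup M] [Module R M]
  (c : ∀ (P : T) (_ : rigid T P), ω.obj P → Module.Dual R (ω.obj P) →ₗ[R] M)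
  (hc : ∀ (P Q : T) (hP : rigid T P) (hQ : rigid T Q) (a : P ⟶ Q) (x : ω.obj P)
    (φ : Module.Dual R (ω.obj Q)), c Q hQ ((ω.map a).hom x) φ = c P hP x (φ ∘ₗ (ω.map a).hom))

/-- The cocone that is given by a compatible family of linear maps. -/
def cocone : Limits.Cocone (dualFunctor ω) where
  pt := ModuleCat.of R M
  ι :=
    { app := fun p => ModuleCat.ofHom (c p.unop.1.obj p.unop.1.property p.unop.2)
      naturality := fun p q f => by
        ext φ
        have e : (ω.map f.unop.1.hom).hom q.unop.2 = p.unop.2 := f.unop.2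
        have := hc _ _ q.unop.1.property p.unop.1.property f.unop.1.hom q.unop.2 φ
        rw [e] at this
        exact this.symm }

/-- To give a linear map out of the coordinate ring is to give its values on the matrix
coefficients. -/
def desc : Coord h →ₗ[R] M :=
  (Limits.colimit.desc (dualFunctor ω) (cocone c hc)).hom

theorem desc_mk {P : T} (hP : rigid T P) (x : ω.obj P) (φ : Module.Dual R (ω.obj P)) :
    desc c hc (mk h hP x φ) = c P hP x φ :=
  congrArg (fun k => k.hom φ)
    (Limits.colimit.ι_desc (cocone c hc) (Opposite.op (Points.mk hP x)))

end Desc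

theorem hom_ext {M : Type*} [AddCommGroup M] [Module R M] {f g : Coord h →ₗ[R] M}
    (hfg : ∀ (P : T) (hP : rigid T P) (x : ω.obj P) (φ : Module.Dual R (ω.obj P)),
      f (mk h hP x φ) = g (mk h hP x φ)) : f = g := by
  ext l
  obtain ⟨P, hP, x, φ, rfl⟩ := exists_mk l
  exact hfg P hP x φ

section Tensor

variable (N : Type u) [AddCommGroup N] [Module R N]

/-- Tensoring with `N` preserves the colimit, so elements of `Coord h ⊗ N` also live at a single
stage. -/
theorem exists_rTensor_mk (l : Coord h ⊗[R] N) : ∃ (P : T) (hP : rigid T P) (x : ω.obj P)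
    (t : Module.Dual R (ω.obj P) ⊗[R] N), (mk h hP x).rTensor N t = l := by
  have := h.isCofiltered
  have := h.preserves_forget
  let c := Limits.isColimitOfPreserves (tensorRight (ModuleCat.of R N))
    (Limits.colimit.isColimit (dualFunctor ω))
  obtain ⟨⟨⟨⟨P, hP⟩, x⟩⟩, t, ht⟩ := Limits.Concrete.isColimit_exists_rep _ c l
  exact ⟨P, hP, x, t, ht⟩

/-- An element that becomes zero in a filtered colimit is already zero at some later stage; a later
stage is a pair `(Q, y)` mapping to `(P, x)`. -/
theorem exists_of_rTensor_mk_eq_zero {P : T} {hP : rigid T P} {x : ω.obj P}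
    {t : Module.Dual R (ω.obj P) ⊗[R] N} (ht : (mk h hP x).rTensor N t = 0) :
    ∃ (Q : T) (_ : rigid T Q) (a : Q ⟶ P) (y : ω.obj Q), (ω.map a).hom y = x ∧
      (Module.Dual.transpose (R := R) (ω.map a).hom).rTensor N t = 0 := by
  have := h.isCofiltered
  have := h.preserves_forget
  let c := Limits.isColimitOfPreserves (tensorRight (ModuleCat.of R N))
    (Limits.colimit.isColimit (dualFunctor ω))
  obtain ⟨⟨⟨⟨Q, hQ⟩, y⟩⟩, f, hf⟩ := (Limits.IsColimit.eq_iff' c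
    (i := Opposite.op (Points.mk hP x)) t 0).mp (by
      rw [map_zero]
      exact ht)
  refine ⟨Q, hQ, f.unop.1.hom, y, f.unop.2, ?_⟩
  rw [map_zero] at hf
  exact hf

end Tensor

end Coord

end Coordinates

/-! ### The tensor constraints of `ω` on vectors and on linear forms. -/

section TensorFunctor

variable {R : Type u} [CommRing R] {T : Type w} [Category.{v} T] [MonoidalCategory T]
  {ω : T ⥤ ModuleCat.{u} R} [ω.Monoidal]

theorem map_μ {X X' Y Y' : T} (a : X ⟶ X') (b : Y ⟶ Y') (z : ω.obj X ⊗[R] ω.obj Y) :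
    (ω.map (a ⊗ₘ b)).hom ((Functor.LaxMonoidal.μ ω X Y).hom z) =
      (Functor.LaxMonoidal.μ ω X' Y').hom
        (TensorProduct.map (ω.map a).hom (ω.map b).hom z) :=
  (congrArg (fun k => k.hom z) (Functor.LaxMonoidal.μ_natural ω a b)).symm

theorem δ_μ {X Y : T} (z : ω.obj X ⊗[R] ω.obj Y) :
    (Functor.OplaxMonoidal.δ ω X Y).hom ((Functor.LaxMonoidal.μ ω X Y).hom z) = z :=
  congrArg (fun k => k.hom z) (Functor.Monoidal.μ_δ ω X Y)

theorem μ_δ {X Y : T} (z : ω.obj (X ⊗ Y)) :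
    (Functor.LaxMonoidal.μ ω X Y).hom ((Functor.OplaxMonoidal.δ ω X Y).hom z) = z :=
  congrArg (fun k => k.hom z) (Functor.Monoidal.δ_μ ω X Y)

theorem ε_η (z : ω.obj (𝟙_ T)) :
    (Functor.LaxMonoidal.ε ω).hom ((Functor.OplaxMonoidal.η ω).hom z) = z :=
  congrArg (fun k => k.hom z) (Functor.Monoidal.η_ε ω)

theorem η_ε (r : R) :
    (Functor.OplaxMonoidal.η ω).hom ((Functor.LaxMonoidal.ε ω).hom r) = r :=
  congrArg (fun k => k.hom r) (Functor.Monoidal.ε_η ω)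

theorem map_associator_μ {X Y Z : T} (x : ω.obj X) (y : ω.obj Y) (z : ω.obj Z) :
    (ω.map (α_ X Y Z).hom).hom ((Functor.LaxMonoidal.μ ω _ _).hom
      ((Functor.LaxMonoidal.μ ω _ _).hom (x ⊗ₜ[R] y) ⊗ₜ[R] z)) =
    (Functor.LaxMonoidal.μ ω _ _).hom (x ⊗ₜ[R] (Functor.LaxMonoidal.μ ω _ _).hom (y ⊗ₜ[R] z)) :=
  congrArg (fun k => k.hom ((x ⊗ₜ[R] y) ⊗ₜ[R] z)) (Functor.LaxMonoidal.associativity ω X Y Z)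

theorem map_leftUnitor_μ {X : T} (r : R) (x : ω.obj X) :
    (ω.map (λ_ X).hom).hom ((Functor.LaxMonoidal.μ ω _ _).hom
      ((Functor.LaxMonoidal.ε ω).hom r ⊗ₜ[R] x)) = r • x :=
  (congrArg (fun k => k.hom (r ⊗ₜ[R] x)) (Functor.LaxMonoidal.left_unitality ω X)).symm

/-- The product of linear forms on `ω(X)` and `ω(Y)`, a linear form on `ω(X ⊗ Y)`. -/
def dualProd (X Y : T) : Module.Dual R (ω.obj X) →ₗ[R] Module.Dual R (ω.obj Y) →ₗ[R]
    Module.Dual R (ω.obj (X ⊗ Y)) :=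
  TensorProduct.curry (Module.Dual.transpose (R := R) (Functor.OplaxMonoidal.δ ω X Y).hom ∘ₗ
    TensorProduct.dualDistrib R (ω.obj X) (ω.obj Y))

theorem dualProd_apply {X Y : T} (φ : Module.Dual R (ω.obj X)) (ψ : Module.Dual R (ω.obj Y))
    (z : ω.obj (X ⊗ Y)) : dualProd X Y φ ψ z =
      TensorProduct.dualDistrib R (ω.obj X) (ω.obj Y) (φ ⊗ₜ ψ)
        ((Functor.OplaxMonoidal.δ ω X Y).hom z) := rfl

theorem dualProd_μ {X Y : T} (φ : Module.Dual R (ω.obj X)) (ψ : Module.Dual R (ω.obj Y))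
    (x : ω.obj X) (y : ω.obj Y) :
    dualProd X Y φ ψ ((Functor.LaxMonoidal.μ ω X Y).hom (x ⊗ₜ[R] y)) = φ x * ψ y := by
  rw [dualProd_apply, δ_μ]
  rfl

theorem ext_μ {X Y : T} {M : Type*} [AddCommGroup M] [Module R M] {f g : ω.obj (X ⊗ Y) →ₗ[R] M}
    (hfg : ∀ x y, f ((Functor.LaxMonoidal.μ ω X Y).hom (x ⊗ₜ[R] y)) =
      g ((Functor.LaxMonoidal.μ ω X Y).hom (x ⊗ₜ[R] y))) : f = g := by
  have : f ∘ₗ (Functor.LaxMonoidal.μ ω X Y).hom = g ∘ₗ (Functor.LaxMonoidal.μ ω X Y).hom :=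
    TensorProduct.ext' hfg
  ext z
  rw [← μ_δ z]
  exact LinearMap.congr_fun this _

theorem ext_μ₃ {X Y Z : T} {M : Type*} [AddCommGroup M] [Module R M]
    {f g : ω.obj ((X ⊗ Y) ⊗ Z) →ₗ[R] M}
    (hfg : ∀ x y z, f ((Functor.LaxMonoidal.μ ω _ _).hom
        ((Functor.LaxMonoidal.μ ω _ _).hom (x ⊗ₜ[R] y) ⊗ₜ[R] z)) =
      g ((Functor.LaxMonoidal.μ ω _ _).hom
        ((Functor.LaxMonoidal.μ ω _ _).hom (x ⊗ₜ[R] y) ⊗ₜ[R] z))) : f = g := by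
  refine ext_μ fun w z => ?_
  let m : ω.obj (X ⊗ Y) →ₗ[R] ω.obj ((X ⊗ Y) ⊗ Z) :=
    (Functor.LaxMonoidal.μ ω _ _).hom ∘ₗ (TensorProduct.mk R _ _).flip z
  exact LinearMap.congr_fun (ext_μ (f := f ∘ₗ m) (g := g ∘ₗ m) fun x y => hfg x y z) w

theorem dualProd_comp {X X' Y Y' : T} (a : X ⟶ X') (b : Y ⟶ Y') (φ : Module.Dual R (ω.obj X'))
    (ψ : Module.Dual R (ω.obj Y')) : dualProd X' Y' φ ψ ∘ₗ (ω.map (a ⊗ₘ b)).hom =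
      dualProd X Y (φ ∘ₗ (ω.map a).hom) (ψ ∘ₗ (ω.map b).hom) := by
  refine ext_μ fun x y => ?_
  rw [LinearMap.comp_apply, map_μ, TensorProduct.map_tmul, dualProd_μ, dualProd_μ]
  rfl

theorem dualProd_assoc {X Y Z : T} (φ : Module.Dual R (ω.obj X)) (ψ : Module.Dual R (ω.obj Y))
    (χ : Module.Dual R (ω.obj Z)) : dualProd _ _ φ (dualProd _ _ ψ χ) ∘ₗ (ω.map (α_ X Y Z).hom).hom =
      dualProd _ _ (dualProd _ _ φ ψ) χ := by
  refine ext_μ₃ fun x y z => ?_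
  rw [LinearMap.comp_apply, map_associator_μ, dualProd_μ, dualProd_μ, dualProd_μ, dualProd_μ,
    mul_assoc]

theorem dualProd_unit {X : T} (φ : Module.Dual R (ω.obj X)) :
    φ ∘ₗ (ω.map (λ_ X).hom).hom = dualProd _ _ (Functor.OplaxMonoidal.η ω).hom φ := by
  refine ext_μ fun x y => ?_
  rw [dualProd_μ, LinearMap.comp_apply, ← ε_η x, map_leftUnitor_μ, η_ε, map_smul, smul_eq_mul]

end TensorFunctor

section BraidedFunctor

variable {R : Type u} [CommRing R] {T : Type w} [Category.{v} T] [MonoidalCategory T]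
  [BraidedCategory T] {ω : T ⥤ ModuleCat.{u} R} [ω.Braided]

theorem map_braiding_μ {X Y : T} (x : ω.obj X) (y : ω.obj Y) :
    (ω.map (β_ X Y).hom).hom ((Functor.LaxMonoidal.μ ω X Y).hom (x ⊗ₜ[R] y)) =
      (Functor.LaxMonoidal.μ ω Y X).hom (y ⊗ₜ[R] x) :=
  congrArg (fun k => k.hom (x ⊗ₜ[R] y)) (Functor.LaxBraided.braided (F := ω) X Y)

theorem dualProd_comm {X Y : T} (φ : Module.Dual R (ω.obj X)) (ψ : Module.Dual R (ω.obj Y)) :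
    dualProd Y X ψ φ ∘ₗ (ω.map (β_ X Y).hom).hom = dualProd X Y φ ψ := by
  refine ext_μ fun x y => ?_
  rw [LinearMap.comp_apply, map_braiding_μ, dualProd_μ, dualProd_μ, mul_comm]

end BraidedFunctor

section Rigid

variable {T : Type w} [Category.{v} T] [MonoidalCategory T]

theorem rigid_unit : rigid T (𝟙_ T) := ObjectProperty.IsMonoidal.toContainsUnit.prop_unit

theorem rigid_tensor {X Y : T} (hX : rigid T X) (hY : rigid T Y) : rigid T (X ⊗ Y) :=
  ObjectProperty.IsMonoidal.toTensorLE.prop_tensor _ _ hX hY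

end Rigid

/-! ### The ring structure on matrix coefficients. -/

section Ring

variable {R : Type u} [CommRing R] {T : Type w} [Category.{v} T] [EssentiallySmall.{u} T]
  [Abelian T] [Linear R T] [MonoidalCategory T] {ω : T ⥤ ModuleCat.{u} R} {h : IsTannakian R ω}

namespace Coord

section Monoidal

variable [ω.Monoidal]

/-- The product with a given matrix coefficient, for a fixed vector. -/
def mulMk {P : T} (hP : rigid T P) (x : ω.obj P) :
    Module.Dual R (ω.obj P) →ₗ[R] Coord h →ₗ[R] Coord h where
  toFun φ := desc (fun Q hQ y => mk h (rigid_tensor hP hQ)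
      ((Functor.LaxMonoidal.μ ω P Q).hom (x ⊗ₜ[R] y)) ∘ₗ dualProd P Q φ)
    (fun Q Q' hQ hQ' a y ψ => by
      have e := map_μ (ω := ω) (𝟙 P) a (x ⊗ₜ[R] y)
      rw [TensorProduct.map_tmul, map_id_apply] at e
      rw [LinearMap.comp_apply, LinearMap.comp_apply, ← e,
        mk_map (rigid_tensor hP hQ) (rigid_tensor hP hQ'), dualProd_comp]
      simp)
  map_add' φ φ' := hom_ext fun Q hQ y ψ => by
    simp only [LinearMap.add_apply, desc_mk, LinearMap.comp_apply, map_add]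
  map_smul' r φ := hom_ext fun Q hQ y ψ => by
    simp only [LinearMap.smul_apply, desc_mk, LinearMap.comp_apply, map_smul, RingHom.id_apply]

theorem mulMk_mk {P Q : T} (hP : rigid T P) (hQ : rigid T Q) (x : ω.obj P) (y : ω.obj Q)
    (φ : Module.Dual R (ω.obj P)) (ψ : Module.Dual R (ω.obj Q)) :
    mulMk hP x φ (mk h hQ y ψ) = mk h (rigid_tensor hP hQ)
      ((Functor.LaxMonoidal.μ ω P Q).hom (x ⊗ₜ[R] y)) (dualProd P Q φ ψ) :=
  desc_mk _ _ hQ y ψ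

/-- The multiplication of the coordinate ring. -/
def mul : Coord h →ₗ[R] Coord h →ₗ[R] Coord h :=
  desc (fun _ hP x => mulMk hP x) fun P P' hP hP' a x φ => hom_ext fun Q hQ y ψ => by
    have e := map_μ (ω := ω) a (𝟙 Q) (x ⊗ₜ[R] y)
    rw [TensorProduct.map_tmul, map_id_apply] at e
    rw [mulMk_mk, mulMk_mk, ← e, mk_map (rigid_tensor hP hQ) (rigid_tensor hP' hQ), dualProd_comp]
    simp

instance : Mul (Coord h) := ⟨fun a b => mul a b⟩

instance : One (Coord h) :=
  ⟨mk h rigid_unit ((Functor.LaxMonoidal.ε ω).hom (1 : R)) (Functor.OplaxMonoidal.η ω).hom⟩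

/-- Pointwise multiplication of functions on `G`: for a tensor automorphism, `φ(g x) ψ(g y) = (φ ⊗
ψ)(g(x ⊗ y))`. -/
theorem mk_mul_mk {P Q : T} (hP : rigid T P) (hQ : rigid T Q) (x : ω.obj P) (y : ω.obj Q)
    (φ : Module.Dual R (ω.obj P)) (ψ : Module.Dual R (ω.obj Q)) :
    mk h hP x φ * mk h hQ y ψ = mk h (rigid_tensor hP hQ)
      ((Functor.LaxMonoidal.μ ω P Q).hom (x ⊗ₜ[R] y)) (dualProd P Q φ ψ) := by
  change mul (mk h hP x φ) (mk h hQ y ψ) = _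
  rw [mul, desc_mk, mulMk_mk]

theorem one_def : (1 : Coord h) =
    mk h rigid_unit ((Functor.LaxMonoidal.ε ω).hom (1 : R)) (Functor.OplaxMonoidal.η ω).hom := rfl

/-- The two products are coefficients of `(P ⊗ Q) ⊗ S` and `P ⊗ (Q ⊗ S)`; the colimit relation along
the associator identifies them. The unit and commutativity laws use the unitor and the braiding in
the same way. -/
theorem mul_assoc' (a b c : Coord h) : a * b * c = a * (b * c) := by
  obtain ⟨P, hP, x, φ, rfl⟩ := exists_mk a
  obtain ⟨Q, hQ, y, ψ, rfl⟩ := exists_mk b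
  obtain ⟨S, hS, z, χ, rfl⟩ := exists_mk c
  simp only [mk_mul_mk]
  rw [← map_associator_μ, mk_map (rigid_tensor (rigid_tensor hP hQ) hS), dualProd_assoc]

theorem one_mul' (a : Coord h) : 1 * a = a := by
  obtain ⟨P, hP, x, φ, rfl⟩ := exists_mk a
  rw [one_def, mk_mul_mk, ← dualProd_unit, ← mk_map _ hP, map_leftUnitor_μ, one_smul]

end Monoidal

variable [BraidedCategory T] [ω.Braided]

theorem mul_comm' (a b : Coord h) : a * b = b * a := by
  obtain ⟨P, hP, x, φ, rfl⟩ := exists_mk a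
  obtain ⟨Q, hQ, y, ψ, rfl⟩ := exists_mk b
  rw [mk_mul_mk, mk_mul_mk, ← dualProd_comm, ← mk_map _ (rigid_tensor hQ hP), map_braiding_μ]

instance : CommRing (Coord h) where
  __ := (inferInstance : AddCommGroup (Coord h))
  left_distrib a b c := map_add (mul a) b c
  right_distrib a b c := LinearMap.map_add₂ mul a b c
  zero_mul a := LinearMap.map_zero₂ mul a
  mul_zero a := map_zero (mul a)
  mul_assoc := mul_assoc'
  one_mul := one_mul'
  mul_one a := by rw [mul_comm', one_mul']
  mul_comm := mul_comm'

instance : Algebra R (Coord h) :=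
  Algebra.ofModule (fun r a b => LinearMap.map_smul₂ mul r a b) (fun r a b => map_smul (mul a) r b)

end Coord

end Ring

/-! ### Matrix coefficients with values in a module, and flatness. -/

section DualTensor

variable {R : Type u} [CommRing R] {T : Type w} [Category.{v} T] [MonoidalCategory T]
  {ω : T ⥤ ModuleCat.{u} R} [ω.Monoidal]

/-- The isomorphism `Hom(ω(P), R) ⊗ N ≃ Hom(ω(P), N)` for a rigid object `P`. -/
def dualTensorEquiv {P : T} (hP : rigid T P) (N : Type u) [AddCommGroup N] [Module R N] :
    Module.Dual R (ω.obj P) ⊗[R] N ≃ₗ[R] (ω.obj P →ₗ[R] N) :=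
  haveI := finite_of_rigid ω hP
  haveI := projective_of_rigid (ω := ω) hP
  LinearEquiv.ofBijective (dualTensorHom R (ω.obj P) N) dualTensorHom_bijective

theorem dualTensorEquiv_symm_comp {P Q : T} (hP : rigid T P) (hQ : rigid T Q) (a : Q ⟶ P)
    {N : Type u} [AddCommGroup N] [Module R N] (t : Module.Dual R (ω.obj P) ⊗[R] N) :
    dualTensorEquiv hP N t ∘ₗ (ω.map a).hom =
      dualTensorEquiv hQ N ((Module.Dual.transpose (R := R) (ω.map a).hom).rTensor N t) := by
  induction t with
  | zero => simp
  | add t t' ht ht' => simp only [map_add, LinearMap.add_comp, ht, ht']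
  | tmul φ n => rfl

variable {N : Type u} [AddCommGroup N] [Module R N]

/-- As `ω(P)` is finite projective, every map out of it is a sum of maps `φ(-) n`. -/
theorem rigid_hom_induction {P : T} (hP : rigid T P) {p : (ω.obj P →ₗ[R] N) → Prop} (zero : p 0)
    (tmul : ∀ φ n, p (dualTensorHom R (ω.obj P) N (φ ⊗ₜ n)))
    (add : ∀ k k', p k → p k' → p (k + k')) (k : ω.obj P →ₗ[R] N) : p k := by
  obtain ⟨t, rfl⟩ := (dualTensorEquiv hP N).surjective k
  induction t with
  | zero => simpa using zero
  | add t t' ht ht' => simpa using add _ _ ht ht'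
  | tmul φ n => exact tmul φ n

end DualTensor

section MkMod

variable {R : Type u} [CommRing R] {T : Type w} [Category.{v} T] [EssentiallySmall.{u} T]
  [Abelian T] [Linear R T] [MonoidalCategory T] {ω : T ⥤ ModuleCat.{u} R} [ω.Monoidal]
  {h : IsTannakian R ω}

namespace Coord

variable (h) in
/-- The matrix coefficients with values in a module `N`: the colimit of the modules `Hom(ω(P), N)`
over all pairs `(P, x)` is `Coord h ⊗ N`. -/
def mkMod {P : T} (hP : rigid T P) (x : ω.obj P) {N : Type u} [AddCommGroup N] [Module R N] :
    (ω.obj P →ₗ[R] N) →ₗ[R] Coord h ⊗[R] N :=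
  (mk h hP x).rTensor N ∘ₗ (dualTensorEquiv hP N).symm.toLinearMap

variable {N : Type u} [AddCommGroup N] [Module R N]

theorem mkMod_dualTensorHom {P : T} (hP : rigid T P) (x : ω.obj P)
    (t : Module.Dual R (ω.obj P) ⊗[R] N) :
    mkMod h hP x (dualTensorHom R (ω.obj P) N t) = (mk h hP x).rTensor N t :=
  congrArg ((mk h hP x).rTensor N) ((dualTensorEquiv hP N).symm_apply_apply t)

theorem mkMod_tmul {P : T} (hP : rigid T P) (x : ω.obj P) (φ : Module.Dual R (ω.obj P)) (n : N) :
    mkMod h hP x (dualTensorHom R (ω.obj P) N (φ ⊗ₜ n)) = mk h hP x φ ⊗ₜ n := by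
  rw [mkMod_dualTensorHom, LinearMap.rTensor_tmul]

theorem mkMod_map {P Q : T} (hP : rigid T P) (hQ : rigid T Q) (a : P ⟶ Q) (x : ω.obj P)
    (k : ω.obj Q →ₗ[R] N) :
    mkMod h hQ ((ω.map a).hom x) k = mkMod h hP x (k ∘ₗ (ω.map a).hom) := by
  refine rigid_hom_induction hQ (p := fun k => mkMod h hQ ((ω.map a).hom x) k =
    mkMod h hP x (k ∘ₗ (ω.map a).hom)) (by simp) (fun φ n => ?_) (fun k k' hk hk' => ?_) k
  · rw [mkMod_tmul, mk_map hP hQ, ← mkMod_tmul]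
    rfl
  · simp only [map_add, LinearMap.add_comp, hk, hk']

theorem lTensor_mkMod {N' : Type u} [AddCommGroup N'] [Module R N'] (f : N →ₗ[R] N') {P : T}
    (hP : rigid T P) (x : ω.obj P) (k : ω.obj P →ₗ[R] N) :
    f.lTensor (Coord h) (mkMod h hP x k) = mkMod h hP x (f ∘ₗ k) := by
  refine rigid_hom_induction hP (p := fun k => f.lTensor (Coord h) (mkMod h hP x k) =
    mkMod h hP x (f ∘ₗ k)) (by simp) (fun φ n => ?_) (fun k k' hk hk' => ?_) k
  · have e : f ∘ₗ dualTensorHom R (ω.obj P) N (φ ⊗ₜ n) = dualTensorHom R (ω.obj P) N' (φ ⊗ₜ f n) := by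
      ext; simp
    rw [e, mkMod_tmul, mkMod_tmul, LinearMap.lTensor_tmul]
  · simp only [map_add, LinearMap.comp_add, hk, hk']

theorem exists_mkMod (l : Coord h ⊗[R] N) : ∃ (P : T) (hP : rigid T P) (x : ω.obj P)
    (k : ω.obj P →ₗ[R] N), mkMod h hP x k = l := by
  obtain ⟨P, hP, x, t, ht⟩ := exists_rTensor_mk N l
  exact ⟨P, hP, x, dualTensorHom R (ω.obj P) N t, by rw [mkMod_dualTensorHom, ht]⟩

/-- The key criterion: an equation in `Coord h ⊗ N` produces a morphism of `T` whose image still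
contains `x` and on which `k` itself vanishes. -/
theorem exists_of_mkMod_eq_zero {P : T} {hP : rigid T P} {x : ω.obj P} {k : ω.obj P →ₗ[R] N}
    (hk : mkMod h hP x k = 0) : ∃ (Q : T) (_ : rigid T Q) (a : Q ⟶ P) (y : ω.obj Q),
      (ω.map a).hom y = x ∧ k ∘ₗ (ω.map a).hom = 0 := by
  obtain ⟨t, rfl⟩ := (dualTensorEquiv hP N).surjective k
  obtain ⟨Q, hQ, a, y, hy, ht⟩ := exists_of_rTensor_mk_eq_zero N
    ((mkMod_dualTensorHom hP x t).symm.trans hk)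
  exact ⟨Q, hQ, a, y, hy, by rw [dualTensorEquiv_symm_comp hP hQ, ht, map_zero]⟩

/-- Both coefficients are pulled back to a common cover, where the vanishing criterion applies to
their difference. -/
theorem exists_of_mkMod_eq {P Q : T} {hP : rigid T P} {hQ : rigid T Q} {x : ω.obj P}
    {y : ω.obj Q} {k : ω.obj P →ₗ[R] N} {l : ω.obj Q →ₗ[R] N}
    (hkl : mkMod h hP x k = mkMod h hQ y l) :
    ∃ (S : T) (_ : rigid T S) (a : S ⟶ P) (b : S ⟶ Q) (z : ω.obj S), (ω.map a).hom z = x ∧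
      (ω.map b).hom z = y ∧ k ∘ₗ (ω.map a).hom = l ∘ₗ (ω.map b).hom := by
  obtain ⟨S, hS, a, b, z, rfl, rfl⟩ := h.exists_pair x y
  rw [mkMod_map hS, mkMod_map hS, ← sub_eq_zero, ← map_sub] at hkl
  obtain ⟨U, hU, c, t, rfl, hc⟩ := exists_of_mkMod_eq_zero hkl
  refine ⟨U, hU, c ≫ a, c ≫ b, t, map_comp_apply .., map_comp_apply .., ?_⟩
  rw [LinearMap.sub_comp, sub_eq_zero] at hc
  simpa [LinearMap.comp_assoc] using hc

/-- `Coord h ⊗ N` is a filtered colimit of the functors `Hom(ω(P), N)`, which are left exact in `N`: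
if `f ∘ k` dies on a cover and `f` is injective, then `k` dies on the same cover. -/
instance : Module.Flat R (Coord h) := by
  rw [Module.Flat.iff_lTensor_preserves_injective_linearMap]
  intro N N' _ _ _ _ f hf
  rw [injective_iff_map_eq_zero]
  intro l hl
  obtain ⟨P, hP, x, k, rfl⟩ := exists_mkMod l
  rw [lTensor_mkMod] at hl
  obtain ⟨Q, hQ, a, y, rfl, ha⟩ := exists_of_mkMod_eq_zero hl
  rw [mkMod_map hQ]
  rw [LinearMap.comp_assoc] at ha
  have : k ∘ₗ (ω.map a).hom = 0 := LinearMap.ext fun z => hf (by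
    simpa using LinearMap.congr_fun ha z)
  rw [this, map_zero]

end Coord

end MkMod

/-! ### The endomorphisms that an algebra-valued point induces through a map `V → L ⊗ V`. -/

section Act

variable {R : Type u} [CommRing R] {L : Type u} [CommRing L] [Algebra R L]
  {A B : Type u} [CommRing A] [Algebra R A] [CommRing B] [Algebra R B]
  {V W U : Type u} [AddCommGroup V] [Module R V] [AddCommGroup W] [Module R W]
  [AddCommGroup U] [Module R U]

/-- For a linear map `ρ : V → L ⊗ V` and a homomorphism `f : L → A`, the `A`-linear
endomorphism of `A ⊗ V` with `1 ⊗ v ↦ (f ⊗ V) (ρ v)`. -/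
def act (ρ : V →ₗ[R] L ⊗[R] V) (f : L →ₐ[R] A) : Module.End A (A ⊗[R] V) :=
  LinearMap.liftBaseChange A (scalarMap f V ∘ₗ ρ)

theorem act_tmul (ρ : V →ₗ[R] L ⊗[R] V) (f : L →ₐ[R] A) (a : A) (v : V) :
    act ρ f (a ⊗ₜ v) = a • scalarMap f V (ρ v) := by
  simp [act]

theorem act_one_tmul (ρ : V →ₗ[R] L ⊗[R] V) (f : L →ₐ[R] A) (v : V) :
    act ρ f (1 ⊗ₜ v) = scalarMap f V (ρ v) := by
  rw [act_tmul, one_smul]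

theorem ext_one_tmul {Q : Type*} [AddCommGroup Q] [Module A Q] {f g : A ⊗[R] V →ₗ[A] Q}
    (hfg : ∀ v, f (1 ⊗ₜ v) = g (1 ⊗ₜ v)) : f = g := by
  refine LinearMap.ext fun z => ?_
  induction z with
  | zero => simp
  | add z z' hz hz' => simp only [map_add, hz, hz']
  | tmul a v =>
    have ha : a ⊗ₜ[R] v = a • (1 : A) ⊗ₜ[R] v := by simp [TensorProduct.smul_tmul']
    rw [ha, map_smul, map_smul, hfg]

theorem scalarMap_comp (f : L →ₐ[R] A) (φ : A →ₐ[R] B) (x : L ⊗[R] V) :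
    scalarMap (φ.comp f) V x = scalarMap φ V (scalarMap f V x) := by
  induction x with
  | zero => simp
  | tmul a m => simp
  | add x y hx hy => simp only [map_add, hx, hy]

theorem endMapFun_act (ρ : V →ₗ[R] L ⊗[R] V) (f : L →ₐ[R] A) (φ : A →ₐ[R] B) :
    endMapFun φ (act ρ f) = act ρ (φ.comp f) := by
  refine ext_one_tmul fun v => ?_
  have : (1 : B) ⊗ₜ[R] v = scalarMap φ V (1 ⊗ₜ v) := by simp
  rw [act_one_tmul, scalarMap_comp, this, endMapFun_scalarMap, act_one_tmul]

/-- An identity over `L` specializes along every `f : L → A`. The next lemma is the analogue for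
maps out of a tensor product. -/
theorem baseChange_act {ρ : V →ₗ[R] L ⊗[R] V} {σ : W →ₗ[R] L ⊗[R] W} {k : V →ₗ[R] W}
    (hk : ∀ v, k.baseChange L (ρ v) = σ (k v)) (f : L →ₐ[R] A) (x : A ⊗[R] V) :
    k.baseChange A (act ρ f x) = act σ f (k.baseChange A x) := by
  have : k.baseChange A ∘ₗ act ρ f = act σ f ∘ₗ k.baseChange A := ext_one_tmul fun v => by
    rw [LinearMap.comp_apply, LinearMap.comp_apply, act_one_tmul, LinearMap.baseChange_tmul,
      act_one_tmul, baseChange_scalarMap, hk]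
  exact LinearMap.congr_fun this x

theorem baseChange_pair_act {ρ : V →ₗ[R] L ⊗[R] V} {σ : W →ₗ[R] L ⊗[R] W}
    {τ : U →ₗ[R] L ⊗[R] U} {m : V ⊗[R] W →ₗ[R] U}
    (hm : ∀ v w, m.baseChange L (pair (ρ v) (σ w)) = τ (m (v ⊗ₜ w))) (f : L →ₐ[R] A)
    (z : A ⊗[R] (V ⊗[R] W)) :
    m.baseChange A (endTensor (act ρ f) (act σ f) z) = act τ f (m.baseChange A z) := by
  have : m.baseChange A ∘ₗ endTensor (act ρ f) (act σ f) = act τ f ∘ₗ m.baseChange A := by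
    refine ext_one_tmul fun z => ?_
    induction z with
    | zero => simp
    | add z z' hz hz' => simp only [TensorProduct.tmul_add, map_add, hz, hz']
    | tmul v w =>
      have : (1 : A) ⊗ₜ[R] (v ⊗ₜ[R] w) = pair (1 ⊗ₜ v) (1 ⊗ₜ w) := by simp
      rw [LinearMap.comp_apply, LinearMap.comp_apply, LinearMap.baseChange_tmul, act_one_tmul, this,
        endTensor_pair, act_one_tmul, act_one_tmul, ← scalarMap_pair, baseChange_scalarMap, hm]
  exact LinearMap.congr_fun this z

/-- An endomorphism `g` of `A ⊗ V` is surjective if `V` has a coevaluation that is preserved by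
`g ⊗ k` for some endomorphism `k`. -/
theorem surjective_of_coevaluation (e : W ⊗[R] V →ₗ[R] R) (c : V ⊗[R] W)
    (hc : ∀ v, TensorProduct.rid R V (e.lTensor V (TensorProduct.assoc R V W V (c ⊗ₜ v))) = v)
    (g : Module.End A (A ⊗[R] V)) (k : Module.End A (A ⊗[R] W))
    (hgk : endTensor g k (1 ⊗ₜ c) = 1 ⊗ₜ c) : Function.Surjective g := by
  intro x
  let θ : (V ⊗[R] W) ⊗[R] V →ₗ[R] V := (TensorProduct.rid R V).toLinearMap ∘ₗ
    e.lTensor V ∘ₗ (TensorProduct.assoc R V W V).toLinearMap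
  -- Contracting `g p ⊗ k d ⊗ y` gives a scalar times `g p`. Applied to `c = (g ⊗ k) c`, whose
  -- contraction with `x` is `x`, this puts `x` in the range of `g`.
  have hθ : ∀ (z : A ⊗[R] (V ⊗[R] W)) (y : A ⊗[R] V),
      θ.baseChange A (pair (endTensor g k z) y) ∈ g.range := by
    intro z y
    induction z using pair_induction with
    | h0 => simp
    | hadd z z' hz hz' => simpa only [map_add, pair_add_left] using add_mem hz hz'
    | h p d =>
      rw [endTensor_pair, LinearMap.baseChange_comp, LinearMap.baseChange_comp,
        LinearMap.comp_apply, LinearMap.comp_apply, baseChange_assoc_pair, LinearMap.lTensor,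
        baseChange_map_pair, baseChange_rid_pair, LinearMap.baseChange_id]
      exact Submodule.smul_mem _ _ ⟨p, rfl⟩
  have hx : θ.baseChange A (pair (1 ⊗ₜ c) x) = x := by
    induction x with
    | zero => simp
    | add x y hx hy => rw [pair_add_right, map_add, hx, hy]
    | tmul a v =>
      rw [pair_tmul, LinearMap.baseChange_tmul, one_mul]
      exact congrArg (a ⊗ₜ[R] ·) (hc v)
  rw [← hgk] at hx
  have := hθ (1 ⊗ₜ c) x
  rwa [hx] at this

end Act

/-! ### The coaction of the coordinate ring on every `ω(X)`. -/

section Coaction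

variable {R : Type u} [CommRing R] {T : Type w} [Category.{v} T] [EssentiallySmall.{u} T]
  [Abelian T] [Linear R T] [MonoidalCategory T] {ω : T ⥤ ModuleCat.{u} R}
  [ω.Monoidal]

theorem mkMod_eq_of_map_eq (h : IsTannakian R ω) {X P Q : T} (hP : rigid T P) (hQ : rigid T Q)
    (p : P ⟶ X) (q : Q ⟶ X) (x : ω.obj P) (y : ω.obj Q)
    (hxy : (ω.map p).hom x = (ω.map q).hom y) :
    Coord.mkMod h hP x (ω.map p).hom = Coord.mkMod h hQ y (ω.map q).hom := by
  obtain ⟨S, hS, a, b, z, rfl, rfl, hab⟩ := h.exists_comp_eq p q x y hxy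
  rw [Coord.mkMod_map hS, Coord.mkMod_map hS, ← ModuleCat.hom_comp, ← ModuleCat.hom_comp,
    ← ω.map_comp, ← ω.map_comp, hab]

/-- Naturality forces `g x = ω(p)(g y)` for a lift `y` of `x` to a rigid cover `p`, so the coaction
must be this coefficient; two lifts have a common refinement. -/
theorem exists_coaction (h : IsTannakian R ω) {X : T} (x : ω.obj X) :
    ∃ l : Coord h ⊗[R] ω.obj X, ∀ (P : T) (hP : rigid T P) (p : P ⟶ X) (y : ω.obj P),
      (ω.map p).hom y = x → l = Coord.mkMod h hP y (ω.map p).hom := by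
  obtain ⟨P, hP, p, y, rfl⟩ := h.exists_lift x
  exact ⟨_, fun Q hQ q z hz => mkMod_eq_of_map_eq h hP hQ p q y z hz.symm⟩

variable [ω.Additive] [ω.Linear R] (h : IsTannakian R ω)

/-- The coaction of the coordinate ring on `ω(X)`. -/
def coaction (X : T) : ω.obj X →ₗ[R] Coord h ⊗[R] ω.obj X where
  toFun x := (exists_coaction h x).choose
  map_add' x y := by
    obtain ⟨P, hP, p, x, rfl⟩ := h.exists_lift x
    obtain ⟨Q, hQ, q, y, rfl⟩ := h.exists_lift y
    -- With both vectors coming from one `z`, their sum is the image of `z` under the sum of the two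
    -- morphisms, and additivity of `ω` finishes.
    obtain ⟨S, hS, a, b, z, rfl, rfl⟩ := h.exists_pair x y
    rw [(exists_coaction h _).choose_spec S hS (a ≫ p) z (map_comp_apply ..),
      (exists_coaction h _).choose_spec S hS (b ≫ q) z (map_comp_apply ..),
      (exists_coaction h _).choose_spec S hS (a ≫ p + b ≫ q) z
        (by rw [ω.map_add, ModuleCat.hom_add, LinearMap.add_apply, map_comp_apply, map_comp_apply]),
      ω.map_add, ModuleCat.hom_add, map_add]
  map_smul' r x := by
    obtain ⟨P, hP, p, x, rfl⟩ := h.exists_lift x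
    rw [(exists_coaction h _).choose_spec P hP p x rfl,
      (exists_coaction h _).choose_spec P hP (r • p) x
        (by rw [ω.map_smul, ModuleCat.hom_smul, LinearMap.smul_apply]),
      ω.map_smul, ModuleCat.hom_smul, map_smul, RingHom.id_apply]

theorem coaction_map {X P : T} (hP : rigid T P) (p : P ⟶ X) (x : ω.obj P) :
    coaction h X ((ω.map p).hom x) = Coord.mkMod h hP x (ω.map p).hom :=
  (exists_coaction h _).choose_spec P hP p x rfl

theorem coaction_of_rigid {P : T} (hP : rigid T P) (x : ω.obj P) :
    coaction h P x = Coord.mkMod h hP x LinearMap.id := by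
  have := coaction_map h hP (𝟙 P) x
  rwa [map_id_apply, ω.map_id] at this

theorem lTensor_coaction {X Y : T} (f : X ⟶ Y) (x : ω.obj X) :
    (ω.map f).hom.lTensor (Coord h) (coaction h X x) = coaction h Y ((ω.map f).hom x) := by
  obtain ⟨P, hP, p, x, rfl⟩ := h.exists_lift x
  rw [coaction_map h hP, Coord.lTensor_mkMod, ← map_comp_apply, coaction_map h hP, ω.map_comp,
    ModuleCat.hom_comp]

end Coaction

section CoactionRing

variable {R : Type u} [CommRing R] {T : Type w} [Category.{v} T] [EssentiallySmall.{u} T]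
  [Abelian T] [Linear R T] [MonoidalCategory T] [BraidedCategory T] {ω : T ⥤ ModuleCat.{u} R}
  [ω.Braided]

/-- Both sides are bilinear in `k` and `l`, and for maps of rank one the claim is the product
formula `Coord.mk_mul_mk`. -/
theorem pair_mkMod {h : IsTannakian R ω} {P Q : T} (hP : rigid T P) (hQ : rigid T Q) (x : ω.obj P)
    (y : ω.obj Q) {M N : Type u} [AddCommGroup M] [Module R M] [AddCommGroup N] [Module R N]
    (k : ω.obj P →ₗ[R] M) (l : ω.obj Q →ₗ[R] N) :
    pair (Coord.mkMod h hP x k) (Coord.mkMod h hQ y l) =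
      Coord.mkMod h (rigid_tensor hP hQ) ((Functor.LaxMonoidal.μ ω P Q).hom (x ⊗ₜ[R] y))
        (TensorProduct.map k l ∘ₗ (Functor.OplaxMonoidal.δ ω P Q).hom) := by
  refine rigid_hom_induction hP (p := fun k => pair (Coord.mkMod h hP x k) (Coord.mkMod h hQ y l) =
      Coord.mkMod h (rigid_tensor hP hQ) ((Functor.LaxMonoidal.μ ω P Q).hom (x ⊗ₜ[R] y))
        (TensorProduct.map k l ∘ₗ (Functor.OplaxMonoidal.δ ω P Q).hom)) (by simp)
    (fun φ m => ?_) (fun k k' hk hk' => ?_) k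
  · refine rigid_hom_induction hQ (p := fun l => pair (Coord.mkMod h hP x
      (dualTensorHom R (ω.obj P) M (φ ⊗ₜ m))) (Coord.mkMod h hQ y l) =
      Coord.mkMod h (rigid_tensor hP hQ) ((Functor.LaxMonoidal.μ ω P Q).hom (x ⊗ₜ[R] y))
        (TensorProduct.map (dualTensorHom R (ω.obj P) M (φ ⊗ₜ m)) l ∘ₗ
          (Functor.OplaxMonoidal.δ ω P Q).hom)) (by simp) (fun ψ n => ?_) (fun l l' hl hl' => ?_) l
    · have e : TensorProduct.map (dualTensorHom R (ω.obj P) M (φ ⊗ₜ m))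
          (dualTensorHom R (ω.obj Q) N (ψ ⊗ₜ n)) ∘ₗ (Functor.OplaxMonoidal.δ ω P Q).hom =
          dualTensorHom R (ω.obj (P ⊗ Q)) (M ⊗[R] N) (dualProd P Q φ ψ ⊗ₜ (m ⊗ₜ n)) := by
        refine ext_μ fun x y => ?_
        rw [LinearMap.comp_apply, δ_μ, dualTensorHom_apply, dualProd_μ, TensorProduct.map_tmul,
          dualTensorHom_apply, dualTensorHom_apply, TensorProduct.smul_tmul_smul]
      rw [e, Coord.mkMod_tmul, Coord.mkMod_tmul, Coord.mkMod_tmul, pair_tmul, Coord.mk_mul_mk]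
    · rw [map_add, pair_add_right, hl, hl', TensorProduct.map_add_right, LinearMap.add_comp, map_add]
  · rw [map_add, pair_add_left, hk, hk', TensorProduct.map_add_left, LinearMap.add_comp, map_add]

variable [ω.Additive] [ω.Linear R] (h : IsTannakian R ω)

theorem baseChange_coaction {X Y : T} (f : X ⟶ Y) (x : ω.obj X) :
    (ω.map f).hom.baseChange (Coord h) (coaction h X x) = coaction h Y ((ω.map f).hom x) :=
  lTensor_coaction h f x

theorem coaction_μ {X Y : T} (x : ω.obj X) (y : ω.obj Y) :
    (Functor.LaxMonoidal.μ ω X Y).hom.baseChange (Coord h)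
        (pair (coaction h X x) (coaction h Y y)) =
      coaction h (X ⊗ Y) ((Functor.LaxMonoidal.μ ω X Y).hom (x ⊗ₜ[R] y)) := by
  obtain ⟨P, hP, p, x, rfl⟩ := h.exists_lift x
  obtain ⟨Q, hQ, q, y, rfl⟩ := h.exists_lift y
  have e := map_μ (ω := ω) p q (x ⊗ₜ[R] y)
  rw [TensorProduct.map_tmul] at e
  rw [coaction_map h hP, coaction_map h hQ, pair_mkMod, ← e, coaction_map h (rigid_tensor hP hQ)]
  refine (Coord.lTensor_mkMod _ _ _ _).trans (congrArg _ (ext_μ fun x y => ?_))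
  rw [map_μ, LinearMap.comp_apply, LinearMap.comp_apply, δ_μ]

theorem coaction_ε (r : R) :
    coaction h (𝟙_ T) ((Functor.LaxMonoidal.ε ω).hom r) = 1 ⊗ₜ (Functor.LaxMonoidal.ε ω).hom r := by
  -- The module `ω(1)` is free on `ε(1)` with coordinate `η`, so the identity is a map of rank one,
  -- and its coefficient at `ε(1)` is the unit of `Coord h`.
  have e : (LinearMap.id : ω.obj (𝟙_ T) →ₗ[R] _) = dualTensorHom R (ω.obj (𝟙_ T)) _
      ((Functor.OplaxMonoidal.η ω).hom ⊗ₜ (Functor.LaxMonoidal.ε ω).hom (1 : R)) := by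
    ext x
    obtain ⟨r, rfl⟩ : ∃ r, (Functor.LaxMonoidal.ε ω).hom r = x := ⟨_, ε_η x⟩
    rw [dualTensorHom_apply, η_ε, ← map_smul]
    simp
  have h1 : coaction h (𝟙_ T) ((Functor.LaxMonoidal.ε ω).hom (1 : R)) =
      1 ⊗ₜ (Functor.LaxMonoidal.ε ω).hom (1 : R) := by
    rw [coaction_of_rigid h rigid_unit, e, Coord.mkMod_tmul, Coord.one_def]
  have hr : (Functor.LaxMonoidal.ε ω).hom r = r • (Functor.LaxMonoidal.ε ω).hom (1 : R) := by
    rw [← map_smul]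
    simp
  rw [hr, map_smul, h1, TensorProduct.tmul_smul]

variable {A : Type u} [CommRing A] [Algebra R A]

/-- The coevaluation is a morphism out of the unit object, on which the action is trivial; hence its
element is fixed, and `surjective_of_coevaluation` applies. -/
theorem act_coaction_surjective_of_rigid (f : Coord h →ₐ[R] A) {P : T} (hP : rigid T P) :
    Function.Surjective (act (coaction h P) f) := by
  obtain ⟨D, c, e, hc⟩ := exists_coevaluation (ω := ω) hP
  refine surjective_of_coevaluation e _ hc _ (act (coaction h D) f) ?_
  have inj : Function.Injective ((Functor.LaxMonoidal.μ ω P D).hom.baseChange A) := by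
    apply Function.LeftInverse.injective (g := (Functor.OplaxMonoidal.δ ω P D).hom.baseChange A)
    intro z
    rw [← LinearMap.comp_apply, ← LinearMap.baseChange_comp, ← ModuleCat.hom_comp,
      Functor.Monoidal.μ_δ]
    exact LinearMap.congr_fun LinearMap.baseChange_id z
  apply inj
  rw [baseChange_pair_act (coaction_μ h), LinearMap.baseChange_tmul, μ_δ,
    ← LinearMap.baseChange_tmul, ← baseChange_act (baseChange_coaction h c), act_one_tmul,
    coaction_ε]
  simp

/-- Surjectivity descends from a rigid cover to `X`, and a surjective endomorphism of a finitely
generated module is injective. No antipode is needed. -/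
theorem act_coaction_bijective (f : Coord h →ₐ[R] A) (X : T) :
    Function.Bijective (act (coaction h X) f) := by
  have hs : Function.Surjective (act (coaction h X) f) := by
    obtain ⟨P, p, hP, _⟩ := h.dominated X
    have hp : Function.Surjective ((ω.map p).hom.baseChange A) :=
      LinearMap.lTensor_surjective A (h.map_surjective p)
    refine Function.Surjective.of_comp (g := (ω.map p).hom.baseChange A) fun x => ?_
    obtain ⟨y, rfl⟩ := hp x
    obtain ⟨z, rfl⟩ := act_coaction_surjective_of_rigid h f hP y
    exact ⟨z, (baseChange_act (baseChange_coaction h p) f z).symm⟩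
  have := h.finite X
  exact ⟨OrzechProperty.injective_of_surjective_endomorphism _ hs, hs⟩

end CoactionRing

/-! ### Representability: homomorphisms `Coord h → A` are the tensor automorphisms of `A ⊗ ω`. -/

section EvalDual

variable {R : Type u} [CommRing R] {A : Type u} [CommRing A] [Algebra R A]
  {M N : Type u} [AddCommGroup M] [Module R M] [AddCommGroup N] [Module R N]

/-- The `A`-valued form `φ ↦ (A ⊗ φ)(y)` for `y ∈ A ⊗ M`. -/
def evalDual (y : A ⊗[R] M) : Module.Dual R M →ₗ[R] A where
  toFun φ := AlgebraTensorModule.rid R A A (LinearMap.baseChange A φ y)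
  map_add' φ ψ := by rw [LinearMap.baseChange_add, LinearMap.add_apply, map_add]
  map_smul' r φ := by
    rw [LinearMap.baseChange_smul, LinearMap.smul_apply, ← algebraMap_smul A r, map_smul,
      algebraMap_smul, RingHom.id_apply]

theorem evalDual_apply (y : A ⊗[R] M) (φ : Module.Dual R M) :
    evalDual y φ = AlgebraTensorModule.rid R A A (LinearMap.baseChange A φ y) := rfl

theorem evalDual_tmul (a : A) (m : M) (φ : Module.Dual R M) :
    evalDual (a ⊗ₜ[R] m) φ = φ m • a := by
  simp [evalDual_apply]

theorem evalDual_add (y y' : A ⊗[R] M) (φ : Module.Dual R M) :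
    evalDual (y + y') φ = evalDual y φ + evalDual y' φ := by
  simp [evalDual_apply]

theorem evalDual_zero (φ : Module.Dual R M) : evalDual (0 : A ⊗[R] M) φ = 0 := by
  simp [evalDual_apply]

theorem evalDual_comp (f : M →ₗ[R] N) (y : A ⊗[R] M) (φ : Module.Dual R N) :
    evalDual y (φ ∘ₗ f) = evalDual (f.baseChange A y) φ := by
  rw [evalDual_apply, evalDual_apply, LinearMap.baseChange_comp, LinearMap.comp_apply]

theorem evalDual_pair (x : A ⊗[R] M) (y : A ⊗[R] N) (φ : Module.Dual R M) (ψ : Module.Dual R N) :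
    evalDual (pair x y) (TensorProduct.dualDistrib R M N (φ ⊗ₜ ψ)) =
      evalDual x φ * evalDual y ψ := by
  induction x with
  | zero => simp [evalDual_zero]
  | add x x' hx hx' => simp only [pair_add_left, evalDual_add, add_mul, hx, hx']
  | tmul a m =>
    induction y with
    | zero => simp [evalDual_zero]
    | add x x' hx hx' => simp only [pair_add_right, evalDual_add, mul_add, hx, hx']
    | tmul b n => simp [evalDual_tmul, mul_smul, smul_comm (φ m)]

end EvalDual

section Points

variable {R : Type u} [CommRing R] {T : Type w} [Category.{v} T] [EssentiallySmall.{u} T]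
  [Abelian T] [Linear R T] [MonoidalCategory T] [BraidedCategory T] {ω : T ⥤ ModuleCat.{u} R}
  [ω.Braided] (h : IsTannakian R ω) {A : Type u} [CommRing A] [Algebra R A]

/-- The homomorphism `Coord h → A` that is given by a tensor automorphism of `ω` on rigid
objects: it maps the matrix coefficient of `x` and `φ` to `(A ⊗ φ) (g (1 ⊗ x))`. -/
def autPoint (g : tensorAut ((rigid T).ι ⋙ ω) A) : Coord h →ₐ[R] A :=
  AlgHom.ofLinearMap
    (Coord.desc (h := h) (fun P hP x => evalDual ((g.1 ⟨P, hP⟩).1 (1 ⊗ₜ[R] (x : ω.obj P))))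
      (fun P Q hP hQ a x φ => by
        rw [evalDual_comp]
        refine congrArg (fun y => evalDual y φ) ?_
        have := g.2.1 (X := ⟨P, hP⟩) (Y := ⟨Q, hQ⟩) (ObjectProperty.homMk a) (1 ⊗ₜ[R] (x : ω.obj P))
        rw [LinearMap.baseChange_tmul] at this
        exact this.symm))
    (by
      rw [Coord.one_def, Coord.desc_mk]
      have := g.2.2.2 (1 ⊗ₜ 1)
      rw [LinearMap.baseChange_tmul] at this
      -- The inclusion of rigid objects has identities as tensor constraints, so the constraints of
      -- the composite differ from those of `ω` only by `ω(𝟙)`. The same holds for `μ` below.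
      have hε : Functor.LaxMonoidal.ε ((rigid T).ι ⋙ ω) = Functor.LaxMonoidal.ε ω := by
        rw [Functor.LaxMonoidal.comp_ε]
        exact (congrArg (_ ≫ ·) (ω.map_id _)).trans (Category.comp_id _)
      rw [hε] at this
      refine (congrArg (fun y => evalDual y _) this.symm).trans ?_
      refine (evalDual_tmul _ _ _).trans ?_
      refine (congrArg (· • (1 : A)) (η_ε (ω := ω) 1)).trans (one_smul _ _))
    (fun a b => by
      obtain ⟨P, hP, x, φ, rfl⟩ := Coord.exists_mk a
      obtain ⟨Q, hQ, y, ψ, rfl⟩ := Coord.exists_mk b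
      rw [Coord.mk_mul_mk, Coord.desc_mk, Coord.desc_mk, Coord.desc_mk]
      have := g.2.2.1 ⟨P, hP⟩ ⟨Q, hQ⟩ (pair (1 ⊗ₜ[R] (x : ω.obj P)) (1 ⊗ₜ[R] (y : ω.obj Q)))
      rw [glTensor_pair, pair_tmul, LinearMap.baseChange_tmul, mul_one] at this
      have hμ : (Functor.LaxMonoidal.μ ((rigid T).ι ⋙ ω) ⟨P, hP⟩ ⟨Q, hQ⟩) =
          Functor.LaxMonoidal.μ ω P Q := by
        rw [Functor.LaxMonoidal.comp_μ]
        exact (congrArg (_ ≫ ·) (ω.map_id _)).trans (Category.comp_id _)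
      rw [hμ] at this
      refine (congrArg (fun y => evalDual y _) this.symm).trans ?_
      refine (evalDual_comp _ _ _).symm.trans ?_
      rw [← evalDual_pair]
      refine congrArg _ (LinearMap.ext fun z => ?_)
      rw [LinearMap.comp_apply, dualProd_apply, δ_μ])

theorem autPoint_mk (g : tensorAut ((rigid T).ι ⋙ ω) A) {P : T} (hP : rigid T P) (x : ω.obj P)
    (φ : Module.Dual R (ω.obj P)) :
    autPoint h g (Coord.mk h hP x φ) = evalDual ((g.1 ⟨P, hP⟩).1 (1 ⊗ₜ[R] (x : ω.obj P))) φ :=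
  Coord.desc_mk _ _ hP x φ

/-- For `k` the identity this recovers `g (1 ⊗ x)` from the homomorphism `autPoint h g`. -/
theorem scalarMap_autPoint_mkMod (g : tensorAut ((rigid T).ι ⋙ ω) A) {P : T} (hP : rigid T P)
    (x : ω.obj P) {N : Type u} [AddCommGroup N] [Module R N] (k : ω.obj P →ₗ[R] N) :
    scalarMap (autPoint h g) N (Coord.mkMod h hP x k) =
      k.baseChange A ((g.1 ⟨P, hP⟩).1 (1 ⊗ₜ[R] (x : ω.obj P))) := by
  refine rigid_hom_induction hP (p := fun k => scalarMap (autPoint h g) N (Coord.mkMod h hP x k) =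
    k.baseChange A ((g.1 ⟨P, hP⟩).1 (1 ⊗ₜ[R] (x : ω.obj P)))) (by simp) (fun φ n => ?_)
    (fun k k' hk hk' => ?_) k
  · rw [Coord.mkMod_tmul, LinearMap.rTensor_tmul, AlgHom.toLinearMap_apply, autPoint_mk]
    have : ∀ y : A ⊗[R] ω.obj P, evalDual y φ ⊗ₜ[R] n =
        (dualTensorHom R (ω.obj P) N (φ ⊗ₜ n)).baseChange A y := by
      intro y
      induction y with
      | zero => simp [evalDual_zero]
      | add y y' hy hy' => rw [evalDual_add, map_add, TensorProduct.add_tmul, hy, hy']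
      | tmul a m => rw [evalDual_tmul, LinearMap.baseChange_tmul, dualTensorHom_apply,
          TensorProduct.smul_tmul]
    exact this _
  · simp only [map_add, hk, hk', LinearMap.baseChange_add, LinearMap.add_apply]

/-- For `k` the identity this recovers the values of `f` on coefficients from the action that `f`
induces. -/
theorem evalDual_scalarMap_mkMod (f : Coord h →ₐ[R] A) {P : T} (hP : rigid T P)
    (x : ω.obj P) {N : Type u} [AddCommGroup N] [Module R N] (k : ω.obj P →ₗ[R] N)
    (φ : Module.Dual R N) :
    evalDual (scalarMap f N (Coord.mkMod h hP x k)) φ = f (Coord.mk h hP x (φ ∘ₗ k)) := by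
  refine rigid_hom_induction hP (p := fun k => evalDual (scalarMap f N (Coord.mkMod h hP x k)) φ =
    f (Coord.mk h hP x (φ ∘ₗ k))) (by simp [evalDual_zero]) (fun ψ n => ?_)
    (fun k k' hk hk' => ?_) k
  · have : φ ∘ₗ dualTensorHom R (ω.obj P) N (ψ ⊗ₜ n) = φ n • ψ := by
      ext; simp [mul_comm]
    rw [Coord.mkMod_tmul, LinearMap.rTensor_tmul, evalDual_tmul, this, map_smul, map_smul]
    rfl
  · simp only [map_add, evalDual_add, hk, hk', LinearMap.comp_add]

variable (A) in
-- `A ⊗ ω(X)` is a quotient of `A ⊗ ω(P)` with `P` rigid, and the automorphisms are natural.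
theorem tensorAutRestrict_injective (h : IsTannakian R ω) :
    Function.Injective (tensorAutRestrict (rigid T).ι ω A) := by
  intro g g' hg
  refine Subtype.ext (funext fun X => Units.ext ?_)
  obtain ⟨P, p, hP, _⟩ := h.dominated X
  have hp : Function.Surjective ((ω.map p).hom.baseChange A) :=
    LinearMap.lTensor_surjective A (h.map_surjective p)
  refine LinearMap.ext fun x => ?_
  obtain ⟨y, rfl⟩ := hp x
  rw [← g.2.1, ← g'.2.1]
  have := congrFun (congrArg Subtype.val hg) ⟨P, hP⟩
  exact congrArg (fun k => (ω.map p).hom.baseChange A (k.1 y)) this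

variable [ω.Additive] [ω.Linear R]

/-- The tensor automorphism of `A ⊗ ω` that is given by a homomorphism `Coord h → A`. -/
def pointAut (f : Coord h →ₐ[R] A) : tensorAut ω A :=
  ⟨fun X => LinearMap.GeneralLinearGroup.ofLinearEquiv
      (LinearEquiv.ofBijective (act (coaction h X) f) (act_coaction_bijective h f X)),
    fun a x => baseChange_act (baseChange_coaction h a) f x,
    fun _ _ x => baseChange_pair_act (coaction_μ h) f x,
    fun x => LinearMap.congr_fun (g := act (coaction h (𝟙_ T)) f ∘ₗ
      (Functor.LaxMonoidal.ε ω).hom.baseChange A) (ext_one_tmul fun r => by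
        rw [LinearMap.comp_apply, LinearMap.baseChange_tmul, act_one_tmul, coaction_ε]
        simp) x⟩

theorem pointAut_val (f : Coord h →ₐ[R] A) (X : T) :
    ((pointAut h f).1 X).1 = act (coaction h X) f := rfl

theorem autPoint_pointAut (f : Coord h →ₐ[R] A) :
    autPoint h (tensorAutRestrict (rigid T).ι ω A (pointAut h f)) = f := by
  refine AlgHom.ext fun l => ?_
  obtain ⟨P, hP, x, φ, rfl⟩ := Coord.exists_mk l
  rw [autPoint_mk]
  change evalDual (act (coaction h P) f (1 ⊗ₜ x)) φ = _
  rw [act_one_tmul, coaction_of_rigid h hP, evalDual_scalarMap_mkMod]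
  rfl

theorem pointAut_autPoint (g : tensorAut ((rigid T).ι ⋙ ω) A) :
    tensorAutRestrict (rigid T).ι ω A (pointAut h (autPoint h g)) = g := by
  refine Subtype.ext (funext fun P => Units.ext ?_)
  refine ext_one_tmul (V := ω.obj P.obj) fun x => ?_
  change act (coaction h P.obj) (autPoint h g) (1 ⊗ₜ x) = _
  rw [act_one_tmul, coaction_of_rigid h P.property, scalarMap_autPoint_mkMod,
    LinearMap.baseChange_id]
  rfl

variable (A) in
-- An automorphism on rigid objects is a point of `Coord h`, and this point acts on every `ω(X)`
-- through the coaction; this is the extension to `T`.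
theorem tensorAutRestrict_bijective (h : IsTannakian R ω) :
    Function.Bijective (tensorAutRestrict (rigid T).ι ω A) :=
  ⟨tensorAutRestrict_injective A h, fun g => ⟨_, pointAut_autPoint h g⟩⟩

variable (A) in
/-- The coordinate ring represents the functor of tensor automorphisms. -/
def pointEquiv (h : IsTannakian R ω) : (Coord h →ₐ[R] A) ≃ tensorAut ω A where
  toFun := pointAut h
  invFun g := autPoint h (tensorAutRestrict (rigid T).ι ω A g)
  left_inv := autPoint_pointAut h
  right_inv _ := tensorAutRestrict_injective A h (pointAut_autPoint h _)

theorem map_pointAut {A B : CommAlgCat.{u} R} (φ : A ⟶ B) (f : Coord h →ₐ[R] A) :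
    (tensorAutFunctor ω).map φ (pointAut h f) = pointAut h (φ.hom.comp f) :=
  Subtype.ext (funext fun X => Units.ext (endMapFun_act (coaction h X) f φ.hom))

end Points

/-! ### The Hopf structure on a representing algebra, by Yoneda. -/

section Represented

variable {R : Type u} [CommRing R] {G : GroupFunctor.{w} R} {L : Type u} [CommRing L] [Algebra R L]
  (e : ∀ A : CommAlgCat.{u} R, (L →ₐ[R] A) ≃ G.obj A)

/-- The bijections `Hom(L, A) ≃ G(A)` are natural in `A`. -/
def IsNaturalRepr : Prop :=
  ∀ (A B : CommAlgCat.{u} R) (φ : A ⟶ B) (f : L →ₐ[R] A), e B (φ.hom.comp f) = G.map φ (e A f)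

/-- The comultiplication on an algebra that represents a group functor. -/
def reprComul : L →ₐ[R] L ⊗[R] L :=
  (e (CommAlgCat.of R (L ⊗[R] L))).symm
    (e (CommAlgCat.of R (L ⊗[R] L)) Algebra.TensorProduct.includeLeft *
      e (CommAlgCat.of R (L ⊗[R] L)) Algebra.TensorProduct.includeRight)

/-- The counit on an algebra that represents a group functor. -/
def reprCounit : L →ₐ[R] R := (e (CommAlgCat.of R R)).symm 1

/-- The antipode on an algebra that represents a group functor. -/
def reprAntipode : L →ₐ[R] L :=
  (e (CommAlgCat.of R L)).symm (e (CommAlgCat.of R L) (AlgHom.id R L))⁻¹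

/-- Naturality along `f` moves the defining product from `L ⊗ L` to `A`. With the analogues for
counit and antipode, the Hopf axioms become group axioms after applying the injective maps `e`. -/
theorem repr_comp_comul (he : IsNaturalRepr e) {A : CommAlgCat.{u} R} (f : L ⊗[R] L →ₐ[R] A) :
    e A (f.comp (reprComul e)) = e A (f.comp Algebra.TensorProduct.includeLeft) *
      e A (f.comp Algebra.TensorProduct.includeRight) := by
  let φ : CommAlgCat.of R (L ⊗[R] L) ⟶ A := CommAlgCat.ofHom f
  have h := he _ _ φ
  refine (h (reprComul e)).trans ?_
  rw [reprComul, Equiv.apply_symm_apply, map_mul, ← h, ← h]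
  rfl

theorem repr_comp_counit (he : IsNaturalRepr e) {A : CommAlgCat.{u} R} (f : R →ₐ[R] A) :
    e A (f.comp (reprCounit e)) = 1 := by
  let φ : CommAlgCat.of R R ⟶ A := CommAlgCat.ofHom f
  refine (he _ _ φ (reprCounit e)).trans ?_
  rw [reprCounit, Equiv.apply_symm_apply, map_one]

theorem repr_comp_antipode (he : IsNaturalRepr e) {A : CommAlgCat.{u} R} (f : L →ₐ[R] A) :
    e A (f.comp (reprAntipode e)) = (e A f)⁻¹ := by
  let φ : CommAlgCat.of R L ⟶ A := CommAlgCat.ofHom f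
  have h := he _ _ φ
  refine (h (reprAntipode e)).trans ?_
  rw [reprAntipode, Equiv.apply_symm_apply, map_inv, ← h]
  rfl

/-- The bialgebra structure on an algebra that represents a group functor. -/
abbrev reprBialgebra (he : IsNaturalRepr e) : Bialgebra R L :=
  Bialgebra.ofAlgHom (reprComul e) (reprCounit e)
    ((e (CommAlgCat.of R (L ⊗[R] (L ⊗[R] L)))).injective (by
      have h := fun f => repr_comp_comul e he (A := CommAlgCat.of R (L ⊗[R] (L ⊗[R] L))) f
      rw [← AlgHom.comp_assoc, h, h]
      have e₁ : ((Algebra.TensorProduct.assoc R R R L L L).toAlgHom.comp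
          (Algebra.TensorProduct.map (reprComul e) (.id R L))).comp
            Algebra.TensorProduct.includeLeft =
          ((Algebra.TensorProduct.assoc R R R L L L).toAlgHom.comp
            Algebra.TensorProduct.includeLeft).comp (reprComul e) := by
        ext x; simp
      have e₂ : (Algebra.TensorProduct.map (.id R L) (reprComul e)).comp
            Algebra.TensorProduct.includeRight =
          (Algebra.TensorProduct.includeRight (R := R) (A := L) (B := L ⊗[R] L)).comp
            (reprComul e) := by
        ext x; simp
      -- Both sides are now the product of the points given by the three coordinate inclusions of
      -- `L` in `L ⊗ L ⊗ L`.
      rw [e₁, e₂, h, h, mul_assoc]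
      refine congrArg₂ (· * ·) (congrArg _ (AlgHom.ext fun x => ?_)) (congrArg₂ (· * ·)
        (congrArg _ (AlgHom.ext fun x => ?_)) (congrArg _ (AlgHom.ext fun x => ?_)))
      · simp [Algebra.TensorProduct.one_def]
      · simp [AlgHom.comp_apply]
      · simp [AlgHom.comp_apply, Algebra.TensorProduct.one_def]))
    ((e (CommAlgCat.of R (R ⊗[R] L))).injective (by
      have h := fun f => repr_comp_comul e he (A := CommAlgCat.of R (R ⊗[R] L)) f
      have h' := fun f => repr_comp_counit e he (A := CommAlgCat.of R (R ⊗[R] L)) f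
      rw [h]
      have e₁ : (Algebra.TensorProduct.map (reprCounit e) (.id R L)).comp
            Algebra.TensorProduct.includeLeft =
          (Algebra.TensorProduct.includeLeft (R := R) (S := R) (A := R) (B := L)).comp
            (reprCounit e) := by
        ext x; simp
      rw [e₁, h', one_mul]
      congr 1
      ext x; simp))
    ((e (CommAlgCat.of R (L ⊗[R] R))).injective (by
      have h := fun f => repr_comp_comul e he (A := CommAlgCat.of R (L ⊗[R] R)) f
      have h' := fun f => repr_comp_counit e he (A := CommAlgCat.of R (L ⊗[R] R)) f
      rw [h]
      have e₁ : (Algebra.TensorProduct.map (.id R L) (reprCounit e)).comp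
            Algebra.TensorProduct.includeRight =
          (Algebra.TensorProduct.includeRight (R := R) (A := L) (B := R)).comp
            (reprCounit e) := by
        ext x; simp
      rw [e₁, h', mul_one]
      congr 1
      ext x; simp))

/-- The Hopf algebra structure on an algebra that represents a group functor. -/
abbrev reprHopfAlgebra (he : IsNaturalRepr e) : HopfAlgebra R L :=
  letI := reprBialgebra e he
  HopfAlgebra.ofAlgHom (reprAntipode e)
    ((e (CommAlgCat.of R L)).injective (by
      have h := repr_comp_comul e he (A := CommAlgCat.of R L)
        (Algebra.TensorProduct.lift (reprAntipode e) (.id R L) fun _ ↦ Commute.all _)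
      have h' := repr_comp_counit e he (A := CommAlgCat.of R L) (Algebra.ofId R L)
      have h'' := repr_comp_antipode e he (A := CommAlgCat.of R L) (.id R L)
      refine h.trans (Eq.trans (congrArg₂ (· * ·) ((congrArg _ ?_).trans h'') (congrArg _ ?_))
        ((inv_mul_cancel (e (CommAlgCat.of R L) (.id R L))).trans h'.symm))
      · exact AlgHom.ext fun x => (Algebra.TensorProduct.lift_tmul _ _ (fun _ _ => Commute.all _ _) _ _).trans
          ((congrArg (_ * ·) (map_one _)).trans (mul_one _))
      · exact AlgHom.ext fun x => (Algebra.TensorProduct.lift_tmul _ _ (fun _ _ => Commute.all _ _) _ _).trans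
          ((congrArg (· * _) (map_one _)).trans (one_mul _))))
    ((e (CommAlgCat.of R L)).injective (by
      have h := repr_comp_comul e he (A := CommAlgCat.of R L)
        (Algebra.TensorProduct.lift (.id R L) (reprAntipode e) fun _ _ ↦ Commute.all _ _)
      have h' := repr_comp_counit e he (A := CommAlgCat.of R L) (Algebra.ofId R L)
      have h'' := repr_comp_antipode e he (A := CommAlgCat.of R L) (.id R L)
      refine h.trans (Eq.trans (congrArg₂ (· * ·) (congrArg _ ?_) ((congrArg _ ?_).trans h''))
        ((mul_inv_cancel (e (CommAlgCat.of R L) (.id R L))).trans h'.symm))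
      · exact AlgHom.ext fun x => by simp
      · exact AlgHom.ext fun x => by simp))

theorem isFlatAffineGroupScheme_of_repr (he : IsNaturalRepr e) [Module.Flat R L] : IsFlatAffineGroupScheme G := by
  let := reprHopfAlgebra e he
  refine ⟨CommHopfAlgCat.of R L, ‹_›, fun A =>
    { toFun := fun f => e A f.ofConv
      invFun := fun g => WithConv.toConv ((e A).symm g)
      left_inv := fun f => by simp
      right_inv := fun g => by simp
      map_mul' := fun f g => ?_ }, fun A B φ f => he A B φ f⟩
  -- The convolution product of `f` and `g` is the composite of the comultiplication with `f ⊗ g`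
  -- followed by multiplication.
  refine (repr_comp_comul e he ((Algebra.TensorProduct.lmul' R).comp
    (Algebra.TensorProduct.map f.ofConv g.ofConv))).trans ?_
  congr 2
  · ext x; simp
  · ext x; simp

end Represented

section TensorAut

variable {R : Type u} [CommRing R] {T : Type w} [Category.{v} T] [EssentiallySmall.{u} T]
  [Abelian T] [Linear R T] [MonoidalCategory T] [BraidedCategory T] {ω : T ⥤ ModuleCat.{u} R}
  [ω.Braided] [ω.Additive] [ω.Linear R]

theorem isFlatAffineGroupScheme_tensorAut (h : IsTannakian R ω) :
    IsFlatAffineGroupScheme (tensorAutFunctor ω) :=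
  isFlatAffineGroupScheme_of_repr (G := tensorAutFunctor ω) (L := Coord h)
    (fun A => pointEquiv A h) (fun _ _ φ f => (map_pointAut h φ f).symm)

end TensorAut

/-! ### From local statements on covers to global ones. -/

section Exhaust

variable {R : Type u} [CommRing R] {T : Type w} [Category.{v} T] [Abelian T]
  {ω : T ⥤ ModuleCat.{u} R} {V : Type u} [AddCommGroup V] [Module R V]

/-- If a class of maps `ω(Z) → V` is closed under sums, and their images cover a finitely generated
submodule, then a single image contains this submodule. -/
theorem exists_le_range {S : ∀ Z : T, (ω.obj Z →ₗ[R] V) → Prop}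
    (hS : ∀ {Z Z' : T} {m : ω.obj Z →ₗ[R] V} {m' : ω.obj Z' →ₗ[R] V}, S Z m → S Z' m' →
      S (Z ⊞ Z') (m ∘ₗ (ω.map Limits.biprod.fst).hom + m' ∘ₗ (ω.map Limits.biprod.snd).hom))
    [ω.Additive] {N : Submodule R V} (hN : N.FG)
    (hx : ∀ x ∈ N, ∃ (Z : T) (m : ω.obj Z →ₗ[R] V), S Z m ∧ x ∈ m.range) :
    ∃ (Z : T) (m : ω.obj Z →ₗ[R] V), S Z m ∧ N ≤ m.range := by
  -- Only elements of `N` are known to be covered, so the induction over finitely generated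
  -- submodules carries the condition to be contained in `N`.
  have key : N ≤ N → ∃ (Z : T) (m : ω.obj Z →ₗ[R] V), S Z m ∧ N ≤ m.range := by
    refine Submodule.fg_induction (motive := fun M _ => M ≤ N → ∃ (Z : T) (m : ω.obj Z →ₗ[R] V),
      S Z m ∧ M ≤ m.range) (fun x hxN => ?_) (fun M M' _ _ hM hM' hMN => ?_) N hN
    · obtain ⟨Z, m, hm, hxm⟩ := hx x (hxN (Submodule.mem_span_singleton_self x))
      exact ⟨Z, m, hm, (Submodule.span_singleton_le_iff_mem _ _).mpr hxm⟩
    · obtain ⟨Z, m, hm, hZ⟩ := hM (le_sup_left.trans hMN)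
      obtain ⟨Z', m', hm', hZ'⟩ := hM' (le_sup_right.trans hMN)
      refine ⟨_, _, hS hm hm', sup_le (hZ.trans ?_) (hZ'.trans ?_)⟩
      · rintro _ ⟨z, rfl⟩
        refine ⟨(ω.map Limits.biprod.inl).hom z, ?_⟩
        rw [LinearMap.add_apply, LinearMap.comp_apply, LinearMap.comp_apply, ← map_comp_apply,
          ← map_comp_apply]
        simp
      · rintro _ ⟨z, rfl⟩
        refine ⟨(ω.map Limits.biprod.inr).hom z, ?_⟩
        rw [LinearMap.add_apply, LinearMap.comp_apply, LinearMap.comp_apply, ← map_comp_apply,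
          ← map_comp_apply]
        simp
  exact key le_rfl

theorem exists_comp_eq_of_ker_le {M N P : Type*} [AddCommGroup M] [Module R M] [AddCommGroup N]
    [Module R N] [AddCommGroup P] [Module R P] {f : M →ₗ[R] N} (hf : Function.Surjective f)
    {g : M →ₗ[R] P} (hfg : f.ker ≤ g.ker) : ∃ i : N →ₗ[R] P, i ∘ₗ f = g := by
  refine ⟨f.ker.liftQ g hfg ∘ₗ (f.quotKerEquivOfSurjective hf).symm.toLinearMap, ?_⟩
  ext x
  have : (f.quotKerEquivOfSurjective hf).symm (f x) = f.ker.mkQ x := by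
    rw [LinearEquiv.symm_apply_eq]; rfl
  simp [this]

variable [Linear R T] [MonoidalCategory T]

/-- Exactness of `ω` at the middle term of `X ⟶ Y ⟶ coker a`. -/
theorem IsTannakian.ker_cokernel_π [ω.Additive] (h : IsTannakian R ω) {X Y : T} (a : X ⟶ Y) :
    (ω.map (Limits.cokernel.π a)).hom.ker ≤ (ω.map a).hom.range := by
  have := h.leftExact
  have := h.rightExact
  let S : ShortComplex T := ShortComplex.mk a (Limits.cokernel.π a) (Limits.cokernel.condition a)
  have hS : S.Exact := ShortComplex.exact_cokernel a
  have hS' : (S.map ω).Exact := hS.map ω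
  rw [ShortComplex.moduleCat_exact_iff] at hS'
  intro y hy
  exact hS' y hy

/-- A linear map that is of the form `ω(a')` on an epimorphic cover is of the form `ω(f)`. -/
theorem IsTannakian.exists_map_eq [ω.Additive] (h : IsTannakian R ω) {X Y Z : T}
    {k : ω.obj X →ₗ[R] ω.obj Y} {a : Z ⟶ X} {a' : Z ⟶ Y}
    (ha : Function.Surjective (ω.map a).hom) (hk : k ∘ₗ (ω.map a).hom = (ω.map a').hom) :
    ∃ f : X ⟶ Y, (ω.map f).hom = k := by
  have := h.epi_of_surjective a ha
  -- By faithfulness this can be tested after `ω`, where `a'` factors through `a`. As `a` is the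
  -- cokernel of its kernel, `a'` descends to `X`.
  have h0 : Limits.kernel.ι a ≫ a' = 0 := h.hom_ext fun x => by
    rw [map_comp_apply, ← hk, LinearMap.comp_apply, ← map_comp_apply, Limits.kernel.condition]
    simp
  obtain ⟨f, hf⟩ := Limits.CokernelCofork.IsColimit.desc'
    (Abelian.epiIsCokernelOfKernel _ (Limits.kernelIsKernel a)) a' h0
  refine ⟨f, LinearMap.ext fun x => ?_⟩
  obtain ⟨z, rfl⟩ := ha x
  have hf' : a ≫ f = a' := hf
  rw [← map_comp_apply, hf', ← hk, LinearMap.comp_apply]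

end Exhaust

/-! ### Reconstruction of objects and morphisms of `T` from comodules. -/

section Comodule

variable {R : Type u} [CommRing R] {T : Type w} [Category.{v} T] [EssentiallySmall.{u} T]
  [Abelian T] [Linear R T] [MonoidalCategory T] [BraidedCategory T] {ω : T ⥤ ModuleCat.{u} R}
  [ω.Braided] [ω.Additive] [ω.Linear R] (h : IsTannakian R ω)
  {V : Type u} [AddCommGroup V] [Module R V] (ρ : V →ₗ[R] Coord h ⊗[R] V)

/-- A linear map `ρ : V → Coord h ⊗ V` is a comodule structure if it induces an action of the
group of tensor automorphisms of `A ⊗ ω` on `A ⊗ V` for all `A`. -/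
structure IsComodule : Prop where
  act_one : ∀ (A : Type u) [CommRing A] [Algebra R A], act ρ ((pointEquiv A h).symm 1) = 1
  act_mul : ∀ (A : Type u) [CommRing A] [Algebra R A] (g g' : tensorAut ω A),
    act ρ ((pointEquiv A h).symm (g * g')) =
      act ρ ((pointEquiv A h).symm g) * act ρ ((pointEquiv A h).symm g')

/-- The linear map `m : ω(X) → V` is equivariant. -/
def IsEquivariant {X : T} (m : ω.obj X →ₗ[R] V) : Prop :=
  ∀ x, m.lTensor (Coord h) (coaction h X x) = ρ (m x)

theorem act_coaction {A : Type u} [CommRing A] [Algebra R A] (g : tensorAut ω A) (X : T) :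
    act (coaction h X) ((pointEquiv A h).symm g) = (g.1 X).1 := by
  have : pointAut h ((pointEquiv A h).symm g) = g := (pointEquiv A h).apply_symm_apply g
  rw [← pointAut_val, this]

theorem isComodule_coaction (X : T) : IsComodule h (coaction h X) where
  act_one A _ _ := act_coaction h 1 X
  act_mul A _ _ g g' := by
    rw [act_coaction, act_coaction, act_coaction]
    rfl

variable {h ρ}

/-- The coproduct for which the coaction on a comodule is coassociative. -/
def opComul (h : IsTannakian R ω) : Coord h →ₐ[R] Coord h ⊗[R] Coord h :=
  -- In `act ρ (g * g')` the automorphism `g'` acts before `g`. The coefficient produced by the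
  -- first application of `ρ` must land in the left factor, hence the order opposite to that of
  -- `reprComul`.
  (pointEquiv _ h).symm (pointEquiv _ h Algebra.TensorProduct.includeRight *
    pointEquiv _ h Algebra.TensorProduct.includeLeft)

/-- Multiplicativity of the action, applied to the universal pair of points with values in `Coord h
⊗ Coord h`. -/
theorem IsComodule.coassoc (hρ : IsComodule h ρ) (v : V) :
    scalarMap (opComul h) V (ρ v) =
      (TensorProduct.assoc R _ _ _).symm (ρ.lTensor (Coord h) (ρ v)) := by
  have h1 := LinearMap.congr_fun (hρ.act_mul (Coord h ⊗[R] Coord h)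
    (pointEquiv _ h Algebra.TensorProduct.includeRight)
    (pointEquiv _ h Algebra.TensorProduct.includeLeft)) (1 ⊗ₜ v)
  rw [Equiv.symm_apply_apply, Equiv.symm_apply_apply, act_one_tmul, Module.End.mul_apply,
    act_one_tmul] at h1
  refine h1.trans ?_
  induction ρ v with
  | zero => simp
  | add x y hx hy => simp only [map_add, hx, hy]
  | tmul l w =>
    rw [LinearMap.rTensor_tmul, act_tmul, LinearMap.lTensor_tmul]
    induction ρ w with
    | zero => simp
    | add x y hx hy => simp only [map_add, smul_add, TensorProduct.tmul_add, hx, hy]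
    | tmul l' w' => simp [TensorProduct.smul_tmul']

theorem IsComodule.counit (hρ : IsComodule h ρ) (v : V) :
    scalarMap ((pointEquiv R h).symm 1) V (ρ v) = 1 ⊗ₜ v := by
  rw [← act_one_tmul, hρ.act_one, Module.End.one_apply]

/-- Every element of a comodule is in the image of an equivariant map from some `ω(P)`. -/
theorem IsComodule.exists_isEquivariant (hρ : IsComodule h ρ) (v : V) :
    ∃ (P : T) (m : ω.obj P →ₗ[R] V), IsEquivariant h ρ m ∧ v ∈ m.range := by
  -- Writing `ρ v` as one coefficient yields a candidate `k : ω(P) → V`. It sends `x` to `v` by the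
  -- counit axiom, but need not be equivariant.
  obtain ⟨P, hP, x, k, hk⟩ := Coord.exists_mkMod (ρ v)
  have hk' : ρ v = k.lTensor (Coord h) (coaction h P x) := by
    rw [coaction_of_rigid h hP, Coord.lTensor_mkMod, LinearMap.comp_id, hk]
  have hkx : k x = v := by
    have h1 := hρ.counit v
    rw [hk'] at h1
    have h2 := baseChange_scalarMap ((pointEquiv R h).symm 1) k (coaction h P x)
    rw [(isComodule_coaction h P).counit, LinearMap.baseChange_tmul] at h2
    simpa using congrArg (TensorProduct.lid R V) (h2.trans h1)
  -- Coassociativity says that the two maps whose equality is the equivariance of `k` have the same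
  -- coefficient at `x`.
  have hkk : Coord.mkMod h hP x (ρ ∘ₗ k) =
      Coord.mkMod h hP x (k.lTensor (Coord h) ∘ₗ coaction h P) := by
    have h1 := hρ.coassoc v
    have h2 := baseChange_scalarMap (opComul h) k (coaction h P x)
    rw [(isComodule_coaction h P).coassoc, coaction_of_rigid h hP, Coord.lTensor_mkMod] at h2
    have h3 := Coord.lTensor_mkMod (h := h) k hP x LinearMap.id
    rw [LinearMap.comp_id, hk] at h3
    have h4 : k.baseChange (Coord h) (Coord.mkMod h hP x LinearMap.id) = ρ v := h3
    rw [h4, h1, LinearMap.comp_id] at h2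
    have h5 : ∀ z : Coord h ⊗[R] (Coord h ⊗[R] ω.obj P),
        k.baseChange (Coord h ⊗[R] Coord h) ((TensorProduct.assoc R _ _ _).symm z) =
          (TensorProduct.assoc R _ _ _).symm ((k.lTensor (Coord h)).lTensor (Coord h) z) := by
      intro z
      induction z with
      | zero => simp
      | add x y hx hy => simp only [map_add, hx, hy]
      | tmul l z =>
        induction z with
        | zero => simp
        | add x y hx hy => simp only [map_add, TensorProduct.tmul_add, hx, hy]
        | tmul l' z => simp
    rw [h5, Coord.lTensor_mkMod, ← hk, Coord.lTensor_mkMod] at h2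
    exact ((TensorProduct.assoc R _ _ _).symm.injective h2).symm
  rw [← sub_eq_zero, ← map_sub] at hkk
  -- Hence the two maps agree after some `ω(a)` whose image contains `x`, and `k ∘ ω(a)` is
  -- equivariant with `v` in its image.
  obtain ⟨Q, hQ, a, y, rfl, ha⟩ := Coord.exists_of_mkMod_eq_zero hkk
  rw [LinearMap.sub_comp, sub_eq_zero] at ha
  refine ⟨Q, k ∘ₗ (ω.map a).hom, fun z => ?_, y, hkx⟩
  rw [LinearMap.lTensor_comp, LinearMap.comp_apply, lTensor_coaction]
  exact (LinearMap.congr_fun ha z).symm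

theorem IsEquivariant.comp_map {X Y : T} {m : ω.obj Y →ₗ[R] V} (hm : IsEquivariant h ρ m)
    (f : X ⟶ Y) : IsEquivariant h ρ (m ∘ₗ (ω.map f).hom) := fun x => by
  rw [LinearMap.lTensor_comp, LinearMap.comp_apply, lTensor_coaction]
  exact hm _

theorem IsEquivariant.add {X : T} {m m' : ω.obj X →ₗ[R] V} (hm : IsEquivariant h ρ m)
    (hm' : IsEquivariant h ρ m') : IsEquivariant h ρ (m + m') := fun x => by
  rw [LinearMap.lTensor_add, LinearMap.add_apply, hm, hm', LinearMap.add_apply, map_add]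

theorem IsEquivariant.of_comp_surjective {X Y : T} {m : ω.obj Y →ₗ[R] V} {f : X ⟶ Y}
    (hf : Function.Surjective (ω.map f).hom) (hm : IsEquivariant h ρ (m ∘ₗ (ω.map f).hom)) :
    IsEquivariant h ρ m := fun y => by
  obtain ⟨x, rfl⟩ := hf y
  have := hm x
  rwa [LinearMap.lTensor_comp, LinearMap.comp_apply, lTensor_coaction] at this

/-- A finitely generated submodule of a comodule is contained in the image of an equivariant map
from some `ω(P)` with `P` rigid. -/
theorem IsComodule.exists_isEquivariant_of_fg (hρ : IsComodule h ρ) {N : Submodule R V}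
    (hN : N.FG) : ∃ (P : T) (_ : rigid T P) (m : ω.obj P →ₗ[R] V), IsEquivariant h ρ m ∧
      N ≤ m.range := by
  obtain ⟨Z, m, hm, hmN⟩ := exists_le_range (ω := ω) (S := fun Z m => IsEquivariant h ρ m)
    (fun hm hm' => (hm.comp_map _).add (hm'.comp_map _)) hN
    (fun v _ => hρ.exists_isEquivariant v)
  obtain ⟨P, p, hP, _⟩ := h.dominated Z
  refine ⟨P, hP, _, hm.comp_map p, hmN.trans ?_⟩
  rw [LinearMap.range_comp, LinearMap.range_eq_top.mpr (h.map_surjective p), Submodule.map_top]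

/-- The image of an equivariant map is of the form `ω(X)`. -/
theorem IsEquivariant.exists_factor [IsNoetherianRing R] {P : T} (hP : rigid T P)
    {m : ω.obj P →ₗ[R] V} (hm : IsEquivariant h ρ m) :
    ∃ (X : T) (π : P ⟶ X) (i : ω.obj X →ₗ[R] V), IsEquivariant h ρ i ∧ Function.Injective i ∧
      i ∘ₗ (ω.map π).hom = m := by
  have := finite_of_rigid ω hP
  -- The kernel of `m` is exhausted by images of morphisms `a : Z ⟶ P` with `m ∘ ω(a) = 0`; being
  -- finitely generated, it is the image of a single one. Then `X` is the cokernel of this `a`.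
  obtain ⟨Z, k, ⟨a, rfl, hma⟩, hker⟩ := exists_le_range (ω := ω) (V := ω.obj P) (N := m.ker)
    (S := fun Z k => ∃ a : Z ⟶ P, (ω.map a).hom = k ∧ m ∘ₗ k = 0)
    (by
      rintro Z Z' _ _ ⟨a, rfl, ha⟩ ⟨a', rfl, ha'⟩
      refine ⟨Limits.biprod.fst ≫ a + Limits.biprod.snd ≫ a', ?_, ?_⟩
      · rw [ω.map_add, ω.map_comp, ω.map_comp]
        rfl
      · rw [LinearMap.comp_add, ← LinearMap.comp_assoc, ha, ← LinearMap.comp_assoc, ha']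
        simp)
    (IsNoetherian.noetherian _)
    (fun x hx => by
      -- For `x` in the kernel, equivariance says that the coefficient of `x` and `m` is `ρ(m x) =
      -- 0`, so the vanishing criterion applies.
      have h1 := hm x
      rw [coaction_of_rigid h hP, Coord.lTensor_mkMod, LinearMap.comp_id,
        LinearMap.mem_ker.mp hx, map_zero] at h1
      obtain ⟨Q, hQ, a, y, hy, ha⟩ := Coord.exists_of_mkMod_eq_zero h1
      exact ⟨Q, _, ⟨a, rfl, ha⟩, y, hy⟩)
  have hs := h.map_surjective (Limits.cokernel.π a)
  have hle : (ω.map (Limits.cokernel.π a)).hom.ker ≤ m.ker := by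
    refine (h.ker_cokernel_π a).trans ?_
    rintro _ ⟨z, rfl⟩
    exact LinearMap.congr_fun hma z
  obtain ⟨i, hi⟩ := exists_comp_eq_of_ker_le hs hle
  refine ⟨_, Limits.cokernel.π a, i, .of_comp_surjective hs (hi ▸ hm), ?_, hi⟩
  rw [injective_iff_map_eq_zero]
  intro x hx
  obtain ⟨y, rfl⟩ := hs x
  obtain ⟨z, rfl⟩ := hker (LinearMap.mem_ker.mpr ((LinearMap.congr_fun hi y).symm.trans hx))
  rw [← map_comp_apply, Limits.cokernel.condition]
  simp

/-- An equivariant map `ω(X) → ω(Y)` is of the form `ω(f)`. -/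
theorem IsEquivariant.exists_map_eq {X Y : T} {k : ω.obj X →ₗ[R] ω.obj Y}
    (hk : IsEquivariant h (coaction h Y) k) : ∃ f : X ⟶ Y, (ω.map f).hom = k := by
  have := h.finite X
  -- The class consists of the `ω(a)` on which the given map is induced by a morphism `a'` of `T`;
  -- one such `a` is an epimorphism.
  obtain ⟨Z, k, ⟨a, a', rfl, ha⟩, htop⟩ := exists_le_range (ω := ω) (V := ω.obj X) (N := ⊤)
    (S := fun Z m => ∃ (a : Z ⟶ X) (a' : Z ⟶ Y), (ω.map a).hom = m ∧ k ∘ₗ m = (ω.map a').hom)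
    (by
      rintro Z Z' _ _ ⟨a, a', rfl, ha⟩ ⟨b, b', rfl, hb⟩
      refine ⟨Limits.biprod.fst ≫ a + Limits.biprod.snd ≫ b,
        Limits.biprod.fst ≫ a' + Limits.biprod.snd ≫ b', ?_, ?_⟩
      · rw [ω.map_add, ω.map_comp, ω.map_comp]
        rfl
      · rw [LinearMap.comp_add, ← LinearMap.comp_assoc, ha, ← LinearMap.comp_assoc, hb, ω.map_add,
          ω.map_comp, ω.map_comp]
        rfl)
    Module.Finite.fg_top
    (fun x _ => by
      have h1 := hk x
      obtain ⟨P, hP, p, x, rfl⟩ := h.exists_lift x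
      obtain ⟨Q, hQ, q, y, hy⟩ := h.exists_lift (k ((ω.map p).hom x))
      rw [coaction_map h hP, Coord.lTensor_mkMod, ← hy, coaction_map h hQ] at h1
      -- Equivariance at `x` is an equality of two coefficients, one through the given map and one
      -- through `ω(q)`; on a common cover the maps themselves agree.
      obtain ⟨S, hS, a, b, z, rfl, -, hab⟩ := Coord.exists_of_mkMod_eq h1
      refine ⟨S, (ω.map (a ≫ p)).hom, ⟨a ≫ p, b ≫ q, rfl, ?_⟩, z, map_comp_apply ..⟩
      rw [ω.map_comp, ω.map_comp, ModuleCat.hom_comp, ModuleCat.hom_comp, ← hab,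
        LinearMap.comp_assoc])
  exact h.exists_map_eq (LinearMap.range_eq_top.mp (top_le_iff.mp htop)) ha

end Comodule

/-! ### Representations of `Aut^⊗(ω)` as comodules, and the equivalence with `T`. -/

section OfAction

variable {R : Type u} [CommRing R] {T : Type w} [Category.{v} T] [EssentiallySmall.{u} T]
  [Abelian T] [Linear R T] [MonoidalCategory T] [BraidedCategory T] {ω : T ⥤ ModuleCat.{u} R}
  [ω.Braided] [ω.Additive] [ω.Linear R] (h : IsTannakian R ω)
  {V : Type u} [AddCommGroup V] [Module R V]

/-- The universal tensor automorphism. -/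
def universalAut : (tensorAutFunctor ω).obj (CommAlgCat.of R (Coord h)) :=
  pointAut h (AlgHom.id R (Coord h))

/-- Yoneda: every point is the image of the universal one, so a functorial action is determined by
the action of the latter. -/
theorem exists_map_universalAut {A : CommAlgCat.{u} R} (g : (tensorAutFunctor ω).obj A) :
    (tensorAutFunctor ω).map (CommAlgCat.ofHom ((pointEquiv A h).symm g)) (universalAut h) = g := by
  rw [universalAut, map_pointAut]
  exact (pointEquiv A h).apply_symm_apply g

/-- The comodule structure that is given by the action of the universal tensor automorphism. -/
def coactionOf (σ : ∀ A : CommAlgCat.{u} R, (tensorAutFunctor ω).obj A →* Module.End A (A ⊗[R] V)) :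
    V →ₗ[R] Coord h ⊗[R] V :=
  (σ (CommAlgCat.of R (Coord h)) (universalAut h)).restrictScalars R ∘ₗ
    TensorProduct.mk R (Coord h) V 1

variable {σ : ∀ A : CommAlgCat.{u} R, (tensorAutFunctor ω).obj A →* Module.End A (A ⊗[R] V)}

theorem act_coactionOf (hσ : ∀ {A B : CommAlgCat.{u} R} (φ : A ⟶ B) (g),
    σ B ((tensorAutFunctor ω).map φ g) = endMapFun φ.hom (σ A g)) {A : CommAlgCat.{u} R}
    (g : (tensorAutFunctor ω).obj A) :
    act (coactionOf h σ) ((pointEquiv A h).symm g) = σ A g := by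
  conv_rhs => rw [← exists_map_universalAut h g, hσ]
  refine ext_one_tmul fun v => ?_
  rw [act_one_tmul]
  simp [endMapFun, coactionOf]

theorem isComodule_coactionOf (hσ : ∀ {A B : CommAlgCat.{u} R} (φ : A ⟶ B) (g),
    σ B ((tensorAutFunctor ω).map φ g) = endMapFun φ.hom (σ A g)) :
    IsComodule h (coactionOf h σ) where
  act_one A _ _ := (act_coactionOf h hσ (A := CommAlgCat.of R A) 1).trans (map_one _)
  act_mul A _ _ g g' := by
    have := act_coactionOf h hσ (A := CommAlgCat.of R A)
    exact (this (g * g')).trans ((map_mul _ _ _).trans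
      (congrArg₂ (· * ·) (this g).symm (this g').symm))

end OfAction

section Rep

variable {R : Type u} [CommRing R] {T : Type w} [Category.{v} T] [EssentiallySmall.{u} T]
  [Abelian T] [Linear R T] [MonoidalCategory T] [BraidedCategory T] {ω : T ⥤ ModuleCat.{u} R}
  [ω.Braided] [ω.Additive] [ω.Linear R] (h : IsTannakian R ω)

/-- The comodule structure on a representation of `Aut^⊗(ω)`. -/
def repCoaction (V : FinRep (tensorAutFunctor ω)) : V.V →ₗ[R] Coord h ⊗[R] V.V :=
  coactionOf h fun A => (Units.coeHom _).comp (V.ρ A)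

theorem act_repCoaction (V : FinRep (tensorAutFunctor ω)) {A : CommAlgCat.{u} R}
    (g : (tensorAutFunctor ω).obj A) :
    act (repCoaction h V) ((pointEquiv A h).symm g) = (V.ρ A g).1 :=
  act_coactionOf h (fun φ g => congrArg Units.val (V.naturality φ g)) g

theorem isComodule_repCoaction (V : FinRep (tensorAutFunctor ω)) :
    IsComodule h (repCoaction h V) :=
  isComodule_coactionOf h fun φ g => congrArg Units.val (V.naturality φ g)

theorem repCoaction_toRep (X : T) : repCoaction h ((toRep ω h).obj X) = coaction h X := by
  refine LinearMap.ext fun x => ?_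
  exact (act_one_tmul (coaction h X) (AlgHom.id R _) x).trans (LinearMap.rTensor_id_apply _ _ _)

/-- Equivariance at the universal point. The converse direction, for maps from `ω(X)`, is
`comm_of_isEquivariant`. -/
theorem lTensor_repCoaction {V W : FinRep (tensorAutFunctor ω)} (f : V ⟶ W) (v : V.V) :
    f.hom.lTensor (Coord h) (repCoaction h V v) = repCoaction h W (f.hom v) :=
  f.comm (CommAlgCat.of R (Coord h)) (universalAut h) (1 ⊗ₜ v)

theorem toRep_linear : (toRep ω h).Linear R where
  map_smul {X Y} f r := FinRep.hom_ext <| by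
    change (ω.map (r • f)).hom = _
    rw [ω.map_smul]
    rfl

theorem comm_of_isEquivariant {X : T} {V : FinRep (tensorAutFunctor ω)} {i : ω.obj X →ₗ[R] V.V}
    (hi : IsEquivariant h (repCoaction h V) i) (A : CommAlgCat.{u} R)
    (g : (tensorAutFunctor ω).obj A) (x : A ⊗[R] ω.obj X) :
    i.baseChange A ((((toRep ω h).obj X).ρ A g).1 x) = (V.ρ A g).1 (i.baseChange A x) := by
  rw [← act_repCoaction h, ← act_repCoaction h, repCoaction_toRep]
  exact baseChange_act hi _ x

theorem toRep_isEquivalence [IsNoetherianRing R] : (toRep ω h).IsEquivalence where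
  faithful :=
    { map_injective := fun {X Y f g} hfg => by
        have := h.faithful
        exact ω.map_injective (ModuleCat.hom_ext (congrArg FinRep.Hom.hom hfg)) }
  full :=
    { map_surjective := fun {X Y} f => by
        have hf : IsEquivariant h (coaction h Y) f.hom := fun x => by
          rw [← repCoaction_toRep, ← repCoaction_toRep]
          exact lTensor_repCoaction h f x
        obtain ⟨a, ha⟩ := hf.exists_map_eq
        exact ⟨a, FinRep.hom_ext ha⟩ }
  essSurj :=
    { mem_essImage := fun V => by
        obtain ⟨P, hP, m, hm, htop⟩ := (isComodule_repCoaction h V).exists_isEquivariant_of_fg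
          (N := ⊤) Module.Finite.fg_top
        obtain ⟨X, π, i, hi, hinj, rfl⟩ := hm.exists_factor hP
        -- The map `m` covers `V`, so its image, which is `ω(X)`, is all of `V`.
        have hsurj : Function.Surjective i :=
          LinearMap.range_eq_top.mp (top_le_iff.mp (htop.trans (LinearMap.range_comp_le_range _ _)))
        exact ⟨X, ⟨FinRep.isoMk (X := (toRep ω h).obj X) (LinearEquiv.ofBijective i ⟨hinj, hsurj⟩)
          (comm_of_isEquivariant h hi)⟩⟩ }

/-- The tensor structure of `toRep ω h` is that of `ω`. -/
def toRepCore : (toRep ω h).CoreMonoidal where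
  εIso := FinRep.isoMk (X := FinRep.unit) (Y := (toRep ω h).obj (𝟙_ T))
    (Functor.Monoidal.εIso ω).toLinearEquiv fun _ g x => g.2.2.2 x
  μIso X Y := FinRep.isoMk (X := FinRep.tensor ((toRep ω h).obj X) ((toRep ω h).obj Y))
    (Y := (toRep ω h).obj (X ⊗ Y)) (Functor.Monoidal.μIso ω X Y).toLinearEquiv
    fun _ g x => g.2.2.1 X Y x
  μIso_hom_natural_left f X := FinRep.hom_ext
    (congrArg ModuleCat.Hom.hom (Functor.LaxMonoidal.μ_natural_left ω f X))
  μIso_hom_natural_right X f := FinRep.hom_ext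
    (congrArg ModuleCat.Hom.hom (Functor.LaxMonoidal.μ_natural_right ω X f))
  associativity X Y Z := FinRep.hom_ext
    (congrArg ModuleCat.Hom.hom (Functor.LaxMonoidal.associativity ω X Y Z))
  left_unitality X := FinRep.hom_ext
    (congrArg ModuleCat.Hom.hom (Functor.LaxMonoidal.left_unitality ω X))
  right_unitality X := FinRep.hom_ext
    (congrArg ModuleCat.Hom.hom (Functor.LaxMonoidal.right_unitality ω X))

/-- The functor `toRep ω h` as a symmetric monoidal functor. -/
abbrev toRepBraided : (toRep ω h).Braided where
  __ := (toRepCore h).toMonoidal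
  braided X Y := FinRep.hom_ext
    (congrArg ModuleCat.Hom.hom (Functor.LaxBraided.braided (F := ω) X Y))

theorem toRepBraided_ε :
    letI := toRepBraided h
    (Functor.LaxMonoidal.ε (toRep ω h)).hom = (Functor.LaxMonoidal.ε ω).hom := rfl

theorem toRepBraided_μ (X Y : T) :
    letI := toRepBraided h
    (Functor.LaxMonoidal.μ (toRep ω h) X Y).hom = (Functor.LaxMonoidal.μ ω X Y).hom := rfl

theorem toRep_forget : toRep ω h ⋙ FinRep.forget _ = ω := rfl

end Rep

/-! ### Rigidity of objects with flat fibre. -/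

section Pairing

variable {C : Type*} [Category* C] [MonoidalCategory C]

/-- For an epimorphism `p : P → X` and a monomorphism `i : D → Pᘁ`, an exact pairing of `X` and `D`
is given by morphisms through which the restricted evaluation and coevaluation of `P` factor. -/
abbrev exactPairingOfFactor {P X D : C} [HasRightDual P] (p : P ⟶ X) [Epi p] (i : D ⟶ Pᘁ) [Mono i]
    (e : D ⊗ X ⟶ 𝟙_ C) (he : D ◁ p ≫ e = i ▷ P ≫ ε_ P (Pᘁ))
    (c : 𝟙_ C ⟶ X ⊗ D) (hc : c ≫ X ◁ i = η_ P (Pᘁ) ≫ p ▷ Pᘁ) : ExactPairing X D where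
  coevaluation' := c
  evaluation' := e
  coevaluation_evaluation' := by
    have : Mono (𝟙_ C ◁ i) := by
      rw [id_whiskerLeft]
      infer_instance
    -- After composition with the monomorphism `i`, the hypotheses on `e` and `c` turn the triangle
    -- identity into that of `P`. The other identity is checked in the same way after the
    -- epimorphism `p`.
    rw [← cancel_mono (λ_ D).hom, ← cancel_mono i]
    simp only [Category.assoc, Iso.inv_hom_id, Category.comp_id, ← leftUnitor_naturality]
    rw [← whisker_exchange_assoc]
    have h1 : D ◁ c ≫ (α_ D X D).inv ≫ (D ⊗ X) ◁ i =
        D ◁ η_ P (Pᘁ) ≫ (α_ D P (Pᘁ)).inv ≫ (D ◁ p) ▷ Pᘁ := by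
      rw [← associator_inv_naturality_right, ← whiskerLeft_comp_assoc, hc,
        whiskerLeft_comp_assoc, associator_inv_naturality_middle]
    rw [reassoc_of% h1, ← comp_whiskerRight_assoc, he, comp_whiskerRight_assoc,
      ← associator_inv_naturality_left_assoc, whisker_exchange_assoc,
      ExactPairing.coevaluation_evaluation_assoc]
    simp
  evaluation_coevaluation' := by
    have : Epi (𝟙_ C ◁ p) := by
      rw [id_whiskerLeft]
      infer_instance
    rw [← cancel_epi (𝟙_ C ◁ p), whisker_exchange_assoc, associator_naturality_right_assoc,
      ← whiskerLeft_comp, he, whiskerLeft_comp, ← associator_naturality_middle_assoc,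
      ← comp_whiskerRight_assoc, hc, comp_whiskerRight_assoc, associator_naturality_left_assoc,
      ← whisker_exchange, ExactPairing.evaluation_coevaluation_assoc]
    simp

end Pairing

section Rigid

variable {R : Type u} [CommRing R] {T : Type w} [Category.{v} T] [Abelian T] [Linear R T]
  [MonoidalCategory T] {ω : T ⥤ ModuleCat.{u} R}

theorem IsTannakian.map_exact [ω.Additive] (h : IsTannakian R ω) {S : ShortComplex T}
    (hS : S.Exact) : Function.Exact (ω.map S.f).hom (ω.map S.g).hom := by
  have := h.leftExact
  have := h.rightExact
  exact (ShortComplex.ShortExact.moduleCat_exact_iff_function_exact _).mp (hS.map ω)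

theorem IsTannakian.exact_of_map_exact [ω.Additive] (h : IsTannakian R ω) {S : ShortComplex T}
    (hS : Function.Exact (ω.map S.f).hom (ω.map S.g).hom) : S.Exact := by
  have := h.leftExact
  have := h.rightExact
  have := h.faithful
  exact (S.exact_map_iff_of_faithful ω).mp
    ((ShortComplex.ShortExact.moduleCat_exact_iff_function_exact _).mpr hS)

variable [ω.Monoidal]

theorem map_whiskerLeft_μ (X : T) {Y Z : T} (f : Y ⟶ Z) (z : ω.obj X ⊗[R] ω.obj Y) :
    (ω.map (X ◁ f)).hom ((Functor.LaxMonoidal.μ ω X Y).hom z) =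
      (Functor.LaxMonoidal.μ ω X Z).hom ((ω.map f).hom.lTensor (ω.obj X) z) :=
  (congrArg (fun k => k.hom z) (Functor.LaxMonoidal.μ_natural_right ω X f)).symm

/-- The constraint `μ` is invertible, so exactness after tensoring with `X` is a question about
modules. -/
theorem map_whiskerLeft_exact (X : T) {Y Z W : T} {f : Y ⟶ Z} {g : Z ⟶ W}
    (hfg : Function.Exact ((ω.map f).hom.lTensor (ω.obj X)) ((ω.map g).hom.lTensor (ω.obj X))) :
    Function.Exact (ω.map (X ◁ f)).hom (ω.map (X ◁ g)).hom := by
  have inj := Function.LeftInverse.injective (δ_μ (ω := ω) (X := X) (Y := W))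
  intro z
  obtain ⟨z, rfl⟩ : ∃ z', (Functor.LaxMonoidal.μ ω X Z).hom z' = z := ⟨_, μ_δ z⟩
  rw [map_whiskerLeft_μ, ← map_zero (Functor.LaxMonoidal.μ ω X W).hom, inj.eq_iff, hfg]
  constructor
  · rintro ⟨y, rfl⟩
    exact ⟨_, map_whiskerLeft_μ X f y⟩
  · rintro ⟨y, hy⟩
    obtain ⟨y, rfl⟩ : ∃ y', (Functor.LaxMonoidal.μ ω X Y).hom y' = y := ⟨_, μ_δ y⟩
    rw [map_whiskerLeft_μ] at hy
    exact ⟨y, Function.LeftInverse.injective (δ_μ (ω := ω)) hy⟩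

theorem IsTannakian.mono_of_injective (h : IsTannakian R ω) {X Y : T} (f : X ⟶ Y)
    (hf : Function.Injective (ω.map f).hom) : Mono f := by
  have := h.faithful
  exact ω.mono_of_mono_map ((ModuleCat.mono_iff_injective _).mpr hf)

/-- An object `X` is rigid if the module `ω(X)` is flat. -/
theorem IsTannakian.rigid_of_flat [MonoidalPreadditive T] [ω.Additive] (h : IsTannakian R ω) (X : T)
    [Module.Flat R (ω.obj X)] : rigid T X := by
  obtain ⟨P, p, ⟨_⟩, _⟩ := h.dominated X
  obtain ⟨Q, q, ⟨_⟩, _⟩ := h.dominated (Limits.kernel p)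
  -- The object `X` is the cokernel of a map `a` between rigid objects, so its dual should be the
  -- kernel of the dual map of `a`.
  let a : Q ⟶ P := q ≫ Limits.kernel.ι p
  let i : Limits.kernel (aᘁ) ⟶ Pᘁ := Limits.kernel.ι (aᘁ)
  have hi : i ≫ aᘁ = 0 := Limits.kernel.condition _
  have hap : Function.Exact (ω.map a).hom (ω.map p).hom := by
    intro x
    rw [h.map_exact (ShortComplex.exact_kernel p) x]
    constructor
    · rintro ⟨y, rfl⟩
      obtain ⟨z, rfl⟩ := h.map_surjective q y
      exact ⟨z, map_comp_apply ..⟩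
    · rintro ⟨z, rfl⟩
      exact ⟨_, (map_comp_apply ..).symm⟩
  have hia : Function.Exact (ω.map i).hom (ω.map (aᘁ)).hom :=
    h.map_exact (ShortComplex.exact_kernel (aᘁ))
  have hD := map_whiskerLeft_exact (ω := ω) (Limits.kernel (aᘁ))
    (lTensor_exact _ hap (h.map_surjective p))
  -- Flatness enters here and in the next step: tensoring with `X` must preserve the kernel defining
  -- the dual. The previous step needs only right exactness.
  have hX := map_whiskerLeft_exact (ω := ω) X (Module.Flat.lTensor_exact _ hia)
  have : Mono (X ◁ i) := h.mono_of_injective _ <| by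
    rw [injective_iff_map_eq_zero]
    intro z hz
    obtain ⟨z, rfl⟩ : ∃ z', (Functor.LaxMonoidal.μ ω _ _).hom z' = z := ⟨_, μ_δ z⟩
    rw [map_whiskerLeft_μ, ← map_zero (Functor.LaxMonoidal.μ ω _ _).hom] at hz
    rw [Module.Flat.lTensor_preserves_injective_linearMap _ (h.map_injective i)
      ((Function.LeftInverse.injective (δ_μ (ω := ω)) hz).trans (map_zero _).symm), map_zero]
  have : Epi (Limits.kernel (aᘁ) ◁ p) := h.epi_of_surjective _ fun z => by
    obtain ⟨z, rfl⟩ : ∃ z', (Functor.LaxMonoidal.μ ω _ _).hom z' = z := ⟨_, μ_δ z⟩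
    obtain ⟨y, rfl⟩ := LinearMap.lTensor_surjective _ (h.map_surjective p) z
    exact ⟨_, map_whiskerLeft_μ ..⟩
  have hap0 : a ≫ p = 0 := by simp [a]
  have hDS : (ShortComplex.mk (Limits.kernel (aᘁ) ◁ a) (Limits.kernel (aᘁ) ◁ p)
      (by rw [← whiskerLeft_comp, hap0, MonoidalPreadditive.whiskerLeft_zero])).Exact :=
    h.exact_of_map_exact hD
  have hXS : (ShortComplex.mk (X ◁ i) (X ◁ aᘁ)
      (by rw [← whiskerLeft_comp, hi, MonoidalPreadditive.whiskerLeft_zero])).Exact :=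
    h.exact_of_map_exact hX
  exact ⟨{ rightDual := Limits.kernel (aᘁ)
           exact := exactPairingOfFactor p i
            -- The evaluation of `P` restricted to the kernel vanishes on the image of `a`, because
            -- `a` can be moved across the evaluation to its dual; so it descends to `X`. Dually,
            -- the coevaluation lifts to the kernel.
            (hDS.desc (i ▷ P ≫ ε_ P (Pᘁ)) (by
              change Limits.kernel (aᘁ) ◁ a ≫ i ▷ P ≫ ε_ P (Pᘁ) = 0
              rw [whisker_exchange_assoc, ← rightAdjointMate_comp_evaluation,
                ← comp_whiskerRight_assoc, hi, MonoidalPreadditive.zero_whiskerRight,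
                Limits.zero_comp])) (hDS.g_desc _ _)
            (hXS.lift (η_ P (Pᘁ) ≫ p ▷ Pᘁ) (by
              change (η_ P (Pᘁ) ≫ p ▷ Pᘁ) ≫ X ◁ aᘁ = 0
              rw [Category.assoc, ← whisker_exchange,
                reassoc_of% coevaluation_comp_rightAdjointMate a, ← comp_whiskerRight, hap0,
                MonoidalPreadditive.zero_whiskerRight, Limits.comp_zero])) (hXS.lift_f _ _) }⟩

end Rigid

/-! ### The functor on the generic fibre: linearity, faithfulness and fullness. -/

section LinearExt

variable {R K : Type u} [CommRing R] [CommRing K] [Algebra R K]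

theorem ScalarExt.liftHom_smul {C : Type w} [Category.{v} C] [Preadditive C] [Linear R C]
    {D : Type*} [Category* D] [Preadditive D] [Linear K D] (F : C ⥤ D) [F.Additive]
    (hF : ∀ {X Y : C} (r : R) (f : X ⟶ Y), F.map (r • f) = algebraMap R K r • F.map f)
    {X Y : ScalarExt R K C} (c : K) (f : X ⟶ Y) :
    liftHom F hF X Y (c • f) = c • liftHom F hF X Y f := by
  induction f using hom_induction with
  | zero => simp
  | add f g hf hg => rw [smul_add, map_add, map_add, smul_add, hf, hg]
  | tmul a f => rw [smul_tmulHom, liftHom_tmulHom, liftHom_tmulHom, smul_smul]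

theorem ScalarExt.lift_linear {C : Type w} [Category.{v} C] [Preadditive C] [Linear R C]
    {D : Type*} [Category* D] [Preadditive D] [Linear K D] (F : C ⥤ D) [F.Additive]
    (hF : ∀ {X Y : C} (r : R) (f : X ⟶ Y), F.map (r • f) = algebraMap R K r • F.map f) :
    (ScalarExt.lift F hF).Linear K where
  map_smul f c := liftHom_smul F hF c f

end LinearExt

section Injective

variable {R K : Type u} [CommRing R] [IsDedekindDomain R] [Field K] [Algebra R K]
  [IsFractionRing R K] (M : Type u) [AddCommGroup M] [Module R M]

variable (K) in
theorem mk_one_injective_of_flat [Module.Flat R M] :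
    Function.Injective (TensorProduct.mk R K M 1) := by
  have h1 := Module.Flat.rTensor_preserves_injective_linearMap (M := M)
    (Algebra.linearMap R K) (IsFractionRing.injective R K)
  have h2 : TensorProduct.mk R K M 1 =
      (Algebra.linearMap R K).rTensor M ∘ₗ (TensorProduct.lid R M).symm.toLinearMap := by
    ext; simp
  rw [h2]
  exact h1.comp (TensorProduct.lid R M).symm.injective

end Injective

section Generic

variable {R : Type u} [CommRing R] {K : Type u} [Field K] [Algebra R K]
  {T : Type w} [Category.{v} T] [Abelian T] [Linear R T] [MonoidalCategory T]
  {ω : T ⥤ ModuleCat.{u} R} [ω.Additive] [ω.Linear R]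

theorem genericFunctor_map_tmulHom [ω.Monoidal] (h : IsTannakian R ω)
    {X Y : ScalarExt R K (rigid T).FullSubcategory} (a : K) (f : X.as ⟶ Y.as) :
    ((genericFunctor K ω h).map (ScalarExt.tmulHom a f : X ⟶ Y)).hom =
      a • (ω.map f.hom).hom.baseChange K := rfl

theorem genericFunctor_linear [ω.Monoidal] (h : IsTannakian R ω) :
    (genericFunctor K ω h).Linear K :=
  ScalarExt.lift_linear _ _

instance genericFunctor_additive [ω.Monoidal] (h : IsTannakian R ω) :
    (genericFunctor K ω h).Additive where
  map_add {_ _ f g} := map_add (ScalarExt.liftHom _ _ _ _) f g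

variable [IsDedekindDomain R] [IsFractionRing R K]

/-- A nonzero multiple of a morphism of the base change is `1 ⊗ f0`. Since `ω` is faithful and the
projective module `ω(Y)` embeds in `K ⊗ ω(Y)`, the morphism `f0` vanishes if its image does. -/
theorem genericFunctor_faithful [ω.Monoidal] (h : IsTannakian R ω) :
    (genericFunctor K ω h).Faithful := by
  suffices H : ∀ {X Y : ScalarExt R K (rigid T).FullSubcategory} (f : X ⟶ Y),
      (genericFunctor K ω h).map f = 0 → f = 0 from
    ⟨fun {X Y f g} hfg => sub_eq_zero.mp (H _ (by rw [Functor.map_sub, hfg, sub_self]))⟩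
  intro X Y f hf
  obtain ⟨⟨f0, s⟩, hs⟩ := IsLocalizedModule.surj (nonZeroDivisors R)
    (TensorProduct.mk R K (X.as ⟶ Y.as) 1) f
  have hs' : algebraMap R K s • f = ScalarExt.tmulHom 1 f0 :=
    (algebraMap_smul K (s : R) (show K ⊗[R] (X.as ⟶ Y.as) from f)).trans hs
  have := genericFunctor_linear (K := K) h
  have h1 := congrArg (fun k => ((genericFunctor K ω h).map k).hom) hs'
  have := projective_of_rigid (ω := ω) Y.as.property
  have h2 : f0 = 0 := by
    refine (rigid T).hom_ext (h.hom_ext fun x => mk_one_injective_of_flat (R := R) K _ ?_)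
    have h3 := LinearMap.congr_fun h1 (1 ⊗ₜ x)
    rw [Functor.map_smul, hf, smul_zero] at h3
    rw [genericFunctor_map_tmulHom, one_smul] at h3
    have h4 : (ω.map (0 : X.as ⟶ Y.as).hom).hom x = 0 := by
      change (ω.map (0 : X.as.obj ⟶ Y.as.obj)).hom x = 0
      simp
    rw [h4, map_zero]
    exact h3.symm
  rw [h2] at hs'
  refine (smul_eq_zero_iff_right ?_).mp (hs'.trans (TensorProduct.tmul_zero _ _))
  exact IsFractionRing.to_map_ne_zero_of_mem_nonZeroDivisors s.2

end Generic

section Full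

variable {R K : Type u} [CommRing R] [CommRing K] [Algebra R K]

variable (R K) in
/-- The base change `K ⊗ A` of an `R`-algebra `A`. -/
def extAlg (A : Type u) [CommRing A] [Algebra R A] : CommAlgCat.{u} K :=
  CommAlgCat.of K (K ⊗[R] A)

variable (R K) in
/-- The homomorphism `A → K ⊗ A` of `R`-algebras. -/
def extHom (A : Type u) [CommRing A] [Algebra R A] : A →ₐ[R] restrictAlg R (extAlg R K A) where
  __ := (Algebra.TensorProduct.includeRight : A →ₐ[R] K ⊗[R] A).toRingHom
  commutes' r := by
    change (Algebra.TensorProduct.includeRight : A →ₐ[R] K ⊗[R] A) (algebraMap R A r) =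
      algebraMap K (K ⊗[R] A) (algebraMap R K r)
    rw [AlgHom.commutes]
    exact IsScalarTower.algebraMap_apply R K (K ⊗[R] A) r

theorem extHom_injective [IsDomain R] [IsDomain K] [FaithfulSMul R K]
    (A : Type u) [CommRing A] [Algebra R A] [Module.Flat R A] :
    Function.Injective (extHom R K A) :=
  Algebra.TensorProduct.includeRight_injective (FaithfulSMul.algebraMap_injective R K)

/-- If `K ⊗ f` is equivariant, then `f` is equivariant. -/
theorem comm_of_glRestrict_comm {A : CommAlgCat.{u} K} {M N : Type u} [AddCommGroup M]
    [Module R M] [AddCommGroup N] [Module R N] (f : M →ₗ[R] N)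
    {g : LinearMap.GeneralLinearGroup (restrictAlg R A) (restrictAlg R A ⊗[R] M)}
    {h : LinearMap.GeneralLinearGroup (restrictAlg R A) (restrictAlg R A ⊗[R] N)}
    (H : ∀ x, (f.baseChange K).baseChange A ((glRestrict R A M g).1 x) =
      (glRestrict R A N h).1 ((f.baseChange K).baseChange A x)) (x : restrictAlg R A ⊗[R] M) :
    f.baseChange (restrictAlg R A) (g.1 x) = h.1 (f.baseChange (restrictAlg R A) x) := by
  obtain ⟨x, rfl⟩ := (AlgebraTensorModule.cancelBaseChange R K (restrictAlg R A)
    (restrictAlg R A) M).surjective x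
  rw [← cancel_glExt (A := restrictAlg R A), ← cancel_baseChange, ← cancel_baseChange,
    ← cancel_glExt (A := restrictAlg R A)]
  exact congrArg _ (H x)

end Full

section Full

variable {R : Type u} [CommRing R] [IsDedekindDomain R] {K : Type u} [Field K] [Algebra R K]
  [IsFractionRing R K]
  {T : Type w} [Category.{v} T] [EssentiallySmall.{u} T] [Abelian T] [Linear R T]
  [MonoidalCategory T] [BraidedCategory T]
  {ω : T ⥤ ModuleCat.{u} R} [ω.Braided] [ω.Additive] [ω.Linear R] (h : IsTannakian R ω)

/-- Equivariance can be tested at a single point of `G_K` that embeds `Coord h` in `A`, because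
flatness of `ω(Y)` makes `Coord h ⊗ ω(Y) → A ⊗ ω(Y)` injective. -/
theorem isEquivariant_of_glRestrict {X Y : T} [Module.Flat R (ω.obj Y)]
    {k : ω.obj X →ₗ[R] ω.obj Y} {A : CommAlgCat.{u} K} {f : Coord h →ₐ[R] restrictAlg R A}
    (hf : Function.Injective f)
    (H : ∀ z, (k.baseChange K).baseChange A
        ((glRestrict R A _ ((pointAut (A := restrictAlg R A) h f).1 X)).1 z) =
      (glRestrict R A _ ((pointAut (A := restrictAlg R A) h f).1 Y)).1
        ((k.baseChange K).baseChange A z)) :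
    IsEquivariant h (coaction h Y) k := fun x => by
  apply Module.Flat.rTensor_preserves_injective_linearMap (M := ω.obj Y) f.toLinearMap hf
  change scalarMap f _ (k.baseChange (Coord h) _) = scalarMap _ _ _
  rw [← baseChange_scalarMap, ← act_one_tmul, ← act_one_tmul, ← LinearMap.baseChange_tmul]
  exact comm_of_glRestrict_comm k H (1 ⊗ₜ x)

variable (R) in
-- Common denominators exist because a finitely generated module over a Noetherian ring is finitely
-- presented.
theorem exists_baseChange_eq_smul {M N : Type u} [AddCommGroup M] [Module R M] [Module.Finite R M]
    [AddCommGroup N] [Module R N] (k : K ⊗[R] M →ₗ[K] K ⊗[R] N) :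
    ∃ (a : K) (k₀ : M →ₗ[R] N), a ≠ 0 ∧ k₀.baseChange K = a • k := by
  have : Module.FinitePresentation R M := Module.finitePresentation_of_finite R _
  obtain ⟨k₀, s, hs⟩ := Module.FinitePresentation.exists_lift_of_isLocalizedModule
    (nonZeroDivisors R) (TensorProduct.mk R K N 1)
    (k.restrictScalars R ∘ₗ TensorProduct.mk R K M 1)
  refine ⟨algebraMap R K s, k₀, IsFractionRing.to_map_ne_zero_of_mem_nonZeroDivisors s.2,
    ext_one_tmul fun x => ?_⟩
  rw [LinearMap.baseChange_tmul]
  exact (LinearMap.congr_fun hs x).trans (algebraMap_smul K (s : R) (k (1 ⊗ₜ x))).symm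

/-- A multiple of the given map is defined over `R`. Equivariance at the point `Coord h → K ⊗ Coord
h`, which is injective, descends to `R`, where fullness is known. -/
theorem genericFunctor_full : (genericFunctor K ω h).Full where
  map_surjective {X Y} k := by
    have := projective_of_rigid (ω := ω) Y.as.property
    have := h.finite X.as.obj
    let k' : K ⊗[R] ω.obj X.as.obj →ₗ[K] K ⊗[R] ω.obj Y.as.obj := k.hom
    obtain ⟨a, k₀, ha, hk⟩ := exists_baseChange_eq_smul R k'
    have hequiv : IsEquivariant h (coaction h Y.as.obj) k₀ := by
      refine isEquivariant_of_glRestrict (A := extAlg R K (Coord h)) h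
        (f := extHom R K (Coord h)) (extHom_injective (Coord h)) fun z => ?_
      rw [hk]
      exact (a • k).comm (extAlg R K (Coord h)) (pointAut h (extHom R K (Coord h))) z
    obtain ⟨f, hf⟩ := hequiv.exists_map_eq
    refine ⟨ScalarExt.tmulHom a⁻¹ (ObjectProperty.homMk f), FinRep.hom_ext ?_⟩
    rw [genericFunctor_map_tmulHom]
    change a⁻¹ • (ω.map f).hom.baseChange K = _
    rw [hf, hk]
    exact inv_smul_smul₀ ha k.hom

end Full

/-! ### Representations of `G_K` as comodules over the coordinate ring of `G`. -/

section ExtLift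

variable {R K : Type u} [CommRing R] [CommRing K] [Algebra R K] {A A' : Type u} [CommRing A]
  [Algebra R A] [CommRing A'] [Algebra R A'] {B : CommAlgCat.{u} K}

theorem tmul_restrictScalars_smul {C V : Type*} [CommRing C] [Algebra K C] [AddCommGroup V]
    [Module R V] [Module K V] [IsScalarTower R K V] (c : C) (r : R) (v : V) :
    c ⊗ₜ[K] (r • v) = algebraMap R K r • c ⊗ₜ[K] v := by
  rw [← TensorProduct.tmul_smul, algebraMap_smul]

theorem liftEquiv_one_tmul {A C : Type*} [CommRing A] [Algebra R A] [CommRing C] [Algebra K C]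
    [Algebra R C] [IsScalarTower R K C] (f : A →ₐ[R] C) (a : A) :
    AlgHom.liftEquiv R K A C f (1 ⊗ₜ a) = f a := by
  simp

theorem cancelBaseChange_one_tmul {C M : Type*} [CommRing C] [Algebra K C] [Algebra R C]
    [IsScalarTower R K C] [AddCommGroup M] [Module R M] (x : M) :
    AlgebraTensorModule.cancelBaseChange R K C C M (1 ⊗ₜ (1 ⊗ₜ x)) = 1 ⊗ₜ x := by
  simp

theorem ext_one_tmul_one_tmul {C M Q : Type u} [CommRing C] [Algebra K C] [AddCommGroup M]
    [Module R M] [AddCommGroup Q] [Module C Q] {f g : C ⊗[K] (K ⊗[R] M) →ₗ[C] Q}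
    (hfg : ∀ x, f (1 ⊗ₜ (1 ⊗ₜ x)) = g (1 ⊗ₜ (1 ⊗ₜ x))) : f = g := by
  refine ext_one_tmul fun y => ?_
  induction y with
  | zero => simp
  | add x y hx hy => simp only [TensorProduct.tmul_add, map_add, hx, hy]
  | tmul k x =>
    have h1 : (1 : C) ⊗ₜ[K] (k ⊗ₜ[R] x) = algebraMap K C k • (1 : C) ⊗ₜ[K] ((1 : K) ⊗ₜ[R] x) := by
      rw [algebraMap_smul, ← TensorProduct.tmul_smul, TensorProduct.smul_tmul', smul_eq_mul,
        mul_one]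
    rw [h1, map_smul, map_smul, hfg]

/-- The homomorphism `K ⊗ A → B` of `K`-algebras that extends a homomorphism `f : A → B` of
`R`-algebras. -/
def extLift (f : A →ₐ[R] restrictAlg R B) : extAlg R K A ⟶ B :=
  CommAlgCat.ofHom (X := K ⊗[R] A) (Y := B) (AlgHom.liftEquiv R K A (restrictAlg R B) f)

theorem extLift_extHom (f : A →ₐ[R] restrictAlg R B) (a : A) :
    (extLift f).hom (extHom R K A a) = f a := by
  change AlgHom.liftEquiv R K A (restrictAlg R B) f (1 ⊗ₜ a) = f a
  exact liftEquiv_one_tmul (C := restrictAlg R B) f a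

variable (K) {V : Type u} [AddCommGroup V] [Module R V] [Module K V] [IsScalarTower R K V]

variable (A V) in
/-- The bijection `A ⊗_R V ≃ (K ⊗_R A) ⊗_K V`, `a ⊗ v ↦ (1 ⊗ a) ⊗ v`. -/
def extTensor : A ⊗[R] V ≃+ extAlg R K A ⊗[K] V :=
  ((TensorProduct.comm R A V).toAddEquiv.trans
    (AlgebraTensorModule.cancelBaseChange R K K V A).symm.toAddEquiv).trans
      (TensorProduct.comm K V (K ⊗[R] A)).toAddEquiv

theorem extTensor_tmul (a : A) (v : V) :
    extTensor K A V (a ⊗ₜ v) = extHom R K A a ⊗ₜ[K] v := rfl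

theorem extTensor_smul (a : A) (z : A ⊗[R] V) :
    extTensor K A V (a • z) = extHom R K A a • extTensor K A V z := by
  induction z with
  | zero => simp
  | add x y hx hy => simp only [smul_add, map_add, hx, hy]
  | tmul b v =>
    rw [TensorProduct.smul_tmul', extTensor_tmul, extTensor_tmul, TensorProduct.smul_tmul',
      smul_eq_mul, smul_eq_mul, map_mul]

theorem extTensor_scalar_smul (r : R) (z : A ⊗[R] V) :
    extTensor K A V (r • z) = algebraMap R K r • extTensor K A V z := by
  induction z with
  | zero => simp
  | add x y hx hy => simp only [smul_add, map_add, hx, hy]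
  | tmul b v =>
    rw [← TensorProduct.tmul_smul, extTensor_tmul, extTensor_tmul, tmul_restrictScalars_smul]

variable {K}

theorem scalarMap_extLift_extTensor (f : A →ₐ[R] A') (f' : A' →ₐ[R] restrictAlg R B)
    (z : A ⊗[R] V) :
    scalarMap (extLift (f'.comp f)).hom V (extTensor K A V z) =
      scalarMap (extLift f').hom V (extTensor K A' V (scalarMap f V z)) := by
  induction z with
  | zero => simp
  | add x y hx hy => simp only [map_add, hx, hy]
  | tmul a v =>
    rw [LinearMap.rTensor_tmul, extTensor_tmul, extTensor_tmul, LinearMap.rTensor_tmul,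
      LinearMap.rTensor_tmul]
    simp only [AlgHom.toLinearMap_apply]
    rw [extLift_extHom, extLift_extHom]
    rfl

theorem scalarMap_extLift_extHom (z : extAlg R K A ⊗[K] V) :
    scalarMap (extLift (extHom R K A)).hom V z = z := by
  obtain ⟨z, rfl⟩ := (extTensor K A V).surjective z
  induction z with
  | zero => simp
  | add x y hx hy => simp only [map_add, hx, hy]
  | tmul a v =>
    rw [extTensor_tmul, LinearMap.rTensor_tmul]
    simp only [AlgHom.toLinearMap_apply]
    rw [extLift_extHom]

/-- For an `R`-linear map `i : M → V` to a `K`-module, the two ways to map `A ⊗ M` to `B ⊗ V`. -/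
theorem baseChange_cancel_symm {M : Type u} [AddCommGroup M] [Module R M] (i : M →ₗ[R] V)
    (f : A →ₐ[R] restrictAlg R B) (z : A ⊗[R] M) :
    (i.liftBaseChange K).baseChange B ((AlgebraTensorModule.cancelBaseChange R K (restrictAlg R B)
        (restrictAlg R B) M).symm (scalarMap f M z)) =
      scalarMap (extLift f).hom V (extTensor K A V (i.lTensor A z)) := by
  induction z with
  | zero => simp
  | add x y hx hy => simp only [map_add, hx, hy]
  | tmul a m =>
    rw [LinearMap.lTensor_tmul, extTensor_tmul, LinearMap.rTensor_tmul, LinearMap.rTensor_tmul]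
    simp only [AlgHom.toLinearMap_apply]
    rw [extLift_extHom, AlgebraTensorModule.cancelBaseChange_symm_tmul]
    refine (LinearMap.baseChange_tmul ..).trans ?_
    rw [LinearMap.liftBaseChange_tmul, one_smul]

end ExtLift

section Lattice

variable {R : Type u} [CommRing R] {K : Type u} [Field K] [Algebra R K]
  {T : Type w} [Category.{v} T] [EssentiallySmall.{u} T] [Abelian T] [Linear R T]
  [MonoidalCategory T] [BraidedCategory T]
  {ω : T ⥤ ModuleCat.{u} R} [ω.Braided] [ω.Additive] [ω.Linear R] (h : IsTannakian R ω)
  (W : FinRep ((tensorAutFunctor ω).baseChange K)) [Module R W.V] [IsScalarTower R K W.V]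

/-- The comodule structure on the restriction of scalars of a representation of `G_K`. -/
def genericCoaction : W.V →ₗ[R] Coord h ⊗[R] W.V where
  toFun v := (extTensor K (Coord h) W.V).symm
    ((W.ρ (extAlg R K (Coord h)) (pointAut h (extHom R K (Coord h)))).1 (1 ⊗ₜ v))
  map_add' v w := by rw [TensorProduct.tmul_add, map_add, map_add]
  map_smul' r v := by
    rw [AddEquiv.symm_apply_eq, RingHom.id_apply, extTensor_scalar_smul, AddEquiv.apply_symm_apply,
      tmul_restrictScalars_smul]
    exact LinearMap.map_smul_of_tower _ (algebraMap R K r) _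

/-- The point `extHom R K (Coord h)` is universal for `G_K`: every `f` factors through it by
`extLift f`. Naturality then expresses the action of `f` by the coaction. -/
theorem action_one_tmul {B : CommAlgCat.{u} K} (f : Coord h →ₐ[R] restrictAlg R B) (v : W.V) :
    (W.ρ B (pointAut (A := restrictAlg R B) h f)).1 (1 ⊗ₜ v) =
      scalarMap (extLift f).hom W.V (extTensor K (Coord h) W.V (genericCoaction h W v)) := by
  have h1 : ((tensorAutFunctor ω).baseChange K).map (extLift f)
      (pointAut h (extHom R K (Coord h))) = pointAut (A := restrictAlg R B) h f :=
    (map_pointAut h ((restrictAlgFunctor R K).map (extLift f)) (extHom R K (Coord h))).trans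
      (congrArg (pointAut (A := restrictAlg R B) h) (AlgHom.ext fun a => extLift_extHom f a))
  rw [← h1]
  refine (congrArg (fun g => g.1 ((1 : B) ⊗ₜ[K] v)) (W.naturality (extLift f) _)).trans ?_
  have h2 : (1 : B) ⊗ₜ[K] v = scalarMap (extLift f).hom W.V (1 ⊗ₜ v) := by
    rw [LinearMap.rTensor_tmul, AlgHom.toLinearMap_apply, map_one]
  rw [h2, glMap_scalarMap]
  exact congrArg _ ((extTensor K (Coord h) W.V).apply_symm_apply _).symm

/-- For an `R`-algebra `A`, the coaction lets `G(A)` act on `A ⊗ W ≃ (K ⊗ A) ⊗_K W` through `G(A) →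
G(K ⊗ A)`. The comodule axioms for `W` thus follow from the group action. -/
theorem extTensor_act {A : Type u} [CommRing A] [Algebra R A] (f : Coord h →ₐ[R] A)
    (z : A ⊗[R] W.V) :
    extTensor K A W.V (act (genericCoaction h W) f z) =
      (W.ρ (extAlg R K A) (pointAut h ((extHom R K A).comp f))).1 (extTensor K A W.V z) := by
  induction z with
  | zero => simp
  | add x y hx hy => simp only [map_add, hx, hy]
  | tmul a v =>
    have h1 : extTensor K A W.V (a ⊗ₜ v) =
        extHom R K A a • (1 : extAlg R K A) ⊗ₜ[K] v := by
      rw [extTensor_tmul, TensorProduct.smul_tmul', smul_eq_mul, mul_one]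
    have h2 := action_one_tmul h W ((extHom R K A).comp f) v
    rw [scalarMap_extLift_extTensor, scalarMap_extLift_extHom] at h2
    rw [h1, map_smul, act_tmul, extTensor_smul]
    exact congrArg _ h2.symm

/-- The action of `G(A)` on `(K ⊗ A) ⊗_K W` through `G(A) → G(K ⊗ A)`. -/
def genericAction (A : Type u) [CommRing A] [Algebra R A] :
    tensorAut ω A →* LinearMap.GeneralLinearGroup (extAlg R K A) (extAlg R K A ⊗[K] W.V) :=
  (W.ρ (extAlg R K A)).comp ((tensorAutFunctor ω).map (CommAlgCat.ofHom (X := A)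
    (Y := restrictAlg R (extAlg R K A)) (extHom R K A))).hom

theorem extTensor_act_symm {A : Type u} [CommRing A] [Algebra R A] (g : tensorAut ω A)
    (z : A ⊗[R] W.V) :
    extTensor K A W.V (act (genericCoaction h W) ((pointEquiv A h).symm g) z) =
      (genericAction W A g).1 (extTensor K A W.V z) := by
  obtain ⟨f, rfl⟩ := (pointEquiv A h).surjective g
  rw [Equiv.symm_apply_apply, extTensor_act]
  refine congrArg (fun g => (W.ρ (extAlg R K A) g).1 (extTensor K A W.V z)) ?_
  exact (map_pointAut h (CommAlgCat.ofHom (X := A)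
    (Y := restrictAlg R (extAlg R K A)) (extHom R K A)) f).symm

theorem isComodule_genericCoaction : IsComodule h (genericCoaction h W) where
  act_one A _ _ := by
    refine LinearMap.ext fun z => (extTensor K A W.V).injective ?_
    rw [extTensor_act_symm, map_one]
    rfl
  act_mul A _ _ g g' := by
    refine LinearMap.ext fun z => (extTensor K A W.V).injective ?_
    rw [Module.End.mul_apply, extTensor_act_symm, extTensor_act_symm, extTensor_act_symm, map_mul]
    rfl

/-- Both sides are `B`-linear, so the vectors `1 ⊗ (1 ⊗ x)` suffice, and on these the claim is the
equivariance of `i` pushed forward along `f`. -/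
theorem comm_of_isEquivariant_genericCoaction {X : T} {i : ω.obj X →ₗ[R] W.V}
    (hi : IsEquivariant h (genericCoaction h W) i) (B : CommAlgCat.{u} K)
    (g : ((tensorAutFunctor ω).baseChange K).obj B) (z : B ⊗[K] (K ⊗[R] ω.obj X)) :
    (i.liftBaseChange K).baseChange B ((glRestrict R B _ (g.1 X)).1 z) =
      (W.ρ B g).1 ((i.liftBaseChange K).baseChange B z) := by
  obtain ⟨f, rfl⟩ := (pointEquiv (restrictAlg R B) h).surjective g
  have key : (i.liftBaseChange K).baseChange B ∘ₗ
      (glRestrict R B _ ((pointAut (A := restrictAlg R B) h f).1 X)).1 =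
        (W.ρ B (pointAut (A := restrictAlg R B) h f)).1 ∘ₗ (i.liftBaseChange K).baseChange B := by
    refine ext_one_tmul_one_tmul fun x => ?_
    rw [LinearMap.comp_apply, LinearMap.comp_apply, LinearMap.baseChange_tmul,
      LinearMap.liftBaseChange_tmul, one_smul]
    refine Eq.trans ?_ (action_one_tmul h W f (i x)).symm
    rw [← hi, ← baseChange_cancel_symm]
    congr 1
    rw [LinearEquiv.eq_symm_apply]
    refine (cancel_glExt (A := restrictAlg R B) _ _).trans ?_
    refine (congrArg (act (coaction h X) f)
      (cancelBaseChange_one_tmul (C := restrictAlg R B) x)).trans ?_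
    exact act_one_tmul _ _ _
  exact LinearMap.congr_fun key z

end Lattice

/-! ### Lattices in representations of `G_K`, and essential surjectivity. -/

section Generic

variable {R : Type u} [CommRing R] [IsDedekindDomain R] {K : Type u} [Field K] [Algebra R K]
  [IsFractionRing R K]

theorem liftBaseChange_injective {M V : Type u} [AddCommGroup M] [Module R M] [AddCommGroup V]
    [Module R V] [Module K V] [IsScalarTower R K V] {i : M →ₗ[R] V} (hi : Function.Injective i) :
    Function.Injective (i.liftBaseChange K) := by
  rw [injective_iff_map_eq_zero]
  intro z hz
  obtain ⟨⟨m, s⟩, hs⟩ := IsLocalizedModule.surj (nonZeroDivisors R) (TensorProduct.mk R K M 1) z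
  have hs' : algebraMap R K s • z = 1 ⊗ₜ m := (algebraMap_smul K (s : R) z).trans hs
  have hm : i m = 0 := by
    have := congrArg (i.liftBaseChange K) hs'
    rwa [map_smul, hz, smul_zero, LinearMap.liftBaseChange_tmul, one_smul, eq_comm] at this
  rw [hi (hm.trans (map_zero i).symm), TensorProduct.tmul_zero] at hs'
  exact (smul_eq_zero_iff_right
    (IsFractionRing.to_map_ne_zero_of_mem_nonZeroDivisors s.2)).mp hs'

theorem liftBaseChange_surjective {M V : Type u} [AddCommGroup M] [Module R M] [AddCommGroup V]
    [Module R V] [Module K V] [IsScalarTower R K V] {i : M →ₗ[R] V} {s : Set V}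
    (hs : Submodule.span K s = ⊤) (hi : s ⊆ i.range) :
    Function.Surjective (i.liftBaseChange K) := by
  rw [← LinearMap.range_eq_top, ← top_le_iff, ← hs, Submodule.span_le]
  intro v hv
  obtain ⟨m, rfl⟩ := hi hv
  exact ⟨1 ⊗ₜ m, by simp⟩

variable (K) in
-- A submodule of a `K`-vector space is torsion-free over `R`, and torsion-free modules over a
-- Dedekind domain are flat.
theorem flat_of_injective {M V : Type u} [AddCommGroup M] [Module R M] [AddCommGroup V]
    [Module R V] [Module K V] [IsScalarTower R K V] {i : M →ₗ[R] V} (hi : Function.Injective i) :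
    Module.Flat R M := by
  have : Module.IsTorsionFree R V := .trans K
  have : Module.IsTorsionFree R M := hi.moduleIsTorsionFree i (fun r m => map_smul i r m)
  infer_instance

variable {T : Type w} [Category.{v} T] [EssentiallySmall.{u} T] [Abelian T] [Linear R T]
  [MonoidalCategory T] [BraidedCategory T] [MonoidalPreadditive T]
  {ω : T ⥤ ModuleCat.{u} R} [ω.Braided] [ω.Additive] [ω.Linear R] (h : IsTannakian R ω)

theorem genericFunctor_essSurj : (genericFunctor K ω h).EssSurj where
  mem_essImage W := by
    let : Module R W.V := Module.compHom W.V (algebraMap R K)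
    have : IsScalarTower R K W.V := IsScalarTower.of_algebraMap_smul fun _ _ => rfl
    obtain ⟨s, hs⟩ := Module.Finite.fg_top (R := K) (M := W.V)
    -- The `R`-span of finitely many `K`-generators of `W` is finitely generated, so one rigid `P`
    -- covers it. The image of `ω(P)` is a subcomodule `ω(X)` that spans `W` over `K`.
    obtain ⟨P, hP, m, hm, hsm⟩ := (isComodule_genericCoaction h W).exists_isEquivariant_of_fg
      (N := Submodule.span R s) ⟨s, rfl⟩
    obtain ⟨X, π, i, hi, hinj, rfl⟩ := hm.exists_factor hP
    have hsi : (s : Set W.V) ⊆ i.range := fun v hv =>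
      (LinearMap.range_comp_le_range (ω.map π).hom i) (hsm (Submodule.subset_span hv))
    have := flat_of_injective K hinj
    have hX : rigid T X := h.rigid_of_flat X
    refine ⟨⟨⟨X, hX⟩⟩, ⟨FinRep.isoMk (X := (genericFunctor K ω h).obj ⟨⟨X, hX⟩⟩)
      (LinearEquiv.ofBijective (i.liftBaseChange K)
        ⟨liftBaseChange_injective hinj, liftBaseChange_surjective hs hsi⟩) ?_⟩⟩
    exact comm_of_isEquivariant_genericCoaction h W hi

theorem genericFunctor_isEquivalence : (genericFunctor K ω h).IsEquivalence where
  faithful := genericFunctor_faithful h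
  full := genericFunctor_full h
  essSurj := genericFunctor_essSurj h

end Generic

/-! ### The tensor structure of the functor on the generic fibre. -/

section Ext

variable {R K : Type u} [CommRing R] [CommRing K] [Algebra R K] {A : Type u} [CommRing A]
  [Algebra R A] [Algebra K A] [IsScalarTower R K A]
  {M N : Type u} [AddCommGroup M] [Module R M] [AddCommGroup N] [Module R N]

/-- Base change in two stages is compatible with tensor products. This reduces equivariance of the
tensor constraint over `K` to the tensor condition on `g` over `R`. -/
theorem cancel_distrib_pair (x : A ⊗[K] (K ⊗[R] M)) (y : A ⊗[K] (K ⊗[R] N)) :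
    AlgebraTensorModule.cancelBaseChange R K A A (M ⊗[R] N)
        ((AlgebraTensorModule.distribBaseChange R K M N).symm.toLinearMap.baseChange A (pair x y)) =
      pair (AlgebraTensorModule.cancelBaseChange R K A A M x)
        (AlgebraTensorModule.cancelBaseChange R K A A N y) := by
  induction x with
  | zero => simp
  | add x x' hx hx' => simp only [pair_add_left, map_add, hx, hx']
  | tmul a x =>
    induction x with
    | zero => simp
    | add x x' hx hx' => simp only [TensorProduct.tmul_add, pair_add_left, map_add, hx, hx']
    | tmul k m =>
      induction y with
      | zero => simp
      | add y y' hy hy' => simp only [pair_add_right, map_add, hy, hy']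
      | tmul b y =>
        induction y with
        | zero => simp
        | add y y' hy hy' => simp only [TensorProduct.tmul_add, pair_add_right, map_add, hy, hy']
        | tmul l n =>
          simp [AlgebraTensorModule.distribBaseChange_symm_tmul, Algebra.smul_def]
          congr 1
          ring

end Ext

section GenericTensor

variable {R K : Type u} [CommRing R] [CommRing K] [Algebra R K]
  {T : Type w} [Category.{v} T] [MonoidalCategory T]
  (ω : T ⥤ ModuleCat.{u} R) [ω.Monoidal]

variable (K) in
/-- The isomorphism `K ≃ K ⊗ ω(1)`. -/
def genericε : K ≃ₗ[K] K ⊗[R] ω.obj (𝟙_ T) :=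
  (AlgebraTensorModule.rid R K K).symm ≪≫ₗ
    (Functor.Monoidal.εIso ω).toLinearEquiv.baseChange R K R (ω.obj (𝟙_ T))

variable (K) in
/-- The isomorphism `(K ⊗ ω(X)) ⊗_K (K ⊗ ω(Y)) ≃ K ⊗ ω(X ⊗ Y)`. -/
def genericμ (X Y : T) : (K ⊗[R] ω.obj X) ⊗[K] (K ⊗[R] ω.obj Y) ≃ₗ[K] K ⊗[R] ω.obj (X ⊗ Y) :=
  (AlgebraTensorModule.distribBaseChange R K (ω.obj X) (ω.obj Y)).symm ≪≫ₗ
    (Functor.Monoidal.μIso ω X Y).toLinearEquiv.baseChange R K (ω.obj X ⊗[R] ω.obj Y) _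

variable (K) in
theorem genericε_apply (k : K) : genericε K ω k = k ⊗ₜ (Functor.LaxMonoidal.ε ω).hom (1 : R) := rfl

theorem genericμ_tmul {X Y : T} (x : K ⊗[R] ω.obj X) (y : K ⊗[R] ω.obj Y) :
    genericμ K ω X Y (x ⊗ₜ y) =
      (Functor.LaxMonoidal.μ ω X Y).hom.baseChange K (pair x y) := rfl

theorem genericμ_tmul_tmul {X Y : T} (k l : K) (x : ω.obj X) (y : ω.obj Y) :
    genericμ K ω X Y ((k ⊗ₜ[R] x) ⊗ₜ (l ⊗ₜ[R] y)) =
      (k * l) ⊗ₜ (Functor.LaxMonoidal.μ ω X Y).hom (x ⊗ₜ[R] y) := by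
  rw [genericμ_tmul, pair_tmul]
  rfl

variable {ω} {A : CommAlgCat.{u} K} (g : tensorAut ω (restrictAlg R A))

theorem genericε_comm (x : A ⊗[K] K) :
    (genericε K ω).toLinearMap.baseChange A x =
      (glRestrict R A _ (g.1 (𝟙_ T))).1 ((genericε K ω).toLinearMap.baseChange A x) := by
  apply (AlgebraTensorModule.cancelBaseChange R K (restrictAlg R A) (restrictAlg R A) _).injective
  have h1 := cancel_glExt (K := K) (g.1 (𝟙_ T)) ((genericε K ω).toLinearMap.baseChange A x)
  refine Eq.trans ?_ h1.symm
  have h2 : (AlgebraTensorModule.cancelBaseChange R K (restrictAlg R A) (restrictAlg R A) _)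
      ((genericε K ω).toLinearMap.baseChange A x) =
      (Functor.LaxMonoidal.ε ω).hom.baseChange (restrictAlg R A)
        (AlgebraTensorModule.cancelBaseChange R K (restrictAlg R A) (restrictAlg R A) R
          ((AlgebraTensorModule.rid R K K).symm.toLinearMap.baseChange A x)) := by
    refine Eq.trans ?_ (cancel_baseChange (K := K) (A := restrictAlg R A) _ _)
    refine congrArg _ ?_
    refine LinearMap.congr_fun (LinearMap.baseChange_comp (A := A) _ _) x
  rw [h2]
  exact g.2.2.2 _

theorem genericμ_comm (X Y : T) (x : A ⊗[K] (K ⊗[R] ω.obj X)) (y : A ⊗[K] (K ⊗[R] ω.obj Y)) :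
    (genericμ K ω X Y).toLinearMap.baseChange A
        (pair ((glRestrict R A _ (g.1 X)).1 x) ((glRestrict R A _ (g.1 Y)).1 y)) =
      (glRestrict R A _ (g.1 (X ⊗ Y))).1
        ((genericμ K ω X Y).toLinearMap.baseChange A (pair x y)) := by
  have h2 : ∀ x y, (AlgebraTensorModule.cancelBaseChange R K (restrictAlg R A) (restrictAlg R A) _)
      ((genericμ K ω X Y).toLinearMap.baseChange A (pair x y)) =
      (Functor.LaxMonoidal.μ ω X Y).hom.baseChange (restrictAlg R A)
        (pair (AlgebraTensorModule.cancelBaseChange R K (restrictAlg R A) (restrictAlg R A) _ x)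
          (AlgebraTensorModule.cancelBaseChange R K (restrictAlg R A) (restrictAlg R A) _ y)) := by
    intro x y
    refine Eq.trans ?_ (congrArg _ (cancel_distrib_pair (K := K) (A := restrictAlg R A) x y))
    refine Eq.trans ?_ (cancel_baseChange (K := K) (A := restrictAlg R A) _ _)
    refine congrArg _ ?_
    refine LinearMap.congr_fun (LinearMap.baseChange_comp (A := A) _ _) (pair x y)
  apply (AlgebraTensorModule.cancelBaseChange R K (restrictAlg R A) (restrictAlg R A) _).injective
  have h1 := cancel_glExt (K := K) (g.1 (X ⊗ Y))
    ((genericμ K ω X Y).toLinearMap.baseChange A (pair x y))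
  refine Eq.trans ?_ h1.symm
  rw [h2, h2]
  refine Eq.trans ?_ (g.2.2.1 X Y _)
  rw [glTensor_pair]
  exact congrArg₂ (fun x y => (Functor.LaxMonoidal.μ ω X Y).hom.baseChange (restrictAlg R A)
    (pair x y)) (cancel_glExt (K := K) (g.1 X) x) (cancel_glExt (K := K) (g.1 Y) y)

end GenericTensor

section GenericTensor

variable {R K : Type u} [CommRing R] [CommRing K] [Algebra R K]
  {T : Type w} [Category.{v} T] [MonoidalCategory T] {ω : T ⥤ ModuleCat.{u} R} [ω.Monoidal]

theorem ext_tmul_tmul {M N Q : Type u} [AddCommGroup M] [Module R M] [AddCommGroup N] [Module R N]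
    [AddCommGroup Q] [Module K Q] {f g : (K ⊗[R] M) ⊗[K] (K ⊗[R] N) →ₗ[K] Q}
    (hfg : ∀ x y, f ((1 ⊗ₜ x) ⊗ₜ (1 ⊗ₜ y)) = g ((1 ⊗ₜ x) ⊗ₜ (1 ⊗ₜ y))) : f = g := by
  refine TensorProduct.ext (ext_one_tmul fun x => ext_one_tmul fun y => ?_)
  exact hfg x y

theorem genericμ_natural {X X' Y Y' : T} (f : X ⟶ X') (g : Y ⟶ Y') :
    (genericμ K ω X' Y').toLinearMap ∘ₗ
        TensorProduct.map ((ω.map f).hom.baseChange K) ((ω.map g).hom.baseChange K) =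
      (ω.map (f ⊗ₘ g)).hom.baseChange K ∘ₗ (genericμ K ω X Y).toLinearMap :=
  ext_tmul_tmul fun x y => by
    simp only [LinearMap.comp_apply, TensorProduct.map_tmul, LinearMap.baseChange_tmul,
      LinearEquiv.coe_coe, genericμ_tmul_tmul, map_μ]

theorem genericμ_associator {X Y Z : T} (x : K ⊗[R] ω.obj X) (y : K ⊗[R] ω.obj Y)
    (z : K ⊗[R] ω.obj Z) :
    (ω.map (α_ X Y Z).hom).hom.baseChange K
        (genericμ K ω _ _ (genericμ K ω _ _ (x ⊗ₜ y) ⊗ₜ z)) =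
      genericμ K ω _ _ (x ⊗ₜ genericμ K ω _ _ (y ⊗ₜ z)) := by
  induction x with
  | zero => simp
  | add x x' hx hx' => simp only [TensorProduct.add_tmul, map_add, hx, hx']
  | tmul k x =>
    induction y with
    | zero => simp
    | add y y' hy hy' => simp only [TensorProduct.add_tmul, TensorProduct.tmul_add, map_add, hy, hy']
    | tmul l y =>
      induction z with
      | zero => simp
      | add y y' hy hy' => simp only [TensorProduct.tmul_add, map_add, hy, hy']
      | tmul m z =>
        rw [genericμ_tmul_tmul, genericμ_tmul_tmul, genericμ_tmul_tmul, genericμ_tmul_tmul,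
          LinearMap.baseChange_tmul, map_associator_μ, mul_assoc]

theorem genericμ_leftUnitor {X : T} (k : K) (x : K ⊗[R] ω.obj X) :
    (ω.map (λ_ X).hom).hom.baseChange K (genericμ K ω _ _ (genericε K ω k ⊗ₜ x)) = k • x := by
  induction x with
  | zero => simp
  | add x x' hx hx' => simp only [TensorProduct.tmul_add, map_add, smul_add, hx, hx']
  | tmul l x =>
    rw [genericε_apply, genericμ_tmul_tmul, LinearMap.baseChange_tmul, map_leftUnitor_μ, one_smul,
      TensorProduct.smul_tmul', smul_eq_mul]

theorem genericμ_rightUnitor {X : T} (k : K) (x : K ⊗[R] ω.obj X) :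
    (ω.map (ρ_ X).hom).hom.baseChange K (genericμ K ω _ _ (x ⊗ₜ genericε K ω k)) = k • x := by
  induction x with
  | zero => simp
  | add x x' hx hx' => simp only [TensorProduct.add_tmul, map_add, smul_add, hx, hx']
  | tmul l x =>
    have h1 : (ω.map (ρ_ X).hom).hom ((Functor.LaxMonoidal.μ ω _ _).hom
        (x ⊗ₜ[R] (Functor.LaxMonoidal.ε ω).hom (1 : R))) = (1 : R) • x :=
      (congrArg (fun k => k.hom (x ⊗ₜ[R] (1 : R))) (Functor.LaxMonoidal.right_unitality ω X)).symm
    rw [genericε_apply, genericμ_tmul_tmul, LinearMap.baseChange_tmul, h1, one_smul,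
      TensorProduct.smul_tmul', smul_eq_mul, mul_comm]

theorem genericμ_braiding [BraidedCategory T] {ω : T ⥤ ModuleCat.{u} R} [ω.Braided] {X Y : T}
    (x : K ⊗[R] ω.obj X) (y : K ⊗[R] ω.obj Y) :
    (ω.map (β_ X Y).hom).hom.baseChange K (genericμ K ω _ _ (x ⊗ₜ y)) =
      genericμ K ω _ _ (y ⊗ₜ x) := by
  induction x with
  | zero => simp
  | add x x' hx hx' => simp only [TensorProduct.add_tmul, TensorProduct.tmul_add, map_add, hx, hx']
  | tmul k x =>
    induction y with
    | zero => simp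
    | add y y' hy hy' => simp only [TensorProduct.add_tmul, TensorProduct.tmul_add, map_add, hy, hy']
    | tmul l y =>
      have h1 : (ω.map (β_ X Y).hom).hom ((Functor.LaxMonoidal.μ ω _ _).hom (x ⊗ₜ[R] y)) =
          (Functor.LaxMonoidal.μ ω _ _).hom (y ⊗ₜ[R] x) :=
        congrArg (fun k => k.hom (x ⊗ₜ[R] y)) (Functor.LaxBraided.braided (F := ω) X Y)
      rw [genericμ_tmul_tmul, genericμ_tmul_tmul, LinearMap.baseChange_tmul, h1, mul_comm]

end GenericTensor

section GenericFunctor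

variable {R K : Type u} [CommRing R] [Field K] [Algebra R K]
  {T : Type w} [Category.{v} T] [Abelian T] [Linear R T] [MonoidalCategory T]
  [MonoidalPreadditive T] [MonoidalLinear R T]
  {ω : T ⥤ ModuleCat.{u} R} [ω.Additive] [ω.Linear R]

/-- Both sides are biadditive in `f` and `g`; on pure tensors the scalars come out and the
naturality of `μ` remains. -/
theorem genericμ_map_tensorMap [ω.Monoidal] (h : IsTannakian R ω)
    {X X' Y Y' : ScalarExt R K (rigid T).FullSubcategory} (f : X ⟶ X') (g : Y ⟶ Y') :
    (genericμ K ω X'.as.obj Y'.as.obj).toLinearMap ∘ₗ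
        TensorProduct.map ((genericFunctor K ω h).map f).hom ((genericFunctor K ω h).map g).hom =
      ((genericFunctor K ω h).map (ScalarExt.tensorMap f g)).hom ∘ₗ
        (genericμ K ω X.as.obj Y.as.obj).toLinearMap := by
  induction f using ScalarExt.hom_induction with
  | zero =>
    rw [ScalarExt.zero_tensorMap, Functor.map_zero, Functor.map_zero]
    refine (congrArg _ (TensorProduct.map_zero_left _)).trans ?_
    exact (LinearMap.comp_zero _).trans (LinearMap.zero_comp _).symm
  | add f f' hf hf' =>
    rw [ScalarExt.add_tensorMap, Functor.map_add, Functor.map_add]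
    refine (congrArg _ (TensorProduct.map_add_left _ _ _)).trans ?_
    exact (LinearMap.comp_add _ _ _).trans
      ((congrArg₂ (· + ·) hf hf').trans (LinearMap.add_comp _ _ _).symm)
  | tmul a f =>
    induction g using ScalarExt.hom_induction with
    | zero =>
      rw [ScalarExt.tensorMap_zero, Functor.map_zero, Functor.map_zero]
      refine (congrArg _ (TensorProduct.map_zero_right _)).trans ?_
      exact (LinearMap.comp_zero _).trans (LinearMap.zero_comp _).symm
    | add f f' hf hf' =>
      rw [ScalarExt.tensorMap_add, Functor.map_add, Functor.map_add]
      refine (congrArg _ (TensorProduct.map_add_right _ _ _)).trans ?_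
      exact (LinearMap.comp_add _ _ _).trans
        ((congrArg₂ (· + ·) hf hf').trans (LinearMap.add_comp _ _ _).symm)
    | tmul b g =>
      rw [ScalarExt.tensorMap_tmulHom, genericFunctor_map_tmulHom, genericFunctor_map_tmulHom,
        genericFunctor_map_tmulHom]
      refine (congrArg _ (TensorProduct.map_smul_left a _ _)).trans ?_
      refine (congrArg (fun k => _ ∘ₗ (a • k)) (TensorProduct.map_smul_right b _ _)).trans ?_
      rw [smul_smul]
      refine (LinearMap.comp_smul _ _ _).trans ?_
      exact (congrArg _ (genericμ_natural f.hom g.hom)).trans (LinearMap.smul_comp _ _ _).symm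

end GenericFunctor

section FinRepTensor

variable {R : Type u} [CommRing R] {G : GroupFunctor.{w} R}

theorem FinRep.whiskerRight_hom {X Y : FinRep G} (f : X ⟶ Y) (Z : FinRep G) :
    (f ▷ Z).hom = TensorProduct.map f.hom LinearMap.id := rfl

theorem FinRep.whiskerLeft_hom {X Y : FinRep G} (Z : FinRep G) (f : X ⟶ Y) :
    (Z ◁ f).hom = TensorProduct.map LinearMap.id f.hom := rfl

theorem FinRep.associator_hom (X Y Z : FinRep G) :
    (α_ X Y Z).hom.hom = (TensorProduct.assoc R X.V Y.V Z.V).toLinearMap := rfl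

theorem FinRep.leftUnitor_hom (X : FinRep G) :
    (λ_ X).hom.hom = (TensorProduct.lid R X.V).toLinearMap := rfl

theorem FinRep.rightUnitor_hom (X : FinRep G) :
    (ρ_ X).hom.hom = (TensorProduct.rid R X.V).toLinearMap := rfl

theorem FinRep.braiding_hom (X Y : FinRep G) :
    (β_ X Y).hom.hom = (TensorProduct.comm R X.V Y.V).toLinearMap := rfl

end FinRepTensor

section GenericMonoidal

variable {R K : Type u} [CommRing R] [Field K] [Algebra R K]
  {T : Type w} [Category.{v} T] [Abelian T] [Linear R T] [MonoidalCategory T] [SymmetricCategory T]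
  [MonoidalPreadditive T] [MonoidalLinear R T]
  {ω : T ⥤ ModuleCat.{u} R} [ω.Additive] [ω.Linear R] [ω.Braided] (h : IsTannakian R ω)

variable (K) in
/-- The unit isomorphism of the functor `(T°)_K ⥤ Rep_f(G_K)`. -/
def genericεIso : 𝟙_ (FinRep ((tensorAutFunctor ω).baseChange K)) ≅
    (genericFunctor K ω h).obj (𝟙_ _) :=
  FinRep.isoMk (X := FinRep.unit) (Y := (genericFunctor K ω h).obj (𝟙_ _))
    (genericε K ω) fun _ g x => genericε_comm g x

/-- The tensor isomorphism of the functor `(T°)_K ⥤ Rep_f(G_K)`. -/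
def genericμIso (X Y : ScalarExt R K (rigid T).FullSubcategory) :
    (genericFunctor K ω h).obj X ⊗ (genericFunctor K ω h).obj Y ≅
      (genericFunctor K ω h).obj (X ⊗ Y) :=
  FinRep.isoMk
    (X := FinRep.tensor ((genericFunctor K ω h).obj X) ((genericFunctor K ω h).obj Y))
    (Y := (genericFunctor K ω h).obj (X ⊗ Y)) (genericμ K ω X.as.obj Y.as.obj)
    (FinRep.comm_of_pair _ fun _ g x y => genericμ_comm g X.as.obj Y.as.obj x y)

theorem genericεIso_hom : (genericεIso K h).hom.hom = (genericε K ω).toLinearMap := rfl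

theorem genericμIso_hom (X Y : ScalarExt R K (rigid T).FullSubcategory) :
    (genericμIso h X Y).hom.hom = (genericμ K ω X.as.obj Y.as.obj).toLinearMap := rfl

theorem genericμIso_natural_left {X Y : ScalarExt R K (rigid T).FullSubcategory} (f : X ⟶ Y)
    (Z : ScalarExt R K (rigid T).FullSubcategory) :
    (genericFunctor K ω h).map f ▷ (genericFunctor K ω h).obj Z ≫ (genericμIso h Y Z).hom =
      (genericμIso h X Z).hom ≫ (genericFunctor K ω h).map (f ▷ Z) := by
  refine FinRep.hom_ext ?_
  rw [FinRep.comp_hom, FinRep.comp_hom, FinRep.whiskerRight_hom, ← FinRep.id_hom,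
    ← (genericFunctor K ω h).map_id]
  exact genericμ_map_tensorMap h f (𝟙 Z)

theorem genericμIso_natural_right {X Y : ScalarExt R K (rigid T).FullSubcategory}
    (Z : ScalarExt R K (rigid T).FullSubcategory) (f : X ⟶ Y) :
    (genericFunctor K ω h).obj Z ◁ (genericFunctor K ω h).map f ≫ (genericμIso h Z Y).hom =
      (genericμIso h Z X).hom ≫ (genericFunctor K ω h).map (Z ◁ f) := by
  refine FinRep.hom_ext ?_
  rw [FinRep.comp_hom, FinRep.comp_hom, FinRep.whiskerLeft_hom, ← FinRep.id_hom,
    ← (genericFunctor K ω h).map_id]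
  exact genericμ_map_tensorMap h (𝟙 Z) f

/-- The constraints of the base change are `1 ⊗` those of `T`, so the functor only multiplies by the
scalar `1`. The same argument covers the unitors and the braiding below. -/
theorem genericFunctor_map_associator (X Y Z : ScalarExt R K (rigid T).FullSubcategory) :
    ((genericFunctor K ω h).map (α_ X Y Z).hom).hom =
      (ω.map (α_ X.as.obj Y.as.obj Z.as.obj).hom).hom.baseChange K :=
  one_smul K ((ω.map (α_ X.as.obj Y.as.obj Z.as.obj).hom).hom.baseChange K)

theorem genericFunctor_map_leftUnitor (X : ScalarExt R K (rigid T).FullSubcategory) :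
    ((genericFunctor K ω h).map (λ_ X).hom).hom = (ω.map (λ_ X.as.obj).hom).hom.baseChange K :=
  one_smul K ((ω.map (λ_ X.as.obj).hom).hom.baseChange K)

theorem genericFunctor_map_rightUnitor (X : ScalarExt R K (rigid T).FullSubcategory) :
    ((genericFunctor K ω h).map (ρ_ X).hom).hom = (ω.map (ρ_ X.as.obj).hom).hom.baseChange K :=
  one_smul K ((ω.map (ρ_ X.as.obj).hom).hom.baseChange K)

theorem genericFunctor_map_braiding (X Y : ScalarExt R K (rigid T).FullSubcategory) :
    ((genericFunctor K ω h).map (β_ X Y).hom).hom =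
      (ω.map (β_ X.as.obj Y.as.obj).hom).hom.baseChange K :=
  one_smul K ((ω.map (β_ X.as.obj Y.as.obj).hom).hom.baseChange K)

variable (K) in
/-- The tensor structure of the functor `(T°)_K ⥤ Rep_f(G_K)`. -/
def genericCore : (genericFunctor K ω h).CoreMonoidal where
  εIso := genericεIso K h
  μIso X Y := genericμIso h X Y
  μIso_hom_natural_left f Z := genericμIso_natural_left h f Z
  μIso_hom_natural_right Z f := genericμIso_natural_right h Z f
  associativity X Y Z := by
    refine FinRep.hom_ext ?_
    rw [FinRep.comp_hom, FinRep.comp_hom, FinRep.comp_hom, FinRep.comp_hom,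
      genericFunctor_map_associator, FinRep.whiskerLeft_hom, FinRep.whiskerRight_hom,
      FinRep.associator_hom, genericμIso_hom, genericμIso_hom, genericμIso_hom, genericμIso_hom]
    exact TensorProduct.ext_threefold fun x y z => genericμ_associator (K := K) (ω := ω) x y z
  left_unitality X := by
    refine FinRep.hom_ext ?_
    rw [FinRep.comp_hom, FinRep.comp_hom, genericFunctor_map_leftUnitor, FinRep.whiskerRight_hom,
      FinRep.leftUnitor_hom, genericμIso_hom, genericεIso_hom]
    exact TensorProduct.ext' fun k x => (genericμ_leftUnitor (K := K) (ω := ω) k x).symm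
  right_unitality X := by
    refine FinRep.hom_ext ?_
    rw [FinRep.comp_hom, FinRep.comp_hom, genericFunctor_map_rightUnitor, FinRep.whiskerLeft_hom,
      FinRep.rightUnitor_hom, genericμIso_hom, genericεIso_hom]
    exact TensorProduct.ext' fun x k => (genericμ_rightUnitor (K := K) (ω := ω) k x).symm

variable (K) in
/-- The functor `(T°)_K ⥤ Rep_f(G_K)` as a symmetric monoidal functor. -/
abbrev genericBraided : (genericFunctor K ω h).Braided where
  __ := (genericCore K h).toMonoidal
  braided X Y := by
    refine FinRep.hom_ext ?_
    rw [FinRep.comp_hom, FinRep.comp_hom, genericFunctor_map_braiding, FinRep.braiding_hom]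
    exact TensorProduct.ext' fun x y => genericμ_braiding (K := K) (ω := ω) x y

end GenericMonoidal

end TannakaDedekind

end

theorem mainTheorem2 {R : Type u} [CommRing R] [IsDedekindDomain R]
    (K : Type u) [Field K] [Algebra R K] [IsFractionRing R K]
    {T : Type w} [Category.{v} T] [EssentiallySmall.{u} T] [Abelian T] [Linear R T]
    [MonoidalCategory T] [SymmetricCategory T] [MonoidalPreadditive T] [MonoidalLinear R T]
    (ω : T ⥤ ModuleCat.{u} R) [ω.Additive] [ω.Linear R] [ω.Braided]
    (h : IsTannakian R ω) :
    IsFlatAffineGroupScheme (tensorAutFunctor ω) ∧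
    (∀ A : CommAlgCat.{u} R, Function.Bijective (tensorAutRestrict (rigid T).ι ω A)) ∧
    (toRep ω h ⋙ FinRep.forget _ = ω ∧ (toRep ω h).IsEquivalence ∧ (toRep ω h).Linear R ∧
      ∃ _ : (toRep ω h).Braided,
        (Functor.LaxMonoidal.ε (toRep ω h)).hom = (Functor.LaxMonoidal.ε ω).hom ∧
        ∀ X Y : T, (Functor.LaxMonoidal.μ (toRep ω h) X Y).hom =
          (Functor.LaxMonoidal.μ ω X Y).hom) ∧
    ((genericFunctor K ω h).IsEquivalence ∧ (genericFunctor K ω h).Linear K ∧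
      ∃ _ : (genericFunctor K ω h).Braided,
        (Functor.LaxMonoidal.ε (genericFunctor K ω h)).hom (1 : K) =
          (1 : K) ⊗ₜ[R] (Functor.LaxMonoidal.ε ω).hom (1 : R) ∧
        ∀ (X Y : ScalarExt R K (rigid T).FullSubcategory)
          (x : K ⊗[R] ω.obj X.as.obj) (y : K ⊗[R] ω.obj Y.as.obj),
          (Functor.LaxMonoidal.μ (genericFunctor K ω h) X Y).hom (x ⊗ₜ[K] y) =
            (Functor.LaxMonoidal.μ ω X.as.obj Y.as.obj).hom.baseChange K (pair x y)) := by
  refine ⟨isFlatAffineGroupScheme_tensorAut h, fun A => tensorAutRestrict_bijective A h,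
    ⟨toRep_forget h, toRep_isEquivalence h, toRep_linear h, toRepBraided h, toRepBraided_ε h,
      toRepBraided_μ h⟩,
    genericFunctor_isEquivalence h, genericFunctor_linear h, genericBraided K h, rfl,
    fun _ _ _ _ => rfl⟩
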